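/- **Theorem 2.** Let $n\ge 1$ and let $M$ be an $n\times n$ integer matrix all of whose (complex) eigenvalues have absolute value greater than one; put $m=|\det M|$. Let $T\subset\mathbb R^n$ be a compact set whose translates $\{T+\nu\}_{\nu\in\mathbb Z^n}$ form a self-affine tiling for $M$: $\bigcup_{\nu\in\mathbb Z^n}(T+\nu)=\mathbb R^n$ with a.e. disjoint union, and $\bigcup_{d\in\Gamma_0}(T+d)=MT$ for a finite full set $\Gamma_0$ of representatives of $\mathbb Z^n/M\mathbb Z^n$. Let $\mathcal L^\infty$ be the space of measurable $\phi:\mathbb R^n\to\mathbb C$ with $\operatorname{ess\,sup}_{x\in T}\sum_{\nu\in\mathbb Z^n}|\phi(x-\nu)|<\infty$. Let $N\ge1$ and let $\Phi=\{\phi_1,\dots,\phi_N\}\subset\mathcal L^\infty$ * be $M$-refinable: there are $c_{jk}\in \ell^1(\mathbb Z^n)$ with $\phi_j(x)=\sum_{k=1}^N\sum_{\nu}c_{jk}(\nu)\phi_k(Mx-\nu)$ for a.e. $x$ and all $j$; and * have $L^2$-stable shifts: there are $C_1,C_2>0$ with $C_1\sum_j\|c_j\|_{\ell^2}\le\|\sum_j\sum_\nu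 c_j(\nu)\phi_j(\cdot-\nu)\|_2\le C_2\sum_j\|c_j\|_{\ell^2}$ for all $c_1,\dots,c_N\in \ell^2(\mathbb Z^n)$. Let $\lambda>1$, $\alpha>0$ and $1\le p,q\le\infty$ (sums $(\sum_l(\cdot)^q)^{1/q}$ are suprema for $q=\infty$, and $1/p=0$ for $p=\infty$). For $l\ge0$ let $V_l^p$ be the set of all functions $\sum_{j}\sum_{\nu}a_j(\nu)\phi_j(M^lx-\nu)$ with $a_j\in \ell^p(\mathbb Z^n)$, let $\sigma_l^p(f)=\inf_{S\in V_l^p}\|f-S\|_p$, and $$\|f\|_{B^{\alpha,\lambda}_{pq}(\Phi)}=\|f\|_p+\Big(\sum_{l=0}^\infty(\lambda^{l\alpha}\sigma_l^p(f))^q\Big)^{1/q}\in[0,\infty],\qquad f\in L^p(\mathbb R^n).$$ There is a family $\tilde\Phi=\{\tilde\phi_1,\dots,\tilde\phi_N\}\subset\mathcal L^\infty$ dual to $\Phi$, that is, $\int\phi_j(x-\mu)\overline{\tilde\phi_k(x-\nu)}\,dx=\delta_{\mu\nu}\delta_{jk}$ for all $j,k$ and $\mu,\nu\in\mathbb Z^n$.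 For every such $\tilde\Phi$ write $\langle f,g\rangle=\int f\bar g$ and $$P_lf(x)=\sum_{j=1}^N\sum_{\nu\in\mathbb Z^n}m^l\langle f,\tilde\phi_j(M^l\cdot-\nu)\rangle\,\phi_j(M^lx-\nu),\qquad R_lf=P_{l+1}f-P_lf .$$ Then for every $f\in L^p(\mathbb R^n)$ there are unique sequences $a_{jl}\in \ell^p(\mathbb Z^n)$ ($1\le j\le N$, $l\ge0$) with $P_0f=\sum_j\sum_\nu a_{j0}(\nu)\phi_j(x-\nu)$ and $R_lf=\sum_j\sum_\nu a_{j(l+1)}(\nu)\phi_j(M^{l+1}x-\nu)$ a.e. for all $l\ge0$, and on $L^p(\mathbb R^n)$ the norm $\|f\|_{B^{\alpha,\lambda}_{pq}(\Phi)}$ is equivalent to each of the following (each is bounded by a constant, independent of $f$, times the other; in particular if one of them is finite, so are all): (i) $\|f\|_p+\big(\sum_{l\ge0}(\lambda^{l\alpha}\|f-P_lf\|_p)^q\big)^{1/q}$; (ii) $\|P_0f\|_p+\big(\sum_{l\ge0}(\lambda^{l\alpha}\|R_lf\|_p)^q\big)^{1/q}$; (iii) $\big(\sum_{l\ge0}(\lambda^{l\alpha}m^{-l/p}\sum_{j=1}^N\|a_{jl}\|_{\ell^p})^q\big)^{1/q}$;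 (iv) $\inf\big(\sum_{l\ge0}(\lambda^{l\alpha}m^{-l/p}\sum_{j=1}^N\|c_{jl}\|_{\ell^p})^q\big)^{1/q}$, the infimum being over all $c_{jl}\in \ell^p(\mathbb Z^n)$ such that $f=\sum_{l=0}^\infty\big(\sum_{j}\sum_\nu c_{jl}(\nu)\phi_j(M^lx-\nu)\big)$ with the series over $l$ convergent in $L^p$ (and $\inf\emptyset=\infty$); (v) if $m>(n+1)/2$: there are functions $\psi_j^\epsilon\in\mathcal L^\infty$ ($1\le j\le N$, $1\le\epsilon\le m-1$) whose shifts $\psi_j^\epsilon(x-\nu)$, $\nu\in\mathbb Z^n$, form an orthonormal basis of $W_0=V_1^2\ominus V_0^2$ in $L^2(\mathbb R^n)$, and for every such family the norm is also equivalent to $$\sum_{j=1}^N\|a_{j0}\|_{\ell^p}+\Big(\sum_{l\ge0}\big(\lambda^{l\alpha}m^{l(1/2-1/p)}\sum_{j=1}^N\sum_{\epsilon=1}^{m-1}\|b_{jl}^\epsilon\|_{\ell^p}\big)^q\Big)^{1/q},$$ where $a_{j0}(\nu)=\langle f,\tilde\phi_j(\cdot-\nu)\rangle$ and $b_{jl}^\epsilon(\nu)=\langle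 f,m^{l/2}\psi_j^\epsilon(M^l\cdot-\nu)\rangle$. -/

import Mathlib

open MeasureTheory Filter Topology
open scoped ENNReal NNReal Matrix ComplexConjugate

noncomputable section

namespace SelfAffine

/-- A dilation matrix for the lattice `ℤⁿ`: an integer matrix all of whose complex eigenvalues have
absolute value greater than one. -/
def IsDilation {n : ℕ} (M : Matrix (Fin n) (Fin n) ℤ) : Prop :=
  ∀ z ∈ spectrum ℂ (M.map (Int.cast : ℤ → ℂ)), 1 < ‖z‖

/-- `m = |det M|`. -/
def idx {n : ℕ} (M : Matrix (Fin n) (Fin n) ℤ) : ℕ := M.det.natAbs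

/-- A lattice point regarded as a vector. -/
def vec {n : ℕ} (ν : Fin n → ℤ) : Fin n → ℝ := fun i => (ν i : ℝ)

/-- `dil M l x = M ^ l x`. -/
def dil {n : ℕ} (M : Matrix (Fin n) (Fin n) ℤ) (l : ℕ) (x : Fin n → ℝ) : Fin n → ℝ :=
  ((M ^ l).map (Int.cast : ℤ → ℝ)) *ᵥ x

/-- `T` is a self-affine tile for `M` with digit set `Γ₀`: the integer translates of `T` tile the
space, `Γ₀` is a full set of representatives of `ℤⁿ / Mℤⁿ`, and the translates of `T` by the
digits tile `M T`. -/
structure IsSelfAffineTile {n : ℕ} (M : Matrix (Fin n) (Fin n) ℤ) (Γ₀ : Finset (Fin n → ℤ))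
    (T : Set (Fin n → ℝ)) : Prop where
  compact : IsCompact T
  cover : (⋃ ν : Fin n → ℤ, (fun x => x + vec ν) '' T) = Set.univ
  disjoint : ∀ μ ν : Fin n → ℤ, μ ≠ ν →
    volume (((fun x => x + vec μ) '' T) ∩ ((fun x => x + vec ν) '' T)) = 0
  digits : ∀ ν : Fin n → ℤ, ∃! d, d ∈ Γ₀ ∧ ∃ μ : Fin n → ℤ, ν = d + M *ᵥ μ
  selfAffine : (⋃ d ∈ Γ₀, (fun x => x + vec d) '' T) = dil M 1 '' T

/-- The norm `|φ|_p`: the `L^p(T)` norm of `∑ ν, |φ(x - ν)|`. -/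
def perNorm {n : ℕ} (T : Set (Fin n → ℝ)) (p : ℝ≥0∞) (φ : (Fin n → ℝ) → ℂ) : ℝ≥0∞ :=
  eLpNorm (fun x => ∑' ν : Fin n → ℤ, ‖φ (x - vec ν)‖ₑ) p (volume.restrict T)

/-- The space `𝓛^p`. -/
def MemPer {n : ℕ} (T : Set (Fin n → ℝ)) (p : ℝ≥0∞) (φ : (Fin n → ℝ) → ℂ) : Prop :=
  AEStronglyMeasurable φ volume ∧ perNorm T p φ < ∞

/-- The `ℓ^p` norm of a sequence, in `[0, ∞]`; for `p = ∞` it is the supremum. -/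
def seqNorm {ι E : Type*} [MeasurableSpace ι] [TopologicalSpace E] [ContinuousENorm E]
    (p : ℝ≥0∞) (c : ι → E) : ℝ≥0∞ :=
  eLpNorm c p Measure.count

/-- Membership in `ℓ^p`. -/
def MemSeq {n : ℕ} (p : ℝ≥0∞) (c : (Fin n → ℤ) → ℂ) : Prop := seqNorm p c < ∞

/-- `∑ j, ∑ ν, c_j(ν) φ_j(M^l x - ν)`. -/
def synth {n N : ℕ} (M : Matrix (Fin n) (Fin n) ℤ) (φ : Fin N → (Fin n → ℝ) → ℂ) (l : ℕ)
    (c : Fin N → (Fin n → ℤ) → ℂ) (x : Fin n → ℝ) : ℂ :=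
  ∑ j, ∑' ν : Fin n → ℤ, c j ν * φ j (dil M l x - vec ν)

/-- `L^p`-stable shifts. -/
def StableShifts {n N : ℕ} (p : ℝ≥0∞) (φ : Fin N → (Fin n → ℝ) → ℂ) : Prop :=
  ∃ C₁ C₂ : ℝ≥0, 0 < C₁ ∧ 0 < C₂ ∧ ∀ c : Fin N → (Fin n → ℤ) → ℂ, (∀ j, MemSeq p (c j)) →
    C₁ * ∑ j, seqNorm p (c j) ≤
      eLpNorm (fun x => ∑ j, ∑' ν : Fin n → ℤ, c j ν * φ j (x - vec ν)) p volume ∧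
    eLpNorm (fun x => ∑ j, ∑' ν : Fin n → ℤ, c j ν * φ j (x - vec ν)) p volume ≤
      C₂ * ∑ j, seqNorm p (c j)

/-- `M`-refinability with `ℓ¹` masks. -/
def Refinable {n N : ℕ} (M : Matrix (Fin n) (Fin n) ℤ) (φ : Fin N → (Fin n → ℝ) → ℂ) : Prop :=
  ∃ c : Fin N → Fin N → (Fin n → ℤ) → ℂ, (∀ j k, MemSeq 1 (c j k)) ∧
    ∀ j, ∀ᵐ x, φ j x = ∑ k, ∑' ν : Fin n → ℤ, c j k ν * φ k (dil M 1 x - vec ν)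

/-- `φ'` is a family in `𝓛^∞` dual to `φ`. -/
def IsDual {n N : ℕ} (T : Set (Fin n → ℝ)) (φ φ' : Fin N → (Fin n → ℝ) → ℂ) : Prop :=
  (∀ j, MemPer T ∞ (φ' j)) ∧ ∀ (j k : Fin N) (μ ν : Fin n → ℤ),
    ∫ x, φ j (x - vec μ) * conj (φ' k (x - vec ν)) = if μ = ν ∧ j = k then 1 else 0

/-- `⟨f, g(M^l · - ν)⟩`. -/
def pairing {n : ℕ} (M : Matrix (Fin n) (Fin n) ℤ) (f g : (Fin n → ℝ) → ℂ) (l : ℕ)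
    (ν : Fin n → ℤ) : ℂ :=
  ∫ y, f y * conj (g (dil M l y - vec ν))

/-- The operator `P_l`. -/
def proj {n N : ℕ} (M : Matrix (Fin n) (Fin n) ℤ) (φ φ' : Fin N → (Fin n → ℝ) → ℂ) (l : ℕ)
    (f : (Fin n → ℝ) → ℂ) : (Fin n → ℝ) → ℂ :=
  synth M φ l (fun j ν => (idx M : ℂ) ^ l * pairing M f (φ' j) l ν)

/-- `R_l f = P_{l+1} f - P_l f`. -/
def detail {n N : ℕ} (M : Matrix (Fin n) (Fin n) ℤ) (φ φ' : Fin N → (Fin n → ℝ) → ℂ) (l : ℕ)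
    (f : (Fin n → ℝ) → ℂ) : (Fin n → ℝ) → ℂ :=
  fun x => proj M φ φ' (l + 1) f x - proj M φ φ' l f x

/-- The space `V_0^p`. -/
def V₀ {n N : ℕ} (p : ℝ≥0∞) (φ : Fin N → (Fin n → ℝ) → ℂ) : Set ((Fin n → ℝ) → ℂ) :=
  {S | ∃ a : Fin N → (Fin n → ℤ) → ℂ, (∀ j, MemSeq p (a j)) ∧
    S = fun x => ∑ j, ∑' ν : Fin n → ℤ, a j ν * φ j (x - vec ν)}

/-- The space `V_l^p`. -/
def V {n N : ℕ} (M : Matrix (Fin n) (Fin n) ℤ) (p : ℝ≥0∞) (φ : Fin N → (Fin n → ℝ) → ℂ)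
    (l : ℕ) : Set ((Fin n → ℝ) → ℂ) :=
  {S | ∃ g ∈ V₀ p φ, S = fun x => g (dil M l x)}

/-- The error `σ_l^p(f)` of `L^p`-approximation of `f` from `V_l^p`. -/
def approxError {n N : ℕ} (M : Matrix (Fin n) (Fin n) ℤ) (p : ℝ≥0∞)
    (φ : Fin N → (Fin n → ℝ) → ℂ) (l : ℕ) (f : (Fin n → ℝ) → ℂ) : ℝ≥0∞ :=
  ⨅ S ∈ V M p φ l, eLpNorm (fun x => f x - S x) p volume

/-- The weight `b ^ s` for a positive real `b`, as an element of `[0, ∞]`. -/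
def wt (b s : ℝ) : ℝ≥0∞ := ENNReal.ofReal (b ^ s)

/-- The norm of `B^{α,λ}_{pq}(Φ)`. -/
def besovNorm {n N : ℕ} (M : Matrix (Fin n) (Fin n) ℤ) (p q : ℝ≥0∞) (α lam : ℝ)
    (φ : Fin N → (Fin n → ℝ) → ℂ) (f : (Fin n → ℝ) → ℂ) : ℝ≥0∞ :=
  eLpNorm f p volume + seqNorm q (fun l : ℕ => wt lam (l * α) * approxError M p φ l f)

/-- Form (i). -/
def normProj {n N : ℕ} (M : Matrix (Fin n) (Fin n) ℤ) (p q : ℝ≥0∞) (α lam : ℝ)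
    (φ φ' : Fin N → (Fin n → ℝ) → ℂ) (f : (Fin n → ℝ) → ℂ) : ℝ≥0∞ :=
  eLpNorm f p volume +
    seqNorm q (fun l : ℕ =>
      wt lam (l * α) * eLpNorm (fun x => f x - proj M φ φ' l f x) p volume)

/-- Form (ii). -/
def normDetail {n N : ℕ} (M : Matrix (Fin n) (Fin n) ℤ) (p q : ℝ≥0∞) (α lam : ℝ)
    (φ φ' : Fin N → (Fin n → ℝ) → ℂ) (f : (Fin n → ℝ) → ℂ) : ℝ≥0∞ :=
  eLpNorm (proj M φ φ' 0 f) p volume +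
    seqNorm q (fun l : ℕ => wt lam (l * α) * eLpNorm (detail M φ φ' l f) p volume)

/-- The coefficient norm
`(∑ l, (λ^{lα} m^{-l/p} ∑ j, ‖c_{jl}‖_{ℓ^p})^q)^{1/q}` of a family `c l j = c_{jl}`. -/
def coeffNorm {n N : ℕ} (M : Matrix (Fin n) (Fin n) ℤ) (p q : ℝ≥0∞) (α lam : ℝ)
    (c : ℕ → Fin N → (Fin n → ℤ) → ℂ) : ℝ≥0∞ :=
  seqNorm q (fun l : ℕ =>
    wt lam (l * α) * wt (idx M) (-(l * p⁻¹.toReal)) * ∑ j, seqNorm p (c l j))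

/-- `a l j = a_{jl}` are the `ℓ^p` coefficient sequences of `P_0 f` and of the `R_l f`. -/
def IsCoeff {n N : ℕ} (M : Matrix (Fin n) (Fin n) ℤ) (p : ℝ≥0∞)
    (φ φ' : Fin N → (Fin n → ℝ) → ℂ) (f : (Fin n → ℝ) → ℂ)
    (a : ℕ → Fin N → (Fin n → ℤ) → ℂ) : Prop :=
  (∀ l j, MemSeq p (a l j)) ∧
  proj M φ φ' 0 f =ᵐ[volume] synth M φ 0 (a 0) ∧
  ∀ l, detail M φ φ' l f =ᵐ[volume] synth M φ (l + 1) (a (l + 1))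

/-- `f = ∑ l, ∑ j, ∑ ν, c_{jl}(ν) φ_j(M^l x - ν)`, with `c_{jl} ∈ ℓ^p` and the series over `l`
convergent in `L^p`. -/
def IsRep {n N : ℕ} (M : Matrix (Fin n) (Fin n) ℤ) (p : ℝ≥0∞)
    (φ : Fin N → (Fin n → ℝ) → ℂ) (f : (Fin n → ℝ) → ℂ)
    (c : ℕ → Fin N → (Fin n → ℤ) → ℂ) : Prop :=
  (∀ l j, MemSeq p (c l j)) ∧
  Tendsto (fun L : ℕ =>
    eLpNorm (fun x => f x - ∑ l ∈ Finset.range L, synth M φ l (c l) x) p volume) atTop (𝓝 0)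

/-- Form (iv); the infimum over the empty set is `∞`. -/
def normInf {n N : ℕ} (M : Matrix (Fin n) (Fin n) ℤ) (p q : ℝ≥0∞) (α lam : ℝ)
    (φ : Fin N → (Fin n → ℝ) → ℂ) (f : (Fin n → ℝ) → ℂ) : ℝ≥0∞ :=
  ⨅ c ∈ {c : ℕ → Fin N → (Fin n → ℤ) → ℂ | IsRep M p φ f c}, coeffNorm M p q α lam c

/-- `V_l^2` in the Hilbert space `L²`. -/
def V₂ {n N : ℕ} (M : Matrix (Fin n) (Fin n) ℤ) (φ : Fin N → (Fin n → ℝ) → ℂ) (l : ℕ) :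
    Set (Lp ℂ 2 (volume : Measure (Fin n → ℝ))) :=
  {g | ∃ S ∈ V M 2 φ l, g =ᵐ[volume] S}

/-- `W_0 = V_1^2 ⊖ V_0^2`. -/
def W₀ {n N : ℕ} (M : Matrix (Fin n) (Fin n) ℤ) (φ : Fin N → (Fin n → ℝ) → ℂ) :
    Set (Lp ℂ 2 (volume : Measure (Fin n → ℝ))) :=
  {g | g ∈ V₂ M φ 1 ∧ ∀ h ∈ V₂ M φ 0, inner ℂ h g = 0}

/-- `ψ ε j`, with `ε` in a set of `m - 1` elements, is a set of wavelets in `𝓛^∞` associated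
with `φ`: the integer shifts of the `ψ ε j` form an orthonormal basis of `W_0`. -/
def IsWavelet {n N : ℕ} (M : Matrix (Fin n) (Fin n) ℤ) (T : Set (Fin n → ℝ))
    (φ : Fin N → (Fin n → ℝ) → ℂ) (ψ : Fin (idx M - 1) → Fin N → (Fin n → ℝ) → ℂ) : Prop :=
  (∀ ε j, MemPer T ∞ (ψ ε j)) ∧
  ∃ Ψ : Fin (idx M - 1) × Fin N × (Fin n → ℤ) → Lp ℂ 2 (volume : Measure (Fin n → ℝ)),
    (∀ ε j ν, Ψ (ε, j, ν) =ᵐ[volume] fun x => ψ ε j (x - vec ν)) ∧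
    Orthonormal ℂ Ψ ∧
    ((Submodule.span ℂ (Set.range Ψ)).topologicalClosure :
      Set (Lp ℂ 2 (volume : Measure (Fin n → ℝ)))) = W₀ M φ

/-- `b_{jl}^ε(ν) = ⟨f, m^{l/2} ψ(M^l · - ν)⟩` for `ψ = ψ_j^ε`. -/
def waveletCoeff {n : ℕ} (M : Matrix (Fin n) (Fin n) ℤ) (f ψ : (Fin n → ℝ) → ℂ) (l : ℕ)
    (ν : Fin n → ℤ) : ℂ :=
  pairing M f (fun y => (((idx M : ℝ) ^ ((l : ℝ) / 2) : ℝ) : ℂ) * ψ y) l ν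

/-- Form (v). -/
def normWavelet {n N : ℕ} (M : Matrix (Fin n) (Fin n) ℤ) (p q : ℝ≥0∞) (α lam : ℝ)
    (φ' : Fin N → (Fin n → ℝ) → ℂ) (ψ : Fin (idx M - 1) → Fin N → (Fin n → ℝ) → ℂ)
    (f : (Fin n → ℝ) → ℂ) : ℝ≥0∞ :=
  (∑ j, seqNorm p (fun ν => pairing M f (φ' j) 0 ν)) +
    seqNorm q (fun l : ℕ =>
      wt lam (l * α) * wt (idx M) (l * (1 / 2 - p⁻¹.toReal)) *
        ∑ j, ∑ ε, seqNorm p (waveletCoeff M f (ψ ε j) l))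

/-- Equivalence `A ∼ B` on `L^p` of two functionals with values in `[0, ∞]`. In particular, one of
`A f`, `B f` is finite if and only if the other is. -/
def NormEquiv {n : ℕ} (p : ℝ≥0∞) (A B : ((Fin n → ℝ) → ℂ) → ℝ≥0∞) : Prop :=
  ∃ C : ℝ≥0, 0 < C ∧ ∀ f : (Fin n → ℝ) → ℂ, MemLp f p volume → A f ≤ C * B f ∧ B f ≤ C * A f

end SelfAffine

end

open SelfAffine

/-!
# Wavelet characterizations of Besov spaces generated by refinable functions

Throughout, `sy φ c = ∑ ν, c ν φ(· - ν)` and `an f g ν = ⟨f, g(· - ν)⟩`. For `φ`, `g` in `𝓛^∞`, which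
is described without the tile as `PerBdd`, Schur's test (`eLpNorm_lintegral_kernel_le`) bounds
`c ↦ sy φ c` from `ℓ^p` to `L^p` and `f ↦ an f g` from `L^p` to `ℓ^p`. Hence `P_0` is bounded on
every `L^p`, and so are the `P_l`, uniformly in `l`, as dilates of `P_0`. They fix `V_l^p` by duality
and `V_l^p ⊂ V_{l+1}^p` by refinability.

**The norms (i)-(iv).** Since `P_l` is bounded and fixes `V_l^p`, `‖f - P_l f‖` is comparable to
`σ_l(f)`, which is (i). For (ii) one needs `‖f - P_l f‖ ≤ ∑_{k ≥ l} ‖R_k f‖`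
(`eLpNorm_sub_proj_le`) and Hardy's inequality with the weights `λ^{lα}` (`exists_hardy`). The former
follows by Fatou's lemma from `P_l f → f` locally in `L^1` (`tendsto_proj`), which is proved for all
`p ≤ ∞`: for bounded `f`, `P_l f - f · (P 1)(M^l ·) → 0` by continuity of translations, where `P 1` is
the periodic image of the constant `1`; for `f = φ_1`, which the projections fix, this forces
`P 1 = 1` by averaging over periods (`projOne_eq_one`). Norms of functions in `V_l^p` are those of
their coefficients up to the factor `m^{-l/p}`, which gives (iii), and (iv) again by Hardy's
inequality.

**Duality.** The sequences `ℓ¹(ℤⁿ)` form a commutative Banach star algebra `Wiener n`, whose characters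
are `ν ↦ exp(i⟨ν, θ⟩)` on the point masses. Matrices over it act on families in `𝓛^∞`, and the
Gramian of a family is such a matrix (`gram`). The lower stability bound, tested on characters cut
off to large boxes, makes the Gramian positive definite at each character (`gram_pos`). By Gelfand
theory its spectrum is positive, so the binomial series for fractional powers converges
(`exists_selfAdjoint_fourthRoot`) and yields an inverse square root with entries in `ℓ¹`. Applied to
`φ` it gives generators `E` in `𝓛^∞` with orthonormal shifts (`exists_orthonormal_generators`), and
from them a dual family.

**Wavelets.** The functions `m^{1/2} E_k(M · - d)`, `d` a digit, are orthonormal generators of `V_1`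
(`Biorth.fine`), and there are `m N` of them, because `M T` has `m` times the volume of `T`
(`IsSelfAffineTile.card_digits`). Expressing `E` through them gives a matrix over `ℓ¹(ℤⁿ)` with `N` orthonormal rows;
the wavelets are the remaining rows of a unitary completion. The completion
(`exists_unitary_completion`) is built from Householder reflections `u ↦ v` of unit vectors, which exist over
`ℓ¹(ℤⁿ)` as soon as `u ≠ v` at every character. A truncated vector depends smoothly on the `n` real
parameters of a character, so its real multiples form the image of an `(n + 1)`-dimensional space and
miss some constant vector if there are more than `(n + 1) / 2` complex coordinates; this constant
vector serves as an intermediate stop.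

**The norm (v).** A square matrix with orthonormal rows over the commutative ring `ℓ¹(ℤⁿ)` is unitary.
Therefore `E` and any wavelets, taken together, span what the generators of `V_1` span, and this
identity of projections holds on every `L^p` (`Pz_eq_of_act`). So the details of the orthogonal
projections are the wavelet series (`detail_eq_wavelet`), and (v) reduces to (ii) for the self-dual
family `E`, whose spaces `V_l^p` are those of `φ`; the coarsest terms of the two dual families differ by
the details (`besov_bddBy_wavelet`).
-/

noncomputable section

namespace SelfAffine

section

/-! ### Schur's test -/

/-- Hölder's inequality for the measure with density `k`. -/
theorem lintegral_mul_rpow_le {Y : Type*} [MeasurableSpace Y] (ν : Measure Y)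
    {k F : Y → ℝ≥0∞} (hk : Measurable k) (hF : Measurable F) {r : ℝ} (hr : 1 ≤ r) :
    (∫⁻ y, k y * F y ∂ν) ^ r ≤ (∫⁻ y, k y ∂ν) ^ (r - 1) * ∫⁻ y, k y * F y ^ r ∂ν := by
  rcases hr.eq_or_lt with rfl | hr
  · simp
  have hr0 : 0 < r := by linarith
  have hc : r.HolderConjugate (r / (r - 1)) := Real.HolderConjugate.conjExponent hr
  have h := ENNReal.lintegral_mul_le_Lp_mul_Lq (ν.withDensity k) hc hF.aemeasurable
    (g := fun _ => 1) aemeasurable_const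
  rw [lintegral_withDensity_eq_lintegral_mul _ hk (by fun_prop),
    lintegral_withDensity_eq_lintegral_mul _ hk (by fun_prop),
    lintegral_withDensity_eq_lintegral_mul _ hk (by fun_prop)] at h
  simp only [Pi.mul_apply, mul_one, ENNReal.one_rpow] at h
  have h2 := ENNReal.rpow_le_rpow h hr0.le
  rw [ENNReal.mul_rpow_of_nonneg _ _ hr0.le, ← ENNReal.rpow_mul, ← ENNReal.rpow_mul] at h2
  rw [mul_comm]
  convert h2 using 2
  · rw [one_div, inv_mul_cancel₀ hr0.ne', ENNReal.rpow_one]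
  · congr 1
    have : r - 1 ≠ 0 := by linarith
    field_simp

/-- **Schur's test**: a nonnegative kernel whose two marginals are bounded by `A` defines an
operator of norm at most `A` on every `L^p`. -/
theorem eLpNorm_lintegral_kernel_le {X Y : Type*} [MeasurableSpace X] [MeasurableSpace Y]
    (μ : Measure X) (ν : Measure Y) [SFinite μ] [SFinite ν] {k : X → Y → ℝ≥0∞}
    (hk : Measurable (Function.uncurry k)) {A : ℝ≥0∞}
    (h1 : ∀ᵐ x ∂μ, ∫⁻ y, k x y ∂ν ≤ A) (h2 : ∀ᵐ y ∂ν, ∫⁻ x, k x y ∂μ ≤ A)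
    {p : ℝ≥0∞} (hp : 1 ≤ p) {F : Y → ℝ≥0∞} (hF : Measurable F) :
    eLpNorm (fun x => ∫⁻ y, k x y * F y ∂ν) p μ ≤ A * eLpNorm F p ν := by
  have hkx : ∀ x, Measurable (k x) := fun x => hk.of_uncurry_left
  by_cases hpt : p = ∞
  · subst hpt
    simp only [eLpNorm_exponent_top]
    refine eLpNormEssSup_le_of_ae_enorm_bound ?_
    filter_upwards [h1] with x hx
    have hle : ∀ᵐ y ∂ν, k x y * F y ≤ k x y * eLpNormEssSup F ν := by
      filter_upwards [enorm_ae_le_eLpNormEssSup F ν] with y hy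
      gcongr; simpa using hy
    rw [enorm_eq_self]
    refine (lintegral_mono_ae hle).trans ?_
    rw [lintegral_mul_const _ (hkx x)]
    gcongr
  have hp0 : p ≠ 0 := (zero_lt_one.trans_le hp).ne'
  have hr : 1 ≤ p.toReal := by
    rw [← ENNReal.toReal_one]; exact ENNReal.toReal_mono hpt hp
  have hr0 : 0 < p.toReal := by linarith
  rw [eLpNorm_eq_lintegral_rpow_enorm_toReal hp0 hpt, eLpNorm_eq_lintegral_rpow_enorm_toReal hp0 hpt]
  simp only [enorm_eq_self]
  set r := p.toReal
  rw [one_div, ENNReal.rpow_inv_le_iff hr0, ENNReal.mul_rpow_of_nonneg _ _ hr0.le,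
    ← ENNReal.rpow_mul, inv_mul_cancel₀ hr0.ne', ENNReal.rpow_one]
  have hFr : Measurable fun y => F y ^ r := hF.pow_const r
  have hkF : Measurable (Function.uncurry fun x y => k x y * F y ^ r) :=
    hk.mul (hFr.comp measurable_snd)
  calc ∫⁻ x, (∫⁻ y, k x y * F y ∂ν) ^ r ∂μ
      ≤ ∫⁻ x, A ^ (r - 1) * ∫⁻ y, k x y * F y ^ r ∂ν ∂μ := by
        refine lintegral_mono_ae ?_
        filter_upwards [h1] with x hx
        refine (lintegral_mul_rpow_le ν (hkx x) hF hr).trans ?_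
        gcongr
    -- Tonelli, then the other marginal
    _ = A ^ (r - 1) * ∫⁻ y, ∫⁻ x, k x y * F y ^ r ∂μ ∂ν := by
        rw [lintegral_const_mul _ hkF.lintegral_prod_right, lintegral_lintegral_swap hkF.aemeasurable]
    _ ≤ A ^ (r - 1) * ∫⁻ y, A * F y ^ r ∂ν := by
        gcongr (A : ℝ≥0∞) ^ (r - 1) * ?_
        refine lintegral_mono_ae ?_
        filter_upwards [h2] with y hy
        rw [lintegral_mul_const _ hk.of_uncurry_right]
        gcongr
    _ = A ^ r * ∫⁻ y, F y ^ r ∂ν := by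
        rw [lintegral_const_mul _ hFr, ← mul_assoc]
        congr 1
        nth_rewrite 2 [← ENNReal.rpow_one A]
        rw [← ENNReal.rpow_add_of_nonneg _ _ (by linarith) (by linarith)]
        simp

theorem eLpNorm_mono_ennreal {X : Type*} [MeasurableSpace X] {μ : Measure X} {E : Type*}
    [TopologicalSpace E] [ContinuousENorm E] {f : X → E}
    {g : X → ℝ≥0∞} {p : ℝ≥0∞} (h : ∀ᵐ x ∂μ, ‖f x‖ₑ ≤ g x) : eLpNorm f p μ ≤ eLpNorm g p μ :=
  eLpNorm_mono_enorm_ae (by simpa using h)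

/-! ### Lattice translates -/

variable {n : ℕ}

@[simp] theorem vec_zero : vec (0 : Fin n → ℤ) = 0 := by ext; simp [vec]
@[simp] theorem vec_add (μ ν : Fin n → ℤ) : vec (μ + ν) = vec μ + vec ν := by ext; simp [vec]
@[simp] theorem vec_neg (ν : Fin n → ℤ) : vec (-ν) = -vec ν := by ext; simp [vec]
@[simp] theorem vec_sub (μ ν : Fin n → ℤ) : vec (μ - ν) = vec μ - vec ν := by ext; simp [vec]

theorem ae_shift {P : (Fin n → ℝ) → Prop} (h : ∀ᵐ x, P x) (a : Fin n → ℝ) : ∀ᵐ x, P (x - a) :=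
  (measurePreserving_sub_right volume a).quasiMeasurePreserving.ae h

theorem ae_all_shift {P : (Fin n → ℝ) → Prop} (h : ∀ᵐ x, P x) :
    ∀ᵐ x, ∀ ν : Fin n → ℤ, P (x - vec ν) :=
  ae_all_iff.2 fun ν => ae_shift h (vec ν)

/-- The half-open unit cube, a fundamental domain of `ℤⁿ`. -/
def cube (n : ℕ) : Set (Fin n → ℝ) := Set.univ.pi fun _ => Set.Ico 0 1

theorem measurableSet_cube : MeasurableSet (cube n) :=
  MeasurableSet.univ_pi fun _ => measurableSet_Ico

theorem volume_cube : volume (cube n) = 1 := by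
  simp [cube, Real.volume_pi_Ico]

theorem existsUnique_sub_mem_cube (x : Fin n → ℝ) : ∃! ν : Fin n → ℤ, x - vec ν ∈ cube n := by
  refine ⟨fun i => ⌊x i⌋, ?_, ?_⟩
  · intro i _
    simp only [Pi.sub_apply, vec, Set.mem_Ico, sub_nonneg]
    exact ⟨Int.floor_le _, by linarith [Int.lt_floor_add_one (x i)]⟩
  · intro ν hν
    ext i
    have := hν i trivial
    simp only [Pi.sub_apply, vec, Set.mem_Ico, sub_nonneg] at this
    exact (Int.floor_eq_iff.2 ⟨this.1, by linarith⟩).symm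

/-- Integration over the space by summing over the lattice translates of the unit cube. -/
theorem lintegral_eq_cube (f : (Fin n → ℝ) → ℝ≥0∞) (hf : Measurable f) :
    ∫⁻ x, f x = ∫⁻ x in cube n, ∑' ν : Fin n → ℤ, f (x - vec ν) := by
  rw [lintegral_tsum (f := fun ν x => f (x - vec ν)) fun ν =>
    (hf.comp (measurable_id.sub_const _)).aemeasurable]
  have hU : (⋃ ν : Fin n → ℤ, (fun x => x + vec ν) ⁻¹' cube n) = Set.univ := by
    refine Set.eq_univ_of_forall fun x => ?_
    obtain ⟨ν, hν, -⟩ := existsUnique_sub_mem_cube x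
    exact Set.mem_iUnion.2 ⟨-ν, by simpa [sub_eq_add_neg] using hν⟩
  have hmU : ∀ ν : Fin n → ℤ, MeasurableSet ((fun x => x + vec ν) ⁻¹' cube n) :=
    fun ν => (measurable_id.add_const _) measurableSet_cube
  rw [← setLIntegral_univ, ← hU, lintegral_iUnion hmU]
  · congr 1
    ext ν
    have h := (measurePreserving_add_right volume (vec ν)).setLIntegral_comp_preimage
      measurableSet_cube (f := fun x => f (x - vec ν)) (hf.comp (measurable_id.sub_const _))
    simpa using h
  · intro μ ν hne
    refine Set.disjoint_left.2 fun x hx hy => hne ?_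
    obtain ⟨κ, -, hκ⟩ := existsUnique_sub_mem_cube x
    have h1 := hκ (-μ) (by simpa [sub_eq_add_neg] using hx)
    have h2 := hκ (-ν) (by simpa [sub_eq_add_neg] using hy)
    exact neg_injective (h1.trans h2.symm)

/-! ### Functions with bounded periodization -/

/-- The class `𝓛^∞`, described without reference to a tile: the lattice periodization of `|φ|` is
essentially bounded, here with the explicit bound `A`. -/
structure PerBddWith (φ : (Fin n → ℝ) → ℂ) (A : ℝ≥0) : Prop where
  aesm : AEStronglyMeasurable φ volume
  bound : ∀ᵐ x, ∑' ν : Fin n → ℤ, ‖φ (x - vec ν)‖ₑ ≤ A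

/-- The class `𝓛^∞`, described without reference to a tile. -/
def PerBdd (φ : (Fin n → ℝ) → ℂ) : Prop := ∃ A, PerBddWith φ A

theorem PerBddWith.congr {φ φ' : (Fin n → ℝ) → ℂ} {A : ℝ≥0} (h : PerBddWith φ A)
    (he : φ =ᵐ[volume] φ') : PerBddWith φ' A := by
  refine ⟨h.aesm.congr he, ?_⟩
  filter_upwards [h.bound, ae_all_shift he] with x hx hy
  simpa only [← hy] using hx

theorem PerBdd.congr {φ φ' : (Fin n → ℝ) → ℂ} (h : PerBdd φ) (he : φ =ᵐ[volume] φ') :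
    PerBdd φ' := let ⟨A, hA⟩ := h; ⟨A, hA.congr he⟩

theorem PerBdd.aesm {φ : (Fin n → ℝ) → ℂ} (h : PerBdd φ) : AEStronglyMeasurable φ volume :=
  let ⟨_, hA⟩ := h; hA.aesm

theorem aesm_shift {φ : (Fin n → ℝ) → ℂ} (h : AEStronglyMeasurable φ volume) (a : Fin n → ℝ) :
    AEStronglyMeasurable (fun x => φ (x - a)) volume :=
  h.comp_measurePreserving (measurePreserving_sub_right volume a)

/-- A Borel measurable representative. -/
theorem PerBddWith.exists_measurable {φ : (Fin n → ℝ) → ℂ} {A : ℝ≥0} (h : PerBddWith φ A) :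
    ∃ φ', Measurable φ' ∧ φ =ᵐ[volume] φ' ∧ PerBddWith φ' A :=
  ⟨h.aesm.mk φ, h.aesm.stronglyMeasurable_mk.measurable, h.aesm.ae_eq_mk, h.congr h.aesm.ae_eq_mk⟩

theorem PerBddWith.lintegral_le {φ : (Fin n → ℝ) → ℂ} {A : ℝ≥0} (h : PerBddWith φ A) :
    ∫⁻ x, ‖φ x‖ₑ ≤ A := by
  obtain ⟨φ', hm, he, h'⟩ := h.exists_measurable
  rw [lintegral_congr_ae (he.mono fun x hx => by rw [hx]), lintegral_eq_cube _ hm.enorm]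
  calc _ ≤ ∫⁻ x in cube n, (A : ℝ≥0∞) := lintegral_mono_ae (ae_restrict_of_ae h'.bound)
    _ = A := by simp [volume_cube]

theorem PerBddWith.ae_le {φ : (Fin n → ℝ) → ℂ} {A : ℝ≥0} (h : PerBddWith φ A) :
    ∀ᵐ x, ‖φ x‖ₑ ≤ A := by
  filter_upwards [h.bound] with x hx
  refine le_trans ?_ hx
  simpa using ENNReal.le_tsum (f := fun ν : Fin n → ℤ => ‖φ (x - vec ν)‖ₑ) 0

/-- For a tile whose integer translates cover the space, `𝓛^∞` is the class `PerBdd`. -/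
theorem memPer_top_iff {M : Matrix (Fin n) (Fin n) ℤ} {Γ₀ : Finset (Fin n → ℤ)}
    {T : Set (Fin n → ℝ)} (hT : IsSelfAffineTile M Γ₀ T) {φ : (Fin n → ℝ) → ℂ} :
    MemPer T ∞ φ ↔ PerBdd φ := by
  constructor
  · rintro ⟨h1, h2⟩
    refine ⟨(perNorm T ∞ φ).toNNReal, h1, ?_⟩
    rw [ENNReal.coe_toNNReal h2.ne]
    have hm : MeasurableSet T := hT.compact.isClosed.measurableSet
    have h3 : ∀ᵐ x, x ∈ T → ∑' ν : Fin n → ℤ, ‖φ (x - vec ν)‖ₑ ≤ perNorm T ∞ φ := by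
      rw [← ae_restrict_iff' hm]
      simpa [perNorm] using ae_le_eLpNormEssSup
        (f := fun x => ∑' ν : Fin n → ℤ, ‖φ (x - vec ν)‖ₑ) (μ := volume.restrict T)
    filter_upwards [ae_all_shift h3] with x hx
    have hxT : x ∈ ⋃ ν : Fin n → ℤ, (fun x => x + vec ν) '' T := hT.cover ▸ Set.mem_univ x
    obtain ⟨ν, y, hy, rfl⟩ := Set.mem_iUnion.1 hxT
    have := hx ν (by simpa using hy)
    rw [← (Equiv.addLeft ν).tsum_eq] at this ⊢
    refine le_trans (le_of_eq ?_) this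
    rw [← (Equiv.addLeft ν).tsum_eq]
    refine tsum_congr fun κ => ?_
    simp only [Equiv.coe_addLeft, vec_add]
    congr 2
    abel_nf
  · rintro ⟨A, h1, h2⟩
    refine ⟨h1, ?_⟩
    have : perNorm T ∞ φ ≤ A := by
      rw [perNorm, eLpNorm_exponent_top]
      exact eLpNormEssSup_le_of_ae_enorm_bound (by simpa using ae_restrict_of_ae h2)
    exact this.trans_lt ENNReal.coe_lt_top

end

section

/-! ### Sequences -/

section seq
variable {ι : Type*} [MeasurableSpace ι] [MeasurableSingletonClass ι]

theorem enorm_le_seqNorm {E : Type*} [TopologicalSpace E] [ContinuousENorm E] {p : ℝ≥0∞}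
    (hp : 1 ≤ p) (c : ι → E) (i : ι) : ‖c i‖ₑ ≤ seqNorm p c := by
  have hp0 : p ≠ 0 := (zero_lt_one.trans_le hp).ne'
  by_cases hpt : p = ∞
  · subst hpt
    have h := enorm_ae_le_eLpNormEssSup c (Measure.count : Measure ι)
    rw [ae_iff, Measure.count_eq_zero_iff] at h
    by_contra hi
    exact (h ▸ hi : i ∈ (∅ : Set ι))
  · have hr := ENNReal.toReal_pos hp0 hpt
    rw [seqNorm, eLpNorm_eq_lintegral_rpow_enorm_toReal hp0 hpt, one_div,
      ENNReal.le_rpow_inv_iff hr, lintegral_count]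
    exact ENNReal.le_tsum (f := fun i => ‖c i‖ₑ ^ p.toReal) i

theorem seqNorm_one {E : Type*} [TopologicalSpace E] [ContinuousENorm E] (c : ι → E) :
    seqNorm 1 c = ∑' i, ‖c i‖ₑ := by
  rw [seqNorm, eLpNorm_one_eq_lintegral_enorm, lintegral_count]

omit [MeasurableSingletonClass ι] in
theorem seqNorm_enorm {E : Type*} [TopologicalSpace E] [ContinuousENorm E] (p : ℝ≥0∞)
    (c : ι → E) : seqNorm p (fun i => ‖c i‖ₑ) = seqNorm p c :=
  eLpNorm_enorm _

end seq

theorem summable_of_tsum_enorm {ι : Type*} {f : ι → ℂ} (h : ∑' i, ‖f i‖ₑ ≠ ∞) : Summable f := by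
  refine Summable.of_norm ?_
  have := ENNReal.summable_toReal h
  simpa using this

variable {n : ℕ}

theorem seqNorm_top_le {p : ℝ≥0∞} (hp : 1 ≤ p) (c : (Fin n → ℤ) → ℂ) :
    seqNorm ∞ c ≤ seqNorm p c := by
  rw [seqNorm, eLpNorm_exponent_top]
  exact eLpNormEssSup_le_of_ae_enorm_bound (Eventually.of_forall (enorm_le_seqNorm hp c))

theorem MemSeq.top {p : ℝ≥0∞} (hp : 1 ≤ p) {c : (Fin n → ℤ) → ℂ} (hc : MemSeq p c) :
    MemSeq ∞ c := (seqNorm_top_le hp c).trans_lt hc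

theorem MemSeq.memLp {p : ℝ≥0∞} {c : (Fin n → ℤ) → ℂ} (hc : MemSeq p c) :
    MemLp c p Measure.count := ⟨.of_discrete, hc⟩

theorem memSeq_iff_memLp {p : ℝ≥0∞} {c : (Fin n → ℤ) → ℂ} :
    MemSeq p c ↔ MemLp c p Measure.count := ⟨MemSeq.memLp, fun h => h.2⟩

theorem MemSeq.add {p : ℝ≥0∞} {c d : (Fin n → ℤ) → ℂ} (hc : MemSeq p c) (hd : MemSeq p d) :
    MemSeq p (c + d) := (hc.memLp.add hd.memLp).2

theorem MemSeq.sub {p : ℝ≥0∞} {c d : (Fin n → ℤ) → ℂ} (hc : MemSeq p c) (hd : MemSeq p d) :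
    MemSeq p (c - d) := (hc.memLp.sub hd.memLp).2

theorem MemSeq.const_mul {p : ℝ≥0∞} {c : (Fin n → ℤ) → ℂ} (hc : MemSeq p c) (k : ℂ) :
    MemSeq p (fun ν => k * c ν) := (hc.memLp.const_mul k).2

theorem memSeq_sum {p : ℝ≥0∞} {κ : Type*} (s : Finset κ) {c : κ → (Fin n → ℤ) → ℂ}
    (hc : ∀ i ∈ s, MemSeq p (c i)) : MemSeq p (fun ν => ∑ i ∈ s, c i ν) :=
  (memLp_finsetSum s fun i hi => (hc i hi).memLp).2

theorem memSeq_one_iff {c : (Fin n → ℤ) → ℂ} : MemSeq 1 c ↔ Summable fun ν => ‖c ν‖ := by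
  rw [MemSeq, seqNorm_one, lt_top_iff_ne_top]
  constructor
  · intro h
    simpa using ENNReal.summable_toReal h
  · intro h
    have := h.tsum_ofReal_ne_top
    simpa [ofReal_norm] using this

/-- Convolution of sequences on `ℤⁿ`. -/
def cconv (c b : (Fin n → ℤ) → ℂ) (ν : Fin n → ℤ) : ℂ := ∑' μ, c μ * b (ν - μ)

/-- The involution `b^*(ν) = conj (b (-ν))`. -/
def bstar (b : (Fin n → ℤ) → ℂ) (ν : Fin n → ℤ) : ℂ := conj (b (-ν))

theorem seqNorm_bstar (b : (Fin n → ℤ) → ℂ) : seqNorm 1 (bstar b) = seqNorm 1 b := by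
  rw [seqNorm_one, seqNorm_one, ← (Equiv.neg _).tsum_eq]
  simp [bstar]

theorem MemSeq.bstar {b : (Fin n → ℤ) → ℂ} (hb : MemSeq 1 b) : MemSeq 1 (bstar b) := by
  rw [MemSeq, seqNorm_bstar]; exact hb

/-- Young's inequality `ℓ^p * ℓ^1 ⊂ ℓ^p`. -/
theorem seqNorm_cconv_le {p : ℝ≥0∞} (hp : 1 ≤ p) (c : (Fin n → ℤ) → ℂ) {b : (Fin n → ℤ) → ℂ}
    (hb : MemSeq 1 b) : seqNorm p (cconv c b) ≤ seqNorm 1 b * seqNorm p c := by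
  rw [← seqNorm_enorm p c]
  have hA : seqNorm 1 b = ((seqNorm 1 b).toNNReal : ℝ≥0∞) := (ENNReal.coe_toNNReal hb.ne).symm
  have hb1 : ∑' ν, ‖b ν‖ₑ ≤ ((seqNorm 1 b).toNNReal : ℝ≥0∞) := by rw [← hA, seqNorm_one]
  rw [hA]
  refine le_trans ?_ (eLpNorm_lintegral_kernel_le Measure.count Measure.count
    (k := fun ν μ => ‖b (ν - μ)‖ₑ) (A := (seqNorm 1 b).toNNReal) (measurable_of_countable _)
    ?_ ?_ hp (measurable_of_countable _))
  · refine eLpNorm_mono_ennreal (Eventually.of_forall fun ν => ?_)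
    rw [lintegral_count]
    refine enorm_tsum_le_tsum_enorm.trans (le_of_eq ?_)
    simp [mul_comm]
  · refine Eventually.of_forall fun ν => ?_
    rw [lintegral_count]
    exact ((Equiv.subLeft ν).tsum_eq (fun μ => ‖b μ‖ₑ)).trans_le hb1
  · refine Eventually.of_forall fun ν => ?_
    rw [lintegral_count]
    exact ((Equiv.subRight ν).tsum_eq (fun μ => ‖b μ‖ₑ)).trans_le hb1

theorem MemSeq.cconv {p : ℝ≥0∞} (hp : 1 ≤ p) {c b : (Fin n → ℤ) → ℂ} (hc : MemSeq p c)
    (hb : MemSeq 1 b) : MemSeq p (cconv c b) :=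
  (seqNorm_cconv_le hp c hb).trans_lt (ENNReal.mul_lt_top hb hc)

/-! ### Synthesis and analysis by the integer shifts of one function -/

/-- `∑ ν, c(ν) φ(x - ν)`. -/
def sy (φ : (Fin n → ℝ) → ℂ) (c : (Fin n → ℤ) → ℂ) (x : Fin n → ℝ) : ℂ :=
  ∑' ν, c ν * φ (x - vec ν)

/-- `⟨f, g(· - ν)⟩`. -/
def an (f g : (Fin n → ℝ) → ℂ) (ν : Fin n → ℤ) : ℂ := ∫ y, f y * conj (g (y - vec ν))

theorem sy_congr {φ φ' : (Fin n → ℝ) → ℂ} (h : φ =ᵐ[volume] φ') (c : (Fin n → ℤ) → ℂ) :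
    sy φ c =ᵐ[volume] sy φ' c := by
  filter_upwards [ae_all_shift h] with x hx
  simp only [sy, hx]

theorem an_congr {f f' g g' : (Fin n → ℝ) → ℂ} (hf : f =ᵐ[volume] f') (hg : g =ᵐ[volume] g') :
    an f g = an f' g' := by
  ext ν
  refine integral_congr_ae ?_
  filter_upwards [hf, ae_all_shift hg] with x hx hy
  simp only [hx, hy]

theorem PerBddWith.synth_enorm_le {φ : (Fin n → ℝ) → ℂ} {A : ℝ≥0} (h : PerBddWith φ A)
    (c : (Fin n → ℤ) → ℂ) :
    ∀ᵐ x, ∑' ν, ‖c ν * φ (x - vec ν)‖ₑ ≤ seqNorm ∞ c * A := by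
  filter_upwards [h.bound] with x hx
  calc ∑' ν, ‖c ν * φ (x - vec ν)‖ₑ ≤ ∑' ν, seqNorm ∞ c * ‖φ (x - vec ν)‖ₑ := by
        refine ENNReal.tsum_le_tsum fun ν => ?_
        rw [enorm_mul]
        gcongr
        exact enorm_le_seqNorm le_top c ν
    _ ≤ _ := by rw [ENNReal.tsum_mul_left]; gcongr

theorem PerBdd.ae_tsum_ne_top {φ : (Fin n → ℝ) → ℂ} (h : PerBdd φ) {p : ℝ≥0∞} (hp : 1 ≤ p)
    {c : (Fin n → ℤ) → ℂ} (hc : MemSeq p c) :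
    ∀ᵐ x, ∑' ν, ‖c ν * φ (x - vec ν)‖ₑ ≠ ∞ := by
  obtain ⟨A, hA⟩ := h
  filter_upwards [hA.synth_enorm_le c] with x hx
  exact (hx.trans_lt (ENNReal.mul_lt_top (hc.top hp) ENNReal.coe_lt_top)).ne

theorem PerBdd.ae_summable {φ : (Fin n → ℝ) → ℂ} (h : PerBdd φ) {p : ℝ≥0∞} (hp : 1 ≤ p)
    {c : (Fin n → ℤ) → ℂ} (hc : MemSeq p c) :
    ∀ᵐ x, Summable fun ν => c ν * φ (x - vec ν) := by
  filter_upwards [h.ae_tsum_ne_top hp hc] with x hx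
  exact summable_of_tsum_enorm hx

theorem PerBdd.aesm_sy {φ : (Fin n → ℝ) → ℂ} (h : PerBdd φ) {p : ℝ≥0∞} (hp : 1 ≤ p)
    {c : (Fin n → ℤ) → ℂ} (hc : MemSeq p c) : AEStronglyMeasurable (sy φ c) volume := by
  refine aestronglyMeasurable_of_tendsto_ae (atTop : Filter (Finset (Fin n → ℤ)))
    (f := fun s x => ∑ ν ∈ s, c ν * φ (x - vec ν)) (fun s => ?_) ?_
  · exact Finset.aestronglyMeasurable_fun_sum _ fun ν _ => (aesm_shift h.aesm _).const_mul _
  · filter_upwards [h.ae_summable hp hc] with x hx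
    exact hx.hasSum

/-- Synthesis is bounded from `ℓ^p` to `L^p`. -/
theorem PerBddWith.eLpNorm_sy_le {φ : (Fin n → ℝ) → ℂ} {A : ℝ≥0} (h : PerBddWith φ A) {p : ℝ≥0∞}
    (hp : 1 ≤ p) (c : (Fin n → ℤ) → ℂ) : eLpNorm (sy φ c) p volume ≤ A * seqNorm p c := by
  obtain ⟨φ', hm, he, h'⟩ := h.exists_measurable
  rw [eLpNorm_congr_ae (sy_congr he c), ← seqNorm_enorm p c]
  refine le_trans ?_ (eLpNorm_lintegral_kernel_le volume Measure.count
    (k := fun x ν => ‖φ' (x - vec ν)‖ₑ) (A := A) ?_ ?_ ?_ hp (measurable_of_countable _))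
  · refine eLpNorm_mono_ennreal (Eventually.of_forall fun x => ?_)
    rw [lintegral_count]
    refine enorm_tsum_le_tsum_enorm.trans (le_of_eq ?_)
    simp [mul_comm]
  · exact measurable_from_prod_countable_left fun ν =>
      (hm.comp (measurable_id.sub_const (vec ν))).enorm
  · simpa only [lintegral_count] using h'.bound
  · refine Eventually.of_forall fun ν => ?_
    rw [lintegral_sub_right_eq_self (fun x => ‖φ' x‖ₑ)]
    exact h'.lintegral_le

theorem an_enorm_le (f g : (Fin n → ℝ) → ℂ) (ν : Fin n → ℤ) :
    ‖an f g ν‖ₑ ≤ ∫⁻ y, ‖g (y - vec ν)‖ₑ * ‖f y‖ₑ := by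
  refine (enorm_integral_le_lintegral_enorm _).trans (le_of_eq ?_)
  simp [mul_comm]

/-- The analysis operator, with absolute values inside, is bounded from `L^p` to `ℓ^p`. -/
theorem PerBddWith.seqNorm_lintegral_le {g : (Fin n → ℝ) → ℂ} {A : ℝ≥0} (h : PerBddWith g A)
    {p : ℝ≥0∞} (hp : 1 ≤ p) {f : (Fin n → ℝ) → ℂ} (hf : AEStronglyMeasurable f volume) :
    seqNorm p (fun ν : Fin n → ℤ => ∫⁻ y, ‖g (y - vec ν)‖ₑ * ‖f y‖ₑ) ≤ A * eLpNorm f p volume := by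
  obtain ⟨g', hm, he, h'⟩ := h.exists_measurable
  have hfe := hf.ae_eq_mk
  have hfm := hf.stronglyMeasurable_mk.measurable
  have heq : (fun ν : Fin n → ℤ => ∫⁻ y, ‖g (y - vec ν)‖ₑ * ‖f y‖ₑ) =
      fun ν => ∫⁻ y, ‖g' (y - vec ν)‖ₑ * ‖hf.mk f y‖ₑ := by
    ext ν
    refine lintegral_congr_ae ?_
    filter_upwards [ae_all_shift he, hfe] with y h1 h2
    rw [h1, ← h2]
  rw [heq, eLpNorm_congr_ae hfe, ← eLpNorm_enorm]
  refine eLpNorm_lintegral_kernel_le Measure.count volume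
    (k := fun ν y => ‖g' (y - vec ν)‖ₑ) (A := A) ?_ ?_ ?_ hp hfm.enorm
  · exact measurable_from_prod_countable_right fun ν =>
      (hm.comp (measurable_id.sub_const (vec ν))).enorm
  · refine Eventually.of_forall fun ν => ?_
    rw [lintegral_sub_right_eq_self (fun x => ‖g' x‖ₑ)]
    exact h'.lintegral_le
  · simpa only [lintegral_count] using h'.bound

/-- Analysis is bounded from `L^p` to `ℓ^p`. -/
theorem PerBddWith.seqNorm_an_le {g : (Fin n → ℝ) → ℂ} {A : ℝ≥0} (h : PerBddWith g A)
    {p : ℝ≥0∞} (hp : 1 ≤ p) {f : (Fin n → ℝ) → ℂ} (hf : AEStronglyMeasurable f volume) :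
    seqNorm p (an f g) ≤ A * eLpNorm f p volume :=
  (eLpNorm_mono_ennreal (Eventually.of_forall (an_enorm_le f g))).trans
    (h.seqNorm_lintegral_le hp hf)

theorem PerBdd.memSeq_an {g : (Fin n → ℝ) → ℂ} (h : PerBdd g) {p : ℝ≥0∞} (hp : 1 ≤ p)
    {f : (Fin n → ℝ) → ℂ} (hf : MemLp f p volume) : MemSeq p (an f g) :=
  let ⟨_, hA⟩ := h
  (hA.seqNorm_an_le hp hf.1).trans_lt (ENNReal.mul_lt_top ENNReal.coe_lt_top hf.2)

theorem PerBdd.memLp_sy {φ : (Fin n → ℝ) → ℂ} (h : PerBdd φ) {p : ℝ≥0∞} (hp : 1 ≤ p)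
    {c : (Fin n → ℤ) → ℂ} (hc : MemSeq p c) : MemLp (SelfAffine.sy φ c) p volume :=
  let ⟨_, hA⟩ := h
  ⟨PerBdd.aesm_sy ⟨_, hA⟩ hp hc,
    (hA.eLpNorm_sy_le hp c).trans_lt (ENNReal.mul_lt_top ENNReal.coe_lt_top hc)⟩

/-- The unit sequence supported at `μ`. -/
def dl (μ : Fin n → ℤ) : (Fin n → ℤ) → ℂ := Pi.single μ 1

theorem memSeq_dl (p : ℝ≥0∞) (μ : Fin n → ℤ) : MemSeq p (dl μ) := by
  rw [memSeq_iff_memLp]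
  have := memLp_indicator_const (μ := Measure.count) p (measurableSet_singleton μ) (1 : ℂ)
    (Or.inr (by simp))
  convert this using 1
  ext ν
  simp [dl, Pi.single_apply, Set.indicator_apply]

theorem sy_dl (φ : (Fin n → ℝ) → ℂ) (μ : Fin n → ℤ) : sy φ (dl μ) = fun x => φ (x - vec μ) := by
  ext x
  rw [sy, tsum_eq_single μ]
  · simp [dl]
  · intro ν hν; simp [dl, hν]

theorem PerBdd.memLp {g : (Fin n → ℝ) → ℂ} (h : PerBdd g) {p : ℝ≥0∞} (hp : 1 ≤ p) :
    MemLp g p volume := by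
  simpa [sy_dl] using h.memLp_sy hp (memSeq_dl p 0)

theorem PerBdd.lintegral_ne_top {g : (Fin n → ℝ) → ℂ} (h : PerBdd g) {p : ℝ≥0∞} (hp : 1 ≤ p)
    {f : (Fin n → ℝ) → ℂ} (hf : MemLp f p volume) (ν : Fin n → ℤ) :
    ∫⁻ y, ‖g (y - vec ν)‖ₑ * ‖f y‖ₑ ≠ ∞ := by
  obtain ⟨A, hA⟩ := h
  have := enorm_le_seqNorm hp (fun ν : Fin n → ℤ => ∫⁻ y, ‖g (y - vec ν)‖ₑ * ‖f y‖ₑ) ν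
  rw [enorm_eq_self] at this
  exact (this.trans_lt ((hA.seqNorm_lintegral_le hp hf.1).trans_lt
    (ENNReal.mul_lt_top ENNReal.coe_lt_top hf.2))).ne

theorem PerBdd.integrable_mul {g : (Fin n → ℝ) → ℂ} (h : PerBdd g) {p : ℝ≥0∞} (hp : 1 ≤ p)
    {f : (Fin n → ℝ) → ℂ} (hf : MemLp f p volume) (ν : Fin n → ℤ) :
    Integrable (fun y => f y * conj (g (y - vec ν))) volume := by
  refine ⟨hf.1.mul (Complex.continuous_conj.comp_aestronglyMeasurable (aesm_shift h.aesm _)), ?_⟩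
  rw [HasFiniteIntegral]
  simpa [mul_comm] using (h.lintegral_ne_top hp hf ν).lt_top

/-- `⟨∑ c(ν) φ(· - ν), g(· - μ)⟩` is the convolution of `c` with the correlation of `φ` and `g`. -/
theorem an_sy {φ g : (Fin n → ℝ) → ℂ} (hφ : PerBdd φ) (hg : PerBdd g) {p : ℝ≥0∞} (hp : 1 ≤ p)
    {c : (Fin n → ℤ) → ℂ} (hc : MemSeq p c) : an (sy φ c) g = cconv c (an φ g) := by
  ext μ
  have hcj : AEStronglyMeasurable (fun y => conj (g (y - vec μ))) volume :=
    Complex.continuous_conj.comp_aestronglyMeasurable (aesm_shift hg.aesm _)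
  simp only [an, sy, cconv, ← tsum_mul_right]
  rw [integral_tsum]
  · refine tsum_congr fun ν => ?_
    rw [← integral_const_mul,
      ← integral_sub_right_eq_self (fun y => c ν * (φ y * conj (g (y - vec (μ - ν))))) (vec ν)]
    simp [mul_assoc]
  · intro ν
    exact ((aesm_shift hφ.aesm _).const_mul _).mul hcj
  · rw [← lintegral_tsum (f := fun ν y => ‖c ν * φ (y - vec ν) * conj (g (y - vec μ))‖ₑ)
      fun ν => (((aesm_shift hφ.aesm _).const_mul _).mul hcj).enorm]
    obtain ⟨A, hA⟩ := hφ
    obtain ⟨B, hB⟩ := hg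
    refine ne_top_of_le_ne_top ?_ (lintegral_mono_ae (g := fun y =>
      seqNorm ∞ c * A * ‖g (y - vec μ)‖ₑ) ?_)
    · rw [lintegral_const_mul'' _ (aesm_shift hB.aesm _).enorm,
        lintegral_sub_right_eq_self (fun x => ‖g x‖ₑ)]
      refine ENNReal.mul_ne_top (ENNReal.mul_ne_top (hc.top hp).ne ENNReal.coe_ne_top) ?_
      exact (hB.lintegral_le.trans_lt ENNReal.coe_lt_top).ne
    · filter_upwards [hA.synth_enorm_le c] with y hy
      simp only [enorm_mul (a := c _ * φ _), ENNReal.tsum_mul_right, RCLike.enorm_conj]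
      gcongr

theorem conj_tsum' {ι : Type*} (f : ι → ℂ) : conj (∑' i, f i) = ∑' i, conj (f i) :=
  Complex.conjCLE.map_tsum

theorem an_sy_right {f g : (Fin n → ℝ) → ℂ} {p : ℝ≥0∞} (hp : 1 ≤ p) (hf : MemLp f p volume)
    (hg : PerBdd g) {b : (Fin n → ℤ) → ℂ} (hb : MemSeq 1 b) :
    an f (sy g b) = cconv (an f g) (bstar b) := by
  ext μ
  rw [cconv, ← (Equiv.addLeft μ).tsum_eq]
  simp only [Equiv.coe_addLeft, bstar, neg_sub, add_sub_cancel_left]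
  simp only [an, sy, conj_tsum', ← tsum_mul_left, ← integral_mul_const]
  have hm : ∀ κ : Fin n → ℤ, AEStronglyMeasurable
      (fun y => f y * conj (b κ * g (y - vec μ - vec κ))) volume := fun κ =>
    hf.1.mul (Complex.continuous_conj.comp_aestronglyMeasurable
      ((by simpa [sub_sub] using aesm_shift hg.aesm (vec μ + vec κ) :
        AEStronglyMeasurable (fun y => g (y - vec μ - vec κ)) volume).const_mul _))
  rw [integral_tsum hm]
  · refine tsum_congr fun κ => integral_congr_ae (Eventually.of_forall fun y => ?_)
    simp only [map_mul, vec_add, sub_sub]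
    ring
  · obtain ⟨A, hA⟩ := hg
    refine ne_top_of_le_ne_top ?_ (ENNReal.tsum_le_tsum (g := fun κ =>
      ‖b κ‖ₑ * (A * eLpNorm f p volume)) fun κ => ?_)
    · rw [ENNReal.tsum_mul_right, ← seqNorm_one]
      exact ENNReal.mul_ne_top hb.ne (ENNReal.mul_ne_top ENNReal.coe_ne_top hf.2.ne)
    · have h1 := enorm_le_seqNorm hp (fun ν : Fin n → ℤ => ∫⁻ y, ‖g (y - vec ν)‖ₑ * ‖f y‖ₑ) (μ + κ)
      rw [enorm_eq_self] at h1
      have h2 := h1.trans (hA.seqNorm_lintegral_le hp hf.1)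
      refine le_trans (le_of_eq ?_) (mul_le_mul_right h2 _)
      rw [← lintegral_const_mul' _ _ enorm_ne_top]
      refine lintegral_congr fun y => ?_
      simp only [enorm_mul, RCLike.enorm_conj, vec_add, sub_sub]
      ring

theorem tsum_enorm_prod_sy {φ : (Fin n → ℝ) → ℂ} {A : ℝ≥0} (h : PerBddWith φ A)
    (c b : (Fin n → ℤ) → ℂ) :
    ∀ᵐ x, ∑' ν, ∑' κ, ‖c ν * (b κ * φ (x - vec ν - vec κ))‖ₑ ≤
      seqNorm 1 b * (seqNorm ∞ c * A) := by
  filter_upwards [ae_all_shift (h.synth_enorm_le c)] with x hx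
  rw [ENNReal.tsum_comm, seqNorm_one, ← ENNReal.tsum_mul_right]
  refine ENNReal.tsum_le_tsum fun κ => ?_
  refine le_trans (le_of_eq ?_) (mul_le_mul_right (hx κ) _)
  rw [← ENNReal.tsum_mul_left]
  refine tsum_congr fun ν => ?_
  rw [sub_right_comm]
  simp only [enorm_mul]
  ring

theorem PerBddWith.sy {φ : (Fin n → ℝ) → ℂ} {A : ℝ≥0} (h : PerBddWith φ A)
    {b : (Fin n → ℤ) → ℂ} (hb : MemSeq 1 b) :
    PerBddWith (sy φ b) ((seqNorm 1 b).toNNReal * A) := by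
  refine ⟨PerBdd.aesm_sy ⟨A, h⟩ le_rfl hb, ?_⟩
  have h1 : seqNorm ∞ (fun _ : Fin n → ℤ => (1 : ℂ)) ≤ 1 := by
    rw [seqNorm, eLpNorm_exponent_top]
    exact eLpNormEssSup_le_of_ae_enorm_bound (by simp)
  filter_upwards [tsum_enorm_prod_sy h (fun _ => 1) b] with x hx
  push_cast
  rw [ENNReal.coe_toNNReal hb.ne]
  refine le_trans (ENNReal.tsum_le_tsum fun ν => enorm_tsum_le_tsum_enorm) ?_
  simp only [one_mul] at hx
  refine hx.trans ?_
  gcongr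
  exact mul_le_of_le_one_left' h1

theorem PerBdd.sy {φ : (Fin n → ℝ) → ℂ} (h : PerBdd φ) {b : (Fin n → ℤ) → ℂ} (hb : MemSeq 1 b) :
    PerBdd (sy φ b) := let ⟨_, hA⟩ := h; ⟨_, hA.sy hb⟩

/-- Associativity of the action of sequences on functions. -/
theorem sy_sy {φ : (Fin n → ℝ) → ℂ} (hφ : PerBdd φ) {p : ℝ≥0∞} (hp : 1 ≤ p)
    {c b : (Fin n → ℤ) → ℂ} (hc : MemSeq p c) (hb : MemSeq 1 b) :
    sy (sy φ b) c =ᵐ[volume] sy φ (cconv c b) := by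
  obtain ⟨A, hA⟩ := hφ
  filter_upwards [tsum_enorm_prod_sy hA c b] with x hx
  have hfin : ∑' ν, ∑' κ, ‖c ν * (b κ * φ (x - vec ν - vec κ))‖ₑ ≠ ∞ :=
    (hx.trans_lt (ENNReal.mul_lt_top hb (ENNReal.mul_lt_top (hc.top hp) ENNReal.coe_lt_top))).ne
  have hre : ∀ ν σ : Fin n → ℤ, x - vec ν - vec (σ - ν) = x - vec σ := by
    intro ν σ; simp
  have hsum : Summable fun q : (Fin n → ℤ) × (Fin n → ℤ) =>
      c q.1 * b (q.2 - q.1) * φ (x - vec q.2) := by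
    refine summable_of_tsum_enorm ?_
    rw [ENNReal.tsum_prod']
    convert hfin using 3 with ν
    rw [← (Equiv.subRight ν).tsum_eq (fun κ => ‖c ν * (b κ * φ (x - vec ν - vec κ))‖ₑ)]
    simp only [Equiv.subRight_apply, hre, mul_assoc]
  have h1 : sy (sy φ b) c x = ∑' ν, ∑' σ, c ν * b (σ - ν) * φ (x - vec σ) := by
    refine tsum_congr fun ν => ?_
    rw [sy, ← tsum_mul_left,
      ← (Equiv.subRight ν).tsum_eq (fun κ => c ν * (b κ * φ (x - vec ν - vec κ)))]
    simp only [Equiv.subRight_apply, hre, mul_assoc]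
  have h2 : ∑' ν, ∑' σ, c ν * b (σ - ν) * φ (x - vec σ) =
      ∑' σ, ∑' ν, c ν * b (σ - ν) * φ (x - vec σ) :=
    (Summable.tsum_comm (f := fun ν σ => c ν * b (σ - ν) * φ (x - vec σ)) hsum).symm
  have h3 : ∀ σ, ∑' ν, c ν * b (σ - ν) * φ (x - vec σ) = cconv c b σ * φ (x - vec σ) :=
    fun σ => tsum_mul_right
  rw [h1, h2]
  exact tsum_congr h3

/-! ### Linearity -/

theorem sy_const_mul (φ : (Fin n → ℝ) → ℂ) (k : ℂ) (c : (Fin n → ℤ) → ℂ) (x : Fin n → ℝ) :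
    sy φ (fun ν => k * c ν) x = k * sy φ c x := by
  simp only [sy, mul_assoc, tsum_mul_left]

theorem sy_add {φ : (Fin n → ℝ) → ℂ} (h : PerBdd φ) {p : ℝ≥0∞} (hp : 1 ≤ p)
    {c d : (Fin n → ℤ) → ℂ} (hc : MemSeq p c) (hd : MemSeq p d) :
    sy φ (c + d) =ᵐ[volume] fun x => sy φ c x + sy φ d x := by
  filter_upwards [h.ae_summable hp hc, h.ae_summable hp hd] with x h1 h2
  simp only [sy, Pi.add_apply, add_mul, h1.tsum_add h2]

theorem sy_sum {φ : (Fin n → ℝ) → ℂ} (h : PerBdd φ) {p : ℝ≥0∞} (hp : 1 ≤ p) {κ : Type*}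
    (s : Finset κ) {c : κ → (Fin n → ℤ) → ℂ} (hc : ∀ i ∈ s, MemSeq p (c i)) :
    sy φ (fun ν => ∑ i ∈ s, c i ν) =ᵐ[volume] fun x => ∑ i ∈ s, sy φ (c i) x := by
  have : ∀ᵐ x, ∀ i ∈ s, Summable fun ν => c i ν * φ (x - vec ν) :=
    (ae_ball_iff s.countable_toSet).2 fun i hi => h.ae_summable hp (hc i hi)
  filter_upwards [this] with x hx
  simp only [sy, Finset.sum_mul]
  exact Summable.tsum_finsetSum hx

theorem sum_sy {κ : Type*} (s : Finset κ) {φ : κ → (Fin n → ℝ) → ℂ} (h : ∀ i ∈ s, PerBdd (φ i))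
    {p : ℝ≥0∞} (hp : 1 ≤ p) {c : (Fin n → ℤ) → ℂ} (hc : MemSeq p c) :
    sy (fun x => ∑ i ∈ s, φ i x) c =ᵐ[volume] fun x => ∑ i ∈ s, sy (φ i) c x := by
  have : ∀ᵐ x, ∀ i ∈ s, Summable fun ν => c ν * φ i (x - vec ν) :=
    (ae_ball_iff s.countable_toSet).2 fun i hi => (h i hi).ae_summable hp hc
  filter_upwards [this] with x hx
  simp only [sy, Finset.mul_sum]
  exact Summable.tsum_finsetSum hx

theorem an_sub {g : (Fin n → ℝ) → ℂ} (h : PerBdd g) {p : ℝ≥0∞} (hp : 1 ≤ p)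
    {f f' : (Fin n → ℝ) → ℂ} (hf : MemLp f p volume) (hf' : MemLp f' p volume) :
    an (fun x => f x - f' x) g = an f g - an f' g := by
  ext ν
  simp only [an, sub_mul, Pi.sub_apply]
  exact integral_sub (h.integrable_mul hp hf ν) (h.integrable_mul hp hf' ν)

theorem an_sum {g : (Fin n → ℝ) → ℂ} (h : PerBdd g) {p : ℝ≥0∞} (hp : 1 ≤ p) {κ : Type*}
    (s : Finset κ) {f : κ → (Fin n → ℝ) → ℂ} (hf : ∀ i ∈ s, MemLp (f i) p volume) :
    an (fun x => ∑ i ∈ s, f i x) g = fun ν => ∑ i ∈ s, an (f i) g ν := by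
  ext ν
  simp only [an, Finset.sum_mul]
  exact integral_finsetSum _ fun i hi => h.integrable_mul hp (hf i hi) ν

theorem an_sum_right {κ : Type*} (s : Finset κ) {g : κ → (Fin n → ℝ) → ℂ}
    (h : ∀ i ∈ s, PerBdd (g i)) {p : ℝ≥0∞} (hp : 1 ≤ p)
    {f : (Fin n → ℝ) → ℂ} (hf : MemLp f p volume) :
    an f (fun x => ∑ i ∈ s, g i x) = fun ν => ∑ i ∈ s, an f (g i) ν := by
  ext ν
  simp only [an, map_sum, Finset.mul_sum]
  exact integral_finsetSum _ fun i hi => (h i hi).integrable_mul hp hf ν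

theorem perBdd_sum {κ : Type*} (s : Finset κ) {g : κ → (Fin n → ℝ) → ℂ}
    (h : ∀ i ∈ s, PerBdd (g i)) : PerBdd (fun x => ∑ i ∈ s, g i x) := by
  classical
  induction s using Finset.induction_on with
  | empty => exact ⟨0, by simp [aestronglyMeasurable_const], by simp⟩
  | insert i s hi ih =>
    obtain ⟨A, hA⟩ := h i (by simp)
    obtain ⟨B, hB⟩ := ih fun j hj => h j (by simp [hj])
    refine ⟨A + B, ?_, ?_⟩
    · simp only [Finset.sum_insert hi]
      exact hA.aesm.add hB.aesm
    · filter_upwards [hA.bound, hB.bound] with x h1 h2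
      simp only [Finset.sum_insert hi]
      push_cast
      refine le_trans ?_ (add_le_add h1 h2)
      rw [← ENNReal.tsum_add]
      exact ENNReal.tsum_le_tsum fun ν => enorm_add_le _ _

theorem PerBdd.const_mul {g : (Fin n → ℝ) → ℂ} (h : PerBdd g) (k : ℂ) :
    PerBdd (fun x => k * g x) := by
  obtain ⟨A, hA⟩ := h
  refine ⟨‖k‖₊ * A, hA.aesm.const_mul k, ?_⟩
  filter_upwards [hA.bound] with x hx
  simp only [enorm_mul, ENNReal.tsum_mul_left]
  push_cast
  exact mul_le_mul_right hx _

theorem an_const_mul_right (f g : (Fin n → ℝ) → ℂ) (k : ℂ) :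
    an f (fun x => k * g x) = fun ν => conj k * an f g ν := by
  ext ν; simp only [an, ← integral_const_mul, map_mul]; congr 1; ext y; ring

end

section

variable {n : ℕ}

/-! ### The dilation -/

theorem dil_zero (M : Matrix (Fin n) (Fin n) ℤ) (x : Fin n → ℝ) : dil M 0 x = x := by
  simp [dil, Matrix.map_one]

theorem dil_dil (M : Matrix (Fin n) (Fin n) ℤ) (k l : ℕ) (x : Fin n → ℝ) :
    dil M k (dil M l x) = dil M (k + l) x := by
  have := Matrix.map_mul (L := M ^ k) (M := M ^ l) (f := Int.castRingHom ℝ)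
  simp only [dil, Matrix.mulVec_mulVec, pow_add]
  congr 1
  simpa using this.symm

theorem dil_sub (M : Matrix (Fin n) (Fin n) ℤ) (l : ℕ) (x y : Fin n → ℝ) :
    dil M l (x - y) = dil M l x - dil M l y := by simp [dil, Matrix.mulVec_sub]

theorem dil_vec (M : Matrix (Fin n) (Fin n) ℤ) (l : ℕ) (ν : Fin n → ℤ) :
    dil M l (vec ν) = vec ((M ^ l) *ᵥ ν) := by
  ext i
  simp [dil, vec, Matrix.mulVec, dotProduct]

/-- The inverse of `dil M l`. -/
def undil (M : Matrix (Fin n) (Fin n) ℤ) (l : ℕ) (x : Fin n → ℝ) : Fin n → ℝ :=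
  ((M ^ l).map (Int.cast : ℤ → ℝ))⁻¹ *ᵥ x

theorem IsDilation.det_ne_zero {M : Matrix (Fin n) (Fin n) ℤ} (hM : IsDilation M) : M.det ≠ 0 := by
  intro h
  have h0 : (0 : ℂ) ∈ spectrum ℂ (M.map (Int.cast : ℤ → ℂ)) := by
    rw [spectrum.zero_mem_iff, Matrix.isUnit_iff_isUnit_det, isUnit_iff_ne_zero, not_not]
    have := (Int.castRingHom ℂ).map_det M
    simp only [h, map_zero] at this
    simpa using this.symm
  have := hM 0 h0
  norm_num at this

theorem det_map_pow (M : Matrix (Fin n) (Fin n) ℤ) (l : ℕ) :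
    ((M ^ l).map (Int.cast : ℤ → ℝ)).det = (M.det : ℝ) ^ l := by
  have := (Int.castRingHom ℝ).map_det (M ^ l)
  simpa [Matrix.det_pow] using this.symm

theorem IsDilation.isUnit_det {M : Matrix (Fin n) (Fin n) ℤ} (hM : IsDilation M) (l : ℕ) :
    IsUnit ((M ^ l).map (Int.cast : ℤ → ℝ)).det := by
  rw [det_map_pow, isUnit_iff_ne_zero]
  exact pow_ne_zero _ (by exact_mod_cast hM.det_ne_zero)

theorem IsDilation.dil_undil {M : Matrix (Fin n) (Fin n) ℤ} (hM : IsDilation M) (l : ℕ)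
    (x : Fin n → ℝ) : dil M l (undil M l x) = x := by
  simp [dil, undil, Matrix.mulVec_mulVec, Matrix.mul_nonsing_inv _ (hM.isUnit_det l)]

theorem IsDilation.undil_dil {M : Matrix (Fin n) (Fin n) ℤ} (hM : IsDilation M) (l : ℕ)
    (x : Fin n → ℝ) : undil M l (dil M l x) = x := by
  simp [dil, undil, Matrix.mulVec_mulVec, Matrix.nonsing_inv_mul _ (hM.isUnit_det l)]

theorem IsDilation.idx_pos {M : Matrix (Fin n) (Fin n) ℤ} (hM : IsDilation M) : 0 < idx M :=
  Int.natAbs_pos.2 hM.det_ne_zero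

theorem IsDilation.mulVec_injective {M : Matrix (Fin n) (Fin n) ℤ} (hM : IsDilation M) :
    Function.Injective fun ν : Fin n → ℤ => M *ᵥ ν := by
  intro μ ν h
  have h1 : dil M 1 (vec μ) = dil M 1 (vec ν) := by
    rw [dil_vec, dil_vec, pow_one]; exact congrArg vec h
  have h2 := congrArg (undil M 1) h1
  rw [hM.undil_dil, hM.undil_dil] at h2
  ext i
  have := congrFun h2 i
  simpa [vec] using this

/-- The dilation as a measurable equivalence. -/
def dilEquiv {M : Matrix (Fin n) (Fin n) ℤ} (hM : IsDilation M) (l : ℕ) :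
    (Fin n → ℝ) ≃ᵐ (Fin n → ℝ) where
  toFun := dil M l
  invFun := undil M l
  left_inv := hM.undil_dil l
  right_inv := hM.dil_undil l
  measurable_toFun := (Continuous.matrix_mulVec continuous_const continuous_id).measurable
  measurable_invFun := (Continuous.matrix_mulVec continuous_const continuous_id).measurable

theorem IsDilation.map_dil {M : Matrix (Fin n) (Fin n) ℤ} (hM : IsDilation M) (l : ℕ) :
    Measure.map (dil M l) volume =
      ENNReal.ofReal (((idx M : ℝ) ^ l)⁻¹) • (volume : Measure (Fin n → ℝ)) := by
  have hd : LinearMap.det (Matrix.toLin' ((M ^ l).map (Int.cast : ℤ → ℝ))) = (M.det : ℝ) ^ l := by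
    rw [LinearMap.det_toLin', det_map_pow]
  have := Measure.map_linearMap_addHaar_eq_smul_addHaar (volume : Measure (Fin n → ℝ))
    (f := Matrix.toLin' ((M ^ l).map (Int.cast : ℤ → ℝ)))
    (by rw [hd]; exact pow_ne_zero _ (by exact_mod_cast hM.det_ne_zero))
  rw [hd, abs_inv, abs_pow] at this
  have hi : ((idx M : ℕ) : ℝ) = |(M.det : ℝ)| := by simp [idx, Nat.cast_natAbs]
  rw [hi, ← this]
  rfl

theorem IsDilation.scale_pos {M : Matrix (Fin n) (Fin n) ℤ} (hM : IsDilation M) (l : ℕ) :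
    0 < ((idx M : ℝ) ^ l)⁻¹ := by
  have := hM.idx_pos
  positivity

theorem IsDilation.quasi {M : Matrix (Fin n) (Fin n) ℤ} (hM : IsDilation M) (l : ℕ) :
    Measure.QuasiMeasurePreserving (dil M l) volume volume :=
  ⟨(dilEquiv hM l).measurable, by
    rw [hM.map_dil]; exact Measure.smul_absolutelyContinuous⟩

theorem IsDilation.quasi_undil {M : Matrix (Fin n) (Fin n) ℤ} (hM : IsDilation M) (l : ℕ) :
    Measure.QuasiMeasurePreserving (undil M l) volume volume := by
  refine ⟨(dilEquiv hM l).symm.measurable, fun s hs => ?_⟩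
  have h1 : Measure.map (undil M l) volume s = volume (undil M l ⁻¹' s) :=
    (dilEquiv hM l).symm.map_apply s
  have h2 : Measure.map (dil M l) volume (undil M l ⁻¹' s) = volume s := by
    rw [show Measure.map (dil M l) volume (undil M l ⁻¹' s) =
      volume (dil M l ⁻¹' (undil M l ⁻¹' s)) from (dilEquiv hM l).map_apply _, ← Set.preimage_comp]
    congr 1
    ext x
    simp [hM.undil_dil]
  rw [hM.map_dil, hs, Measure.smul_apply, smul_eq_mul, mul_eq_zero] at h2
  rw [h1]
  exact h2.resolve_left (by simpa using hM.scale_pos l)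

theorem IsDilation.ae_dil {M : Matrix (Fin n) (Fin n) ℤ} (hM : IsDilation M) (l : ℕ)
    {P : (Fin n → ℝ) → Prop} (h : ∀ᵐ x, P x) : ∀ᵐ x, P (dil M l x) := (hM.quasi l).ae h

theorem IsDilation.integral_dil {M : Matrix (Fin n) (Fin n) ℤ} (hM : IsDilation M) (l : ℕ)
    (f : (Fin n → ℝ) → ℂ) :
    ∫ x, f (dil M l x) = ((idx M : ℂ) ^ l)⁻¹ * ∫ x, f x := by
  have h := (dilEquiv hM l).measurableEmbedding.integral_map (μ := volume) f
  have h2 : Measure.map (⇑(dilEquiv hM l)) volume = _ := hM.map_dil l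
  rw [h2, integral_smul_measure, ENNReal.toReal_ofReal (hM.scale_pos l).le] at h
  refine h.symm.trans ?_
  rw [Complex.real_smul]
  push_cast
  rfl

theorem IsDilation.eLpNorm_dil {M : Matrix (Fin n) (Fin n) ℤ} (hM : IsDilation M) (l : ℕ)
    (p : ℝ≥0∞) (f : (Fin n → ℝ) → ℂ) :
    eLpNorm (fun x => f (dil M l x)) p volume =
      wt (idx M) (-(l * p⁻¹.toReal)) * eLpNorm f p volume := by
  have h := (dilEquiv hM l).measurableEmbedding.eLpNorm_map_measure (μ := volume) (g := f) (p := p)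
  have h2 : Measure.map (⇑(dilEquiv hM l)) volume = _ := hM.map_dil l
  have h0 : ENNReal.ofReal (((idx M : ℝ) ^ l)⁻¹) ≠ 0 := by simpa using hM.scale_pos l
  rw [h2, eLpNorm_smul_measure_of_ne_zero h0] at h
  refine h.symm.trans ?_
  rw [smul_eq_mul, wt, ENNReal.ofReal_rpow_of_pos (hM.scale_pos l)]
  congr 2
  rw [one_div, ← Real.rpow_natCast, ← Real.rpow_neg (Nat.cast_nonneg _),
    ← Real.rpow_mul (Nat.cast_nonneg _)]
  congr 1; ring

theorem wt_idx_ne_zero {M : Matrix (Fin n) (Fin n) ℤ} (hM : IsDilation M) (s : ℝ) :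
    wt (idx M) s ≠ 0 := by
  have : (0 : ℝ) < idx M := by exact_mod_cast hM.idx_pos
  simpa [wt] using Real.rpow_pos_of_pos this s

theorem wt_ne_top (b s : ℝ) : wt b s ≠ ∞ := ENNReal.ofReal_ne_top

theorem wt_add {b : ℝ} (hb : 0 < b) (s t : ℝ) : wt b (s + t) = wt b s * wt b t := by
  rw [wt, wt, wt, Real.rpow_add hb, ENNReal.ofReal_mul (Real.rpow_nonneg hb.le _)]

theorem wt_neg_mul {b : ℝ} (hb : 0 < b) (s : ℝ) : wt b (-s) * wt b s = 1 := by
  rw [← wt_add hb]; simp [wt]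

/-- The powers of the inverse matrix tend to zero. -/
theorem IsDilation.tendsto_undil {M : Matrix (Fin n) (Fin n) ℤ} (hM : IsDilation M) :
    ∃ r : ℕ → ℝ, Tendsto r atTop (𝓝 0) ∧ ∀ l x, ‖undil M l x‖ ≤ r l * ‖x‖ := by
  let _ := Matrix.linftyOpNormedRing (n := Fin n) (α := ℂ)
  let _ := Matrix.linftyOpNormedAlgebra (n := Fin n) (R := ℂ) (α := ℂ)
  have : CompleteSpace (Matrix (Fin n) (Fin n) ℂ) := FiniteDimensional.complete ℂ _
  set B : Matrix (Fin n) (Fin n) ℂ := M.map (Int.cast : ℤ → ℂ) with hB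
  have hdet : IsUnit B.det := by
    rw [hB, show M.map (Int.cast : ℤ → ℂ) = M.map (Int.castRingHom ℂ) from rfl,
      ← RingHom.mapMatrix_apply, ← RingHom.map_det, isUnit_iff_ne_zero]
    simpa using hM.det_ne_zero
  have hu : IsUnit B := (Matrix.isUnit_iff_isUnit_det _).2 hdet
  refine ⟨fun l => ‖(B⁻¹) ^ l‖, ?_, ?_⟩
  · rcases Nat.eq_zero_or_pos n with rfl | hn
    · have : ∀ l : ℕ, ‖(B⁻¹) ^ l‖ = 0 := fun l => by
        rw [Subsingleton.elim ((B⁻¹) ^ l) 0, norm_zero]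
      simp only [this, tendsto_const_nhds]
    have : Nonempty (Fin n) := ⟨⟨0, hn⟩⟩
    -- the eigenvalues of the inverse are the inverses of those of `M`; conclude by Gelfand's
    -- formula
    have hlt : spectralRadius ℂ B⁻¹ < 1 := by
      refine spectrum.spectralRadius_lt_of_forall_lt (r := 1) (B⁻¹) ?_
      intro z hz
      have hz' : z⁻¹ ∈ spectrum ℂ B := by
        have h := spectrum.map_inv (𝕜 := ℂ) hu.unit
        have h2 : (↑hu.unit⁻¹ : Matrix (Fin n) (Fin n) ℂ) = B⁻¹ := by
          rw [Matrix.coe_units_inv]; rfl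
        rw [h2, IsUnit.unit_spec] at h
        rw [← h] at hz
        simpa using hz
      have h1 := hM _ hz'
      rw [norm_inv] at h1
      have h2 : 0 < ‖z‖ := by
        by_contra h0
        have : ‖z‖ = 0 := le_antisymm (not_lt.1 h0) (norm_nonneg _)
        rw [this] at h1; norm_num at h1
      have : ‖z‖ < 1 := by
        rwa [lt_inv_comm₀ one_pos h2, inv_one] at h1
      exact_mod_cast this
    obtain ⟨ρ, hρ1, hρ2⟩ := exists_between hlt
    have hρt : ρ ≠ ∞ := (hρ2.trans ENNReal.one_lt_top).ne
    have hev := (spectrum.pow_nnnorm_pow_one_div_tendsto_nhds_spectralRadius (B⁻¹)).eventually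
      (gt_mem_nhds hρ1)
    have hle : ∀ᶠ l : ℕ in atTop, ‖(B⁻¹) ^ l‖ ≤ ρ.toReal ^ l := by
      filter_upwards [hev, eventually_gt_atTop 0] with l hl hl0
      have h3 : (‖(B⁻¹) ^ l‖₊ : ℝ≥0∞) ≤ ρ ^ l := by
        have := ENNReal.rpow_le_rpow hl.le (Nat.cast_nonneg l : (0 : ℝ) ≤ l)
        rw [← ENNReal.rpow_mul, one_div, inv_mul_cancel₀ (by positivity), ENNReal.rpow_one,
          ENNReal.rpow_natCast] at this
        exact this
      have := ENNReal.toReal_mono (ENNReal.pow_ne_top hρt) h3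
      simpa using this
    refine squeeze_zero' (Eventually.of_forall fun l => norm_nonneg _) hle
      (tendsto_pow_atTop_nhds_zero_of_lt_one ENNReal.toReal_nonneg ?_)
    rw [← ENNReal.toReal_one]
    exact (ENNReal.toReal_lt_toReal hρt ENNReal.one_ne_top).2 hρ2
  · intro l x
    have hx : (fun i => ((undil M l x) i : ℂ)) = ((B⁻¹) ^ l) *ᵥ (fun i => (x i : ℂ)) := by
      have h1 : (B ^ l) *ᵥ (fun i => ((undil M l x) i : ℂ)) = fun i => (x i : ℂ) := by
        have h2 := hM.dil_undil l x
        have h3 : B ^ l = ((M ^ l).map (Int.cast : ℤ → ℝ)).map (Complex.ofRealHom) := by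
          have : B ^ l = (M ^ l).map (Int.castRingHom ℂ) := by
            rw [Matrix.map_pow]; rfl
          rw [this]; ext i j; simp
        rw [h3]
        ext i
        have h4 := congrArg (fun z : ℝ => (z : ℂ)) (congrFun h2 i)
        rw [← h4]
        simp [dil, Matrix.mulVec, dotProduct]
      rw [← h1, Matrix.mulVec_mulVec, Matrix.inv_pow', Matrix.nonsing_inv_mul, Matrix.one_mulVec]
      rw [Matrix.det_pow]; exact hdet.pow l
    have h5 := Matrix.linfty_opNorm_mulVec ((B⁻¹) ^ l) (fun i => (x i : ℂ))
    rw [← hx] at h5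
    have hn : ∀ y : Fin n → ℝ, ‖fun i => (y i : ℂ)‖ = ‖y‖ := by
      intro y
      simp only [Pi.norm_def]
      congr 2
      ext i
      simp
    rwa [hn, hn] at h5

/-! ### Composition with the dilation -/

theorem PerBddWith.comp_dil {M : Matrix (Fin n) (Fin n) ℤ} (hM : IsDilation M)
    {φ : (Fin n → ℝ) → ℂ} {A : ℝ≥0} (h : PerBddWith φ A) :
    PerBddWith (fun x => φ (dil M 1 x)) A := by
  refine ⟨h.aesm.comp_quasiMeasurePreserving (hM.quasi 1), ?_⟩
  filter_upwards [hM.ae_dil 1 h.bound] with x hx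
  refine le_trans ?_ hx
  simp only [dil_sub, dil_vec, pow_one]
  exact ENNReal.tsum_comp_le_tsum_of_injective hM.mulVec_injective
    (fun ν => ‖φ (dil M 1 x - vec ν)‖ₑ)

theorem PerBdd.comp_dil {M : Matrix (Fin n) (Fin n) ℤ} (hM : IsDilation M)
    {φ : (Fin n → ℝ) → ℂ} (h : PerBdd φ) : PerBdd (fun x => φ (dil M 1 x)) :=
  let ⟨_, hA⟩ := h; ⟨_, hA.comp_dil hM⟩

/-- Convolution of a sequence on `Mℤⁿ` with a sequence on `ℤⁿ`. -/
def dconv (M : Matrix (Fin n) (Fin n) ℤ) (c b : (Fin n → ℤ) → ℂ) (σ : Fin n → ℤ) : ℂ :=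
  ∑' ν, c ν * b (σ - M *ᵥ ν)

theorem seqNorm_dconv_le {M : Matrix (Fin n) (Fin n) ℤ} (hM : IsDilation M) {p : ℝ≥0∞}
    (hp : 1 ≤ p) (c : (Fin n → ℤ) → ℂ) {b : (Fin n → ℤ) → ℂ} (hb : MemSeq 1 b) :
    seqNorm p (dconv M c b) ≤ seqNorm 1 b * seqNorm p c := by
  rw [← seqNorm_enorm p c]
  have hA : seqNorm 1 b = ((seqNorm 1 b).toNNReal : ℝ≥0∞) := (ENNReal.coe_toNNReal hb.ne).symm
  have hb1 : ∑' ν, ‖b ν‖ₑ ≤ ((seqNorm 1 b).toNNReal : ℝ≥0∞) := by rw [← hA, seqNorm_one]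
  rw [hA]
  refine le_trans ?_ (eLpNorm_lintegral_kernel_le Measure.count Measure.count
    (k := fun ν μ => ‖b (ν - M *ᵥ μ)‖ₑ) (A := (seqNorm 1 b).toNNReal) (measurable_of_countable _)
    ?_ ?_ hp (measurable_of_countable _))
  · refine eLpNorm_mono_ennreal (Eventually.of_forall fun ν => ?_)
    rw [lintegral_count]
    refine enorm_tsum_le_tsum_enorm.trans (le_of_eq ?_)
    simp [mul_comm]
  · refine Eventually.of_forall fun ν => ?_
    rw [lintegral_count]
    refine le_trans (ENNReal.tsum_comp_le_tsum_of_injective (f := fun μ => ν - M *ᵥ μ) ?_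
      (fun μ => ‖b μ‖ₑ)) hb1
    exact fun μ κ h => hM.mulVec_injective (by simpa using h)
  · refine Eventually.of_forall fun ν => ?_
    rw [lintegral_count]
    exact ((Equiv.subRight (M *ᵥ ν)).tsum_eq (fun μ => ‖b μ‖ₑ)).trans_le hb1

theorem MemSeq.dconv {M : Matrix (Fin n) (Fin n) ℤ} (hM : IsDilation M) {p : ℝ≥0∞} (hp : 1 ≤ p)
    {c b : (Fin n → ℤ) → ℂ} (hc : MemSeq p c) (hb : MemSeq 1 b) : MemSeq p (dconv M c b) :=
  (seqNorm_dconv_le hM hp c hb).trans_lt (ENNReal.mul_lt_top hb hc)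

theorem sy_comp_dil {M : Matrix (Fin n) (Fin n) ℤ} (hM : IsDilation M) {φ : (Fin n → ℝ) → ℂ}
    (hφ : PerBdd φ) {p : ℝ≥0∞} (hp : 1 ≤ p)
    {c b : (Fin n → ℤ) → ℂ} (hc : MemSeq p c) (hb : MemSeq 1 b) :
    sy (fun x => sy φ b (dil M 1 x)) c =ᵐ[volume] fun x => sy φ (dconv M c b) (dil M 1 x) := by
  obtain ⟨A, hA⟩ := hφ
  have hre : ∀ (x : Fin n → ℝ) (ν κ : Fin n → ℤ),
      dil M 1 (x - vec ν) - vec κ = dil M 1 x - vec κ - vec (M *ᵥ ν) := by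
    intro x ν κ; simp [dil_sub, dil_vec]; abel
  filter_upwards [hM.ae_dil 1 (ae_all_shift hA.bound)] with x hx
  have hfin : ∑' ν, ∑' κ, ‖c ν * (b κ * φ (dil M 1 (x - vec ν) - vec κ))‖ₑ ≠ ∞ := by
    refine ne_top_of_le_ne_top (b := seqNorm 1 b * (seqNorm ∞ c * A))
      (ENNReal.mul_ne_top hb.ne (ENNReal.mul_ne_top (hc.top hp).ne ENNReal.coe_ne_top)) ?_
    rw [ENNReal.tsum_comm, seqNorm_one, ← ENNReal.tsum_mul_right]
    refine ENNReal.tsum_le_tsum fun κ => ?_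
    have h1 : ∑' ν, ‖φ (dil M 1 (x - vec ν) - vec κ)‖ₑ ≤ A := by
      refine le_trans ?_ (hx κ)
      simp only [hre]
      exact ENNReal.tsum_comp_le_tsum_of_injective hM.mulVec_injective
        (fun ν => ‖φ (dil M 1 x - vec κ - vec ν)‖ₑ)
    calc ∑' ν, ‖c ν * (b κ * φ (dil M 1 (x - vec ν) - vec κ))‖ₑ
        ≤ ∑' ν, ‖b κ‖ₑ * (seqNorm ∞ c * ‖φ (dil M 1 (x - vec ν) - vec κ)‖ₑ) := by
          refine ENNReal.tsum_le_tsum fun ν => ?_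
          rw [enorm_mul, enorm_mul, mul_left_comm]
          gcongr
          exact enorm_le_seqNorm le_top c ν
      _ ≤ _ := by
          rw [ENNReal.tsum_mul_left, ENNReal.tsum_mul_left]
          gcongr
  have hre' : ∀ ν σ : Fin n → ℤ,
      dil M 1 (x - vec ν) - vec (σ - M *ᵥ ν) = dil M 1 x - vec σ := by
    intro ν σ; rw [hre, vec_sub]; abel
  have hsum : Summable fun q : (Fin n → ℤ) × (Fin n → ℤ) =>
      c q.1 * b (q.2 - M *ᵥ q.1) * φ (dil M 1 x - vec q.2) := by
    refine summable_of_tsum_enorm ?_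
    rw [ENNReal.tsum_prod']
    convert hfin using 3 with ν
    rw [← (Equiv.subRight (M *ᵥ ν)).tsum_eq
      (fun κ => ‖c ν * (b κ * φ (dil M 1 (x - vec ν) - vec κ))‖ₑ)]
    simp only [Equiv.subRight_apply, hre', mul_assoc]
  have h1 : sy (fun x => sy φ b (dil M 1 x)) c x =
      ∑' ν, ∑' σ, c ν * b (σ - M *ᵥ ν) * φ (dil M 1 x - vec σ) := by
    refine tsum_congr fun ν => ?_
    simp only [sy]
    rw [← tsum_mul_left, ← (Equiv.subRight (M *ᵥ ν)).tsum_eq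
      (fun κ => c ν * (b κ * φ (dil M 1 (x - vec ν) - vec κ)))]
    simp only [Equiv.subRight_apply, hre', mul_assoc]
  have h2 : ∑' ν, ∑' σ, c ν * b (σ - M *ᵥ ν) * φ (dil M 1 x - vec σ) =
      ∑' σ, ∑' ν, c ν * b (σ - M *ᵥ ν) * φ (dil M 1 x - vec σ) :=
    (Summable.tsum_comm (f := fun ν σ => c ν * b (σ - M *ᵥ ν) * φ (dil M 1 x - vec σ)) hsum).symm
  rw [h1, h2]
  exact tsum_congr fun σ => tsum_mul_right

end

section

variable {n N : ℕ} {ι : Type*} [Fintype ι]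

/-! ### Families of generators and biorthogonal projections -/

/-- `∑ j, ∑ ν, c_j(ν) φ_j(x - ν)`. -/
def syf (φ : ι → (Fin n → ℝ) → ℂ) (c : ι → (Fin n → ℤ) → ℂ) (x : Fin n → ℝ) : ℂ :=
  ∑ j, sy (φ j) (c j) x

/-- The projection `f ↦ ∑ j, ∑ ν, ⟨f, φ'_j(· - ν)⟩ φ_j(· - ν)` at scale zero. -/
def Pz (φ φ' : ι → (Fin n → ℝ) → ℂ) (f : (Fin n → ℝ) → ℂ) : (Fin n → ℝ) → ℂ :=
  syf φ fun j => an f (φ' j)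

/-- Biorthogonality of two families in `𝓛^∞`. -/
structure Biorth [DecidableEq ι] (φ φ' : ι → (Fin n → ℝ) → ℂ) : Prop where
  left : ∀ j, PerBdd (φ j)
  right : ∀ j, PerBdd (φ' j)
  an_eq : ∀ j k ν, an (φ j) (φ' k) ν = if ν = 0 ∧ j = k then 1 else 0

theorem exists_common_bound {φ : ι → (Fin n → ℝ) → ℂ} (h : ∀ j, PerBdd (φ j)) :
    ∃ A : ℝ≥0, 0 < A ∧ ∀ j, PerBddWith (φ j) A := by
  choose A hA using h
  refine ⟨1 + ∑ j, A j, by positivity, fun j => ⟨(hA j).aesm, ?_⟩⟩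
  filter_upwards [(hA j).bound] with x hx
  refine hx.trans ?_
  have : A j ≤ 1 + ∑ j, A j :=
    (Finset.single_le_sum (fun _ _ => zero_le) (Finset.mem_univ j)).trans le_add_self
  exact_mod_cast this

theorem syf_congr {φ φ₂ : ι → (Fin n → ℝ) → ℂ} (h : ∀ j, φ j =ᵐ[volume] φ₂ j)
    (c : ι → (Fin n → ℤ) → ℂ) : syf φ c =ᵐ[volume] syf φ₂ c := by
  filter_upwards [ae_all_iff.2 fun j => sy_congr (h j) (c j)] with x hx
  simp only [syf, hx]

theorem memLp_syf {φ : ι → (Fin n → ℝ) → ℂ} (h : ∀ j, PerBdd (φ j)) {p : ℝ≥0∞} (hp : 1 ≤ p)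
    {c : ι → (Fin n → ℤ) → ℂ} (hc : ∀ j, MemSeq p (c j)) : MemLp (syf φ c) p volume :=
  memLp_finsetSum _ fun j _ => (h j).memLp_sy hp (hc j)

theorem eLpNorm_syf_le {φ : ι → (Fin n → ℝ) → ℂ} {A : ℝ≥0} (h : ∀ j, PerBddWith (φ j) A)
    {p : ℝ≥0∞} (hp : 1 ≤ p) {c : ι → (Fin n → ℤ) → ℂ} (hc : ∀ j, MemSeq p (c j)) :
    eLpNorm (syf φ c) p volume ≤ A * ∑ j, seqNorm p (c j) := by
  have : syf φ c = ∑ j, sy (φ j) (c j) := by ext x; simp [syf]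
  rw [this, Finset.mul_sum]
  refine (eLpNorm_sum_le (fun j _ => PerBdd.aesm_sy ⟨A, h j⟩ hp (hc j)) hp).trans ?_
  exact Finset.sum_le_sum fun j _ => (h j).eLpNorm_sy_le hp (c j)

theorem syf_sub {φ : ι → (Fin n → ℝ) → ℂ} (h : ∀ j, PerBdd (φ j)) {p : ℝ≥0∞} (hp : 1 ≤ p)
    {c d : ι → (Fin n → ℤ) → ℂ} (hc : ∀ j, MemSeq p (c j)) (hd : ∀ j, MemSeq p (d j)) :
    syf φ (fun j => c j - d j) =ᵐ[volume] fun x => syf φ c x - syf φ d x := by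
  have h1 : ∀ᵐ x, ∀ j, Summable fun ν => c j ν * φ j (x - vec ν) :=
    ae_all_iff.2 fun j => (h j).ae_summable hp (hc j)
  have h2 : ∀ᵐ x, ∀ j, Summable fun ν => d j ν * φ j (x - vec ν) :=
    ae_all_iff.2 fun j => (h j).ae_summable hp (hd j)
  filter_upwards [h1, h2] with x hx hy
  simp only [syf, ← Finset.sum_sub_distrib]
  refine Finset.sum_congr rfl fun j _ => ?_
  simp only [sy, Pi.sub_apply, sub_mul]
  exact (hx j).tsum_sub (hy j)

theorem syf_add {φ : ι → (Fin n → ℝ) → ℂ} (h : ∀ j, PerBdd (φ j)) {p : ℝ≥0∞} (hp : 1 ≤ p)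
    {c d : ι → (Fin n → ℤ) → ℂ} (hc : ∀ j, MemSeq p (c j)) (hd : ∀ j, MemSeq p (d j)) :
    syf φ (fun j => c j + d j) =ᵐ[volume] fun x => syf φ c x + syf φ d x := by
  filter_upwards [ae_all_iff.2 fun j => sy_add (h j) hp (hc j) (hd j)] with x hx
  simp only [syf, hx, Finset.sum_add_distrib]

theorem cconv_ite (c : (Fin n → ℤ) → ℂ) (P : Prop) [Decidable P] :
    cconv c (fun ν => if ν = 0 ∧ P then 1 else 0) = if P then c else 0 := by
  ext ν
  by_cases hP : P
  · rw [cconv, tsum_eq_single ν]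
    · simp [hP]
    · intro μ hμ; simp [sub_eq_zero, Ne.symm hμ]
  · simp [cconv, hP]

section
variable [DecidableEq ι]

theorem Biorth.an_syf {φ φ' : ι → (Fin n → ℝ) → ℂ} (h : Biorth φ φ') {p : ℝ≥0∞} (hp : 1 ≤ p)
    {c : ι → (Fin n → ℤ) → ℂ} (hc : ∀ j, MemSeq p (c j)) (k : ι) :
    an (syf φ c) (φ' k) = c k := by
  have h1 : an (syf φ c) (φ' k) = fun ν => ∑ j, an (sy (φ j) (c j)) (φ' k) ν :=
    an_sum (h.right k) hp Finset.univ fun j _ => (h.left j).memLp_sy hp (hc j)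
  have h2 : ∀ j, an (sy (φ j) (c j)) (φ' k) = if j = k then c j else 0 := by
    intro j
    rw [an_sy (h.left j) (h.right k) hp (hc j), ← cconv_ite]
    congr 1
    ext ν; exact h.an_eq j k ν
  rw [h1]
  ext ν
  simp only [h2]
  rw [Finset.sum_eq_single k] <;> simp +contextual

theorem Biorth.Pz_syf {φ φ' : ι → (Fin n → ℝ) → ℂ} (h : Biorth φ φ') {p : ℝ≥0∞} (hp : 1 ≤ p)
    {c : ι → (Fin n → ℤ) → ℂ} (hc : ∀ j, MemSeq p (c j)) : Pz φ φ' (syf φ c) = syf φ c := by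
  rw [Pz]
  congr 1
  ext1 j
  exact h.an_syf hp hc j

/-- Coefficients are controlled by the function they synthesize. -/
theorem Biorth.seqNorm_le {φ φ' : ι → (Fin n → ℝ) → ℂ} (h : Biorth φ φ') {B : ℝ≥0}
    (hB : ∀ j, PerBddWith (φ' j) B) {p : ℝ≥0∞} (hp : 1 ≤ p)
    {c : ι → (Fin n → ℤ) → ℂ} (hc : ∀ j, MemSeq p (c j)) (k : ι) :
    seqNorm p (c k) ≤ B * eLpNorm (syf φ c) p volume := by
  nth_rewrite 1 [← h.an_syf hp hc k]
  exact (hB k).seqNorm_an_le hp (memLp_syf h.left hp hc).1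

end

theorem Pz_congr (φ φ' : ι → (Fin n → ℝ) → ℂ) {f g : (Fin n → ℝ) → ℂ} (h : f =ᵐ[volume] g) :
    Pz φ φ' f = Pz φ φ' g := by
  rw [Pz, Pz]
  congr 1
  ext1 j
  exact an_congr h (ae_eq_refl _)

theorem Pz_sub {φ φ' : ι → (Fin n → ℝ) → ℂ} (h : ∀ j, PerBdd (φ j)) (h' : ∀ j, PerBdd (φ' j))
    {p : ℝ≥0∞} (hp : 1 ≤ p) {f g : (Fin n → ℝ) → ℂ} (hf : MemLp f p volume)
    (hg : MemLp g p volume) :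
    Pz φ φ' (fun x => f x - g x) =ᵐ[volume] fun x => Pz φ φ' f x - Pz φ φ' g x := by
  have h1 : (fun j => an (fun x => f x - g x) (φ' j)) = fun j => an f (φ' j) - an g (φ' j) := by
    ext1 j; exact an_sub (h' j) hp hf hg
  rw [Pz, h1]
  exact syf_sub h hp (fun j => (h' j).memSeq_an hp hf) fun j => (h' j).memSeq_an hp hg

theorem memLp_Pz {φ φ' : ι → (Fin n → ℝ) → ℂ} (h : ∀ j, PerBdd (φ j)) (h' : ∀ j, PerBdd (φ' j))
    {p : ℝ≥0∞} (hp : 1 ≤ p) {f : (Fin n → ℝ) → ℂ} (hf : MemLp f p volume) :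
    MemLp (Pz φ φ' f) p volume :=
  memLp_syf h hp fun j => (h' j).memSeq_an hp hf

theorem exists_Pz_bound {φ φ' : ι → (Fin n → ℝ) → ℂ} (h : ∀ j, PerBdd (φ j))
    (h' : ∀ j, PerBdd (φ' j)) :
    ∃ K : ℝ≥0, 1 ≤ K ∧ ∀ (p : ℝ≥0∞), 1 ≤ p → ∀ f : (Fin n → ℝ) → ℂ, MemLp f p volume →
      eLpNorm (Pz φ φ' f) p volume ≤ K * eLpNorm f p volume := by
  obtain ⟨A, -, hA⟩ := exists_common_bound h
  obtain ⟨B, -, hB⟩ := exists_common_bound h'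
  refine ⟨1 + A * (Fintype.card ι * B), le_self_add, fun p hp f hf => ?_⟩
  refine (eLpNorm_syf_le hA hp fun j => (h' j).memSeq_an hp hf).trans ?_
  calc (A : ℝ≥0∞) * ∑ j, seqNorm p (an f (φ' j))
      ≤ A * ∑ _j : ι, B * eLpNorm f p volume := by
        gcongr with j
        exact (hB j).seqNorm_an_le hp hf.1
    _ ≤ _ := by
        rw [Finset.sum_const, nsmul_eq_mul, Finset.card_univ]
        push_cast
        rw [add_mul, one_mul, mul_assoc, mul_assoc]
        exact le_add_self

/-! ### The projections at scale `l` -/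

theorem synth_eq (M : Matrix (Fin n) (Fin n) ℤ) (φ : Fin N → (Fin n → ℝ) → ℂ) (l : ℕ)
    (c : Fin N → (Fin n → ℤ) → ℂ) : synth M φ l c = fun x => syf φ c (dil M l x) := rfl

theorem IsDilation.pairing_eq {M : Matrix (Fin n) (Fin n) ℤ} (hM : IsDilation M)
    (f g : (Fin n → ℝ) → ℂ) (l : ℕ) (ν : Fin n → ℤ) :
    (idx M : ℂ) ^ l * pairing M f g l ν = an (fun x => f (undil M l x)) g ν := by
  have h := hM.integral_dil l (fun y => f (undil M l y) * conj (g (y - vec ν)))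
  simp only [hM.undil_dil] at h
  have h0 : (idx M : ℂ) ^ l ≠ 0 := pow_ne_zero _ (by exact_mod_cast hM.idx_pos.ne')
  rw [pairing, h, ← mul_assoc, mul_inv_cancel₀ h0, one_mul]
  rfl

theorem IsDilation.proj_eq {M : Matrix (Fin n) (Fin n) ℤ} (hM : IsDilation M)
    (φ φ' : Fin N → (Fin n → ℝ) → ℂ) (l : ℕ) (f : (Fin n → ℝ) → ℂ) :
    proj M φ φ' l f = fun x => Pz φ φ' (fun x => f (undil M l x)) (dil M l x) := by
  rw [proj, synth_eq]
  simp only [hM.pairing_eq]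
  rfl

theorem IsDilation.memLp_dil {M : Matrix (Fin n) (Fin n) ℤ} (hM : IsDilation M) (l : ℕ)
    {p : ℝ≥0∞} {f : (Fin n → ℝ) → ℂ} (hf : MemLp f p volume) :
    MemLp (fun x => f (dil M l x)) p volume :=
  ⟨hf.1.comp_quasiMeasurePreserving (hM.quasi l), by
    rw [hM.eLpNorm_dil]; exact ENNReal.mul_lt_top (wt_ne_top _ _).lt_top hf.2⟩

theorem IsDilation.eLpNorm_undil {M : Matrix (Fin n) (Fin n) ℤ} (hM : IsDilation M) (l : ℕ)
    (p : ℝ≥0∞) (f : (Fin n → ℝ) → ℂ) :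
    eLpNorm f p volume =
      wt (idx M) (-(l * p⁻¹.toReal)) * eLpNorm (fun x => f (undil M l x)) p volume := by
  rw [← hM.eLpNorm_dil]
  simp only [hM.undil_dil]

theorem IsDilation.memLp_undil {M : Matrix (Fin n) (Fin n) ℤ} (hM : IsDilation M) (l : ℕ)
    {p : ℝ≥0∞} {f : (Fin n → ℝ) → ℂ} (hf : MemLp f p volume) :
    MemLp (fun x => f (undil M l x)) p volume := by
  refine ⟨hf.1.comp_quasiMeasurePreserving (hM.quasi_undil l), ?_⟩
  have h := hf.2
  rw [hM.eLpNorm_undil l] at h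
  by_contra hc
  rw [not_lt, top_le_iff] at hc
  rw [hc, ENNReal.mul_top (wt_idx_ne_zero hM _)] at h
  exact lt_irrefl _ h

theorem IsDilation.ae_undil {M : Matrix (Fin n) (Fin n) ℤ} (hM : IsDilation M) (l : ℕ)
    {P : (Fin n → ℝ) → Prop} (h : ∀ᵐ x, P x) : ∀ᵐ x, P (undil M l x) := (hM.quasi_undil l).ae h

/-- Membership in `V_l^p` up to null sets. -/
def InV (M : Matrix (Fin n) (Fin n) ℤ) (p : ℝ≥0∞) (φ : Fin N → (Fin n → ℝ) → ℂ) (l : ℕ)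
    (S : (Fin n → ℝ) → ℂ) : Prop :=
  ∃ c : Fin N → (Fin n → ℤ) → ℂ, (∀ j, MemSeq p (c j)) ∧ S =ᵐ[volume] synth M φ l c

theorem mem_V_iff {M : Matrix (Fin n) (Fin n) ℤ} {p : ℝ≥0∞} {φ : Fin N → (Fin n → ℝ) → ℂ} {l : ℕ}
    {S : (Fin n → ℝ) → ℂ} :
    S ∈ V M p φ l ↔ ∃ c : Fin N → (Fin n → ℤ) → ℂ, (∀ j, MemSeq p (c j)) ∧ S = synth M φ l c := by
  constructor
  · rintro ⟨g, ⟨a, ha, rfl⟩, rfl⟩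
    exact ⟨a, ha, rfl⟩
  · rintro ⟨a, ha, rfl⟩
    exact ⟨syf φ a, ⟨a, ha, rfl⟩, rfl⟩

theorem approxError_le {M : Matrix (Fin n) (Fin n) ℤ} {p : ℝ≥0∞} {φ : Fin N → (Fin n → ℝ) → ℂ}
    {l : ℕ} {S : (Fin n → ℝ) → ℂ} (hS : InV M p φ l S) (f : (Fin n → ℝ) → ℂ) :
    approxError M p φ l f ≤ eLpNorm (fun x => f x - S x) p volume := by
  obtain ⟨c, hc, he⟩ := hS
  refine (iInf₂_le (synth M φ l c) (mem_V_iff.2 ⟨c, hc, rfl⟩)).trans (le_of_eq ?_)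
  refine eLpNorm_congr_ae ?_
  filter_upwards [he] with x hx
  rw [hx]

section facts
variable {M : Matrix (Fin n) (Fin n) ℤ} (hM : IsDilation M) {p : ℝ≥0∞} (hp : 1 ≤ p)
  {φ φ' : Fin N → (Fin n → ℝ) → ℂ}
include hM hp

theorem InV.memLp (h : ∀ j, PerBdd (φ j)) {l : ℕ} {S : (Fin n → ℝ) → ℂ} (hS : InV M p φ l S) :
    MemLp S p volume := by
  obtain ⟨c, hc, he⟩ := hS
  exact (hM.memLp_dil l (memLp_syf h hp hc)).ae_eq he.symm

theorem InV.add (h : ∀ j, PerBdd (φ j)) {l : ℕ} {S S' : (Fin n → ℝ) → ℂ} (hS : InV M p φ l S)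
    (hS' : InV M p φ l S') : InV M p φ l (fun x => S x + S' x) := by
  obtain ⟨c, hc, he⟩ := hS
  obtain ⟨c', hc', he'⟩ := hS'
  refine ⟨fun j => c j + c' j, fun j => (hc j).add (hc' j), ?_⟩
  filter_upwards [he, he', hM.ae_dil l (syf_add h hp hc hc')] with x h1 h2 h3
  simp only [h1, h2, synth_eq, h3]

theorem InV.sub (h : ∀ j, PerBdd (φ j)) {l : ℕ} {S S' : (Fin n → ℝ) → ℂ} (hS : InV M p φ l S)
    (hS' : InV M p φ l S') : InV M p φ l (fun x => S x - S' x) := by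
  obtain ⟨c, hc, he⟩ := hS
  obtain ⟨c', hc', he'⟩ := hS'
  refine ⟨fun j => c j - c' j, fun j => ?_, ?_⟩
  · exact (hc j).sub (hc' j)
  filter_upwards [he, he', hM.ae_dil l (syf_sub h hp hc hc')] with x h1 h2 h3
  simp only [h1, h2, synth_eq, h3]

theorem inV_proj (h' : ∀ j, PerBdd (φ' j)) (l : ℕ)
    {f : (Fin n → ℝ) → ℂ} (hf : MemLp f p volume) : InV M p φ l (proj M φ φ' l f) :=
  ⟨fun j => an (fun x => f (undil M l x)) (φ' j),
    fun j => (h' j).memSeq_an hp (hM.memLp_undil l hf), by rw [hM.proj_eq]; rfl⟩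

theorem memLp_proj (h : ∀ j, PerBdd (φ j)) (h' : ∀ j, PerBdd (φ' j)) (l : ℕ)
    {f : (Fin n → ℝ) → ℂ} (hf : MemLp f p volume) : MemLp (proj M φ φ' l f) p volume :=
  (inV_proj hM hp h' l hf).memLp hM hp h

omit hp in
theorem proj_congr (l : ℕ) {f g : (Fin n → ℝ) → ℂ} (hfg : f =ᵐ[volume] g) :
    proj M φ φ' l f = proj M φ φ' l g := by
  rw [hM.proj_eq, hM.proj_eq, Pz_congr φ φ' (hM.ae_undil l hfg)]

theorem proj_sub (h : ∀ j, PerBdd (φ j)) (h' : ∀ j, PerBdd (φ' j)) (l : ℕ)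
    {f g : (Fin n → ℝ) → ℂ} (hf : MemLp f p volume) (hg : MemLp g p volume) :
    proj M φ φ' l (fun x => f x - g x) =ᵐ[volume]
      fun x => proj M φ φ' l f x - proj M φ φ' l g x := by
  have := hM.ae_dil l (Pz_sub h h' hp (hM.memLp_undil l hf) (hM.memLp_undil l hg))
  filter_upwards [this] with x hx
  simp only [hM.proj_eq, hx]

theorem proj_of_inV (h : Biorth φ φ') {l : ℕ} {S : (Fin n → ℝ) → ℂ} (hS : InV M p φ l S) :
    proj M φ φ' l S =ᵐ[volume] S := by
  obtain ⟨c, hc, he⟩ := hS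
  refine EventuallyEq.trans ?_ he.symm
  have h1 : (fun x => S (undil M l x)) =ᵐ[volume] syf φ c := by
    filter_upwards [hM.ae_undil l he] with x hx
    simp only [hx, synth_eq, hM.dil_undil]
  rw [hM.proj_eq, Pz_congr φ φ' h1, h.Pz_syf hp hc]
  rfl

end facts

theorem exists_proj_bound {M : Matrix (Fin n) (Fin n) ℤ} (hM : IsDilation M)
    {φ φ' : Fin N → (Fin n → ℝ) → ℂ} (h : ∀ j, PerBdd (φ j)) (h' : ∀ j, PerBdd (φ' j)) :
    ∃ K : ℝ≥0, 1 ≤ K ∧ ∀ (p : ℝ≥0∞), 1 ≤ p → ∀ (l : ℕ) (f : (Fin n → ℝ) → ℂ), MemLp f p volume →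
      eLpNorm (proj M φ φ' l f) p volume ≤ K * eLpNorm f p volume := by
  obtain ⟨K, hK1, hK⟩ := exists_Pz_bound h h'
  refine ⟨K, hK1, fun p hp l f hf => ?_⟩
  rw [hM.proj_eq, hM.eLpNorm_dil, hM.eLpNorm_undil l p f, mul_left_comm]
  gcongr
  exact hK p hp _ (hM.memLp_undil l hf)

/-- Refinability makes the spaces `V_l^p` increasing. -/
theorem InV.succ {M : Matrix (Fin n) (Fin n) ℤ} (hM : IsDilation M) {p : ℝ≥0∞} (hp : 1 ≤ p)
    {φ : Fin N → (Fin n → ℝ) → ℂ} (h : ∀ j, PerBdd (φ j)) (href : Refinable M φ) {l : ℕ}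
    {S : (Fin n → ℝ) → ℂ} (hS : InV M p φ l S) : InV M p φ (l + 1) S := by
  obtain ⟨a, ha, he⟩ := hS
  obtain ⟨c, hc, hφ⟩ := href
  refine ⟨fun k ν => ∑ j, dconv M (a j) (c j k) ν,
    fun k => memSeq_sum _ fun j _ => (ha j).dconv hM hp (hc j k), ?_⟩
  have h1 : ∀ j, sy (φ j) (a j) =ᵐ[volume]
      fun x => ∑ k, sy (φ k) (dconv M (a j) (c j k)) (dil M 1 x) := by
    intro j
    have e1 : φ j =ᵐ[volume] fun x => ∑ k, sy (φ k) (c j k) (dil M 1 x) := hφ j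
    refine (sy_congr e1 (a j)).trans ?_
    refine (sum_sy Finset.univ (fun k _ => ((h k).sy (hc j k)).comp_dil hM) hp (ha j)).trans ?_
    have := ae_all_iff.2 fun k => sy_comp_dil hM (h k) hp (ha j) (hc j k)
    filter_upwards [this] with x hx
    exact Finset.sum_congr rfl fun k _ => hx k
  have h2 : ∀ k, sy (φ k) (fun ν => ∑ j, dconv M (a j) (c j k) ν) =ᵐ[volume]
      fun x => ∑ j, sy (φ k) (dconv M (a j) (c j k)) x := fun k =>
    sy_sum (h k) hp Finset.univ fun j _ => (ha j).dconv hM hp (hc j k)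
  filter_upwards [he, hM.ae_dil l (ae_all_iff.2 h1), hM.ae_dil (l + 1) (ae_all_iff.2 h2)]
    with x hx hx1 hx2
  rw [hx]
  simp only [synth_eq, syf, hx1, hx2, dil_dil, add_comm 1 l]
  exact Finset.sum_comm

theorem InV.mono {M : Matrix (Fin n) (Fin n) ℤ} (hM : IsDilation M) {p : ℝ≥0∞} (hp : 1 ≤ p)
    {φ : Fin N → (Fin n → ℝ) → ℂ} (h : ∀ j, PerBdd (φ j)) (href : Refinable M φ) {l l' : ℕ}
    (hl : l ≤ l') {S : (Fin n → ℝ) → ℂ} (hS : InV M p φ l S) : InV M p φ l' S := by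
  induction l', hl using Nat.le_induction with
  | base => exact hS
  | succ k _ ih => exact ih.succ hM hp h href

theorem IsDual.biorth {M : Matrix (Fin n) (Fin n) ℤ} {Γ₀ : Finset (Fin n → ℤ)}
    {T : Set (Fin n → ℝ)} (hT : IsSelfAffineTile M Γ₀ T) {φ φ' : Fin N → (Fin n → ℝ) → ℂ}
    (hφ : ∀ j, MemPer T ∞ (φ j)) (hd : IsDual T φ φ') : Biorth φ φ' where
  left j := (memPer_top_iff hT).1 (hφ j)
  right j := (memPer_top_iff hT).1 (hd.1 j)
  an_eq j k ν := by simpa [an, eq_comm] using hd.2 j k 0 ν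

theorem Biorth.isDual {M : Matrix (Fin n) (Fin n) ℤ} {Γ₀ : Finset (Fin n → ℤ)}
    {T : Set (Fin n → ℝ)} (hT : IsSelfAffineTile M Γ₀ T) {φ φ' : Fin N → (Fin n → ℝ) → ℂ}
    (hd : Biorth φ φ') : IsDual T φ φ' := by
  refine ⟨fun j => (memPer_top_iff hT).2 (hd.right j), fun j k μ ν => ?_⟩
  have h := hd.an_eq j k (ν - μ)
  rw [an, ← integral_sub_right_eq_self _ (vec μ)] at h
  simp only [vec_sub, sub_sub, add_sub_cancel] at h
  rw [h]
  simp only [sub_eq_zero, eq_comm]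

end

section

variable {n N : ℕ}

/-! ### Continuity of translations and averaging of periodic functions -/

/-- Translations are continuous in `L^1`. -/
theorem tendsto_translate {g : (Fin n → ℝ) → ℂ} (hg : MemLp g 1 volume) :
    Tendsto (fun s : Fin n → ℝ => ∫⁻ x, ‖g (x - s) - g x‖ₑ) (𝓝 0) (𝓝 0) := by
  have hc : Continuous fun s : Fin n → ℝ => DomAddAct.mk (-s) +ᵥ hg.toLp g := by
    have : Fact ((1 : ℝ≥0∞) ≠ ∞) := ⟨ENNReal.one_ne_top⟩
    exact (DomAddAct.mkHomeomorph.continuous.comp continuous_neg).vadd continuous_const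
  have h0 := (tendsto_iff_edist_tendsto_0.1 (hc.tendsto 0))
  refine h0.congr fun s => ?_
  rw [DomAddAct.mk_vadd_toLp, DomAddAct.mk_vadd_toLp, Lp.edist_toLp_toLp,
    eLpNorm_one_eq_lintegral_enorm]
  refine lintegral_congr fun x => ?_
  simp [sub_eq_neg_add]

theorem lintegral_cube_add {H : (Fin n → ℝ) → ℝ≥0∞} (hH : Measurable H)
    (hper : ∀ x (ν : Fin n → ℤ), H (x - vec ν) = H x) (z : Fin n → ℝ) :
    ∫⁻ t in cube n, H (z + t) = ∫⁻ t in cube n, H t := by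
  have h1 : ∫⁻ t in cube n, H (z + t) = ∫⁻ t, (cube n).indicator 1 (t - z) * H t := by
    rw [← lintegral_indicator measurableSet_cube,
      ← lintegral_sub_right_eq_self (fun t => (cube n).indicator (fun t => H (z + t)) t) z]
    refine lintegral_congr fun t => ?_
    by_cases ht : t - z ∈ cube n <;> simp [ht]
  have hm : Measurable fun t => (cube n).indicator (1 : (Fin n → ℝ) → ℝ≥0∞) (t - z) * H t :=
    ((measurable_one.indicator measurableSet_cube).comp (measurable_id.sub_const z)).mul hH
  rw [h1, lintegral_eq_cube _ hm]
  refine lintegral_congr fun t => ?_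
  simp only [hper, ENNReal.tsum_mul_right]
  obtain ⟨ν, hν, huniq⟩ := existsUnique_sub_mem_cube (t - z)
  rw [tsum_eq_single ν]
  · rw [sub_right_comm] at hν; simp [hν]
  · intro μ hμ
    have : t - vec μ - z ∉ cube n := fun h => hμ (huniq μ (by rwa [sub_right_comm] at h))
    simp [this]

/-- Averaging a function of the dilated variable over translates. -/
theorem lintegral_average {M : Matrix (Fin n) (Fin n) ℤ} (hM : IsDilation M) (l : ℕ)
    {H G : (Fin n → ℝ) → ℝ≥0∞} (hH : Measurable H)
    (hper : ∀ x (ν : Fin n → ℤ), H (x - vec ν) = H x) (hG : Measurable G) :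
    ∫⁻ t in cube n, ∫⁻ x, G (x - undil M l t) * H (dil M l x) =
      (∫⁻ x, G x) * ∫⁻ t in cube n, H t := by
  have hmd : Measurable (dil M l) := (dilEquiv hM l).measurable
  have h1 : ∀ t, ∫⁻ x, G (x - undil M l t) * H (dil M l x) =
      ∫⁻ x, G x * H (dil M l x + t) := by
    intro t
    rw [← lintegral_sub_right_eq_self (fun x => G x * H (dil M l x + t)) (undil M l t)]
    refine lintegral_congr fun x => ?_
    rw [dil_sub, hM.dil_undil, sub_add_cancel]
  simp only [h1]
  rw [lintegral_lintegral_swap]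
  · have h2 : ∀ x, ∫⁻ t in cube n, G x * H (dil M l x + t) = G x * ∫⁻ t in cube n, H t := by
      intro x
      have hHx : Measurable fun t => H (dil M l x + t) := hH.comp (measurable_const.add measurable_id)
      rw [lintegral_const_mul _ hHx, lintegral_cube_add hH hper]
    simp only [h2]
    rw [lintegral_mul_const _ hG]
  · exact ((hG.comp measurable_snd).mul (hH.comp
      ((hmd.comp measurable_snd).add measurable_fst))).aemeasurable

/-! ### The kernel of the projection -/

/-- The kernel `∑ j, ∑ ν, |φ_j(x - ν)| |φ'_j(y - ν)|`. -/
def absKer (φ φ' : Fin N → (Fin n → ℝ) → ℂ) (x y : Fin n → ℝ) : ℝ≥0∞ :=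
  ∑ j, ∑' ν : Fin n → ℤ, ‖φ j (x - vec ν)‖ₑ * ‖φ' j (y - vec ν)‖ₑ

/-- The function `∑ j, ∑ ν, (∫ conj φ'_j) φ_j(x - ν)`, formally the projection of the constant
function `1`. -/
def projOne (φ φ' : Fin N → (Fin n → ℝ) → ℂ) : (Fin n → ℝ) → ℂ :=
  syf φ fun j _ => ∫ y, conj (φ' j y)

section kernel
variable {φ φ' : Fin N → (Fin n → ℝ) → ℂ}

theorem measurable_absKer (hm : ∀ j, Measurable (φ j)) (hm' : ∀ j, Measurable (φ' j)) :
    Measurable (Function.uncurry (absKer φ φ')) := by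
  refine Finset.measurable_fun_sum (f := fun (j : Fin N) (q : (Fin n → ℝ) × (Fin n → ℝ)) =>
    ∑' ν : Fin n → ℤ, ‖φ j (q.1 - vec ν)‖ₑ * ‖φ' j (q.2 - vec ν)‖ₑ)
    Finset.univ fun j _ => Measurable.tsum fun ν => ?_
  exact ((hm j).comp (measurable_fst.sub_const _)).enorm.mul
    ((hm' j).comp (measurable_snd.sub_const _)).enorm

theorem measurable_absKer_comp (hm : ∀ j, Measurable (φ j)) (hm' : ∀ j, Measurable (φ' j))
    {X : Type*} [MeasurableSpace X] {a b : X → Fin n → ℝ} (ha : Measurable a) (hb : Measurable b) :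
    Measurable fun q => absKer φ φ' (a q) (b q) := by
  have h : (fun q => absKer φ φ' (a q) (b q)) =
      Function.uncurry (absKer φ φ') ∘ fun q => (a q, b q) := by
    funext q; simp only [Function.comp_apply, Function.uncurry_apply_pair]
  rw [h]
  exact (measurable_absKer hm hm').comp (ha.prodMk hb)

theorem absKer_shift (x y : Fin n → ℝ) (μ : Fin n → ℤ) :
    absKer φ φ' (x - vec μ) (y - vec μ) = absKer φ φ' x y := by
  refine Finset.sum_congr rfl fun j _ => ?_
  rw [← (Equiv.addLeft μ).tsum_eq (fun ν => ‖φ j (x - vec ν)‖ₑ * ‖φ' j (y - vec ν)‖ₑ)]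
  simp only [Equiv.coe_addLeft, vec_add, sub_sub]

theorem absKer_diag_le {A : ℝ≥0} (h : ∀ j, PerBddWith (φ j) A) (h' : ∀ j, PerBddWith (φ' j) A)
    (t : Fin n → ℝ) : ∀ᵐ z, absKer φ φ' z (z - t) ≤ N * (A * A) := by
  have h1 : ∀ᵐ z, ∀ j, ∑' ν : Fin n → ℤ, ‖φ j (z - vec ν)‖ₑ ≤ A := ae_all_iff.2 fun j => (h j).bound
  have h2 : ∀ᵐ z, ∀ j, ∀ ν : Fin n → ℤ, ‖φ' j (z - t - vec ν)‖ₑ ≤ A :=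
    ae_all_iff.2 fun j => ae_shift (ae_all_shift (h' j).ae_le) t
  filter_upwards [h1, h2] with z hz hz'
  calc absKer φ φ' z (z - t) ≤ ∑ _j : Fin N, (A : ℝ≥0∞) * A := by
        refine Finset.sum_le_sum fun j _ => ?_
        calc _ ≤ ∑' ν : Fin n → ℤ, ‖φ j (z - vec ν)‖ₑ * A :=
              ENNReal.tsum_le_tsum fun ν => mul_le_mul_right (hz' j ν) _
          _ ≤ _ := by rw [ENNReal.tsum_mul_right]; exact mul_le_mul_left (hz j) _
    _ = _ := by simp

theorem lintegral_absKer_le {A : ℝ≥0} (h : ∀ j, PerBddWith (φ j) A)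
    (h' : ∀ j, PerBddWith (φ' j) A) (hm' : ∀ j, Measurable (φ' j)) :
    ∀ᵐ z, ∫⁻ y, absKer φ φ' z y ≤ N * (A * A) := by
  filter_upwards [ae_all_iff.2 fun j => (h j).bound] with z hz
  have hms : ∀ j (ν : Fin n → ℤ), Measurable fun y => ‖φ' j (y - vec ν)‖ₑ := fun j ν =>
    ((hm' j).comp (measurable_id.sub_const (vec ν))).enorm
  simp only [absKer]
  rw [lintegral_finsetSum _ fun j _ => Measurable.tsum fun ν => (hms j ν).const_mul _]
  calc _ ≤ ∑ _j : Fin N, (A : ℝ≥0∞) * A := by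
        refine Finset.sum_le_sum fun j _ => ?_
        rw [lintegral_tsum fun ν => ((hms j ν).const_mul _).aemeasurable]
        calc _ ≤ ∑' ν : Fin n → ℤ, ‖φ j (z - vec ν)‖ₑ * A := by
              refine ENNReal.tsum_le_tsum fun ν => ?_
              rw [lintegral_const_mul _ (hms j ν),
                lintegral_sub_right_eq_self (fun y => ‖φ' j y‖ₑ)]
              exact mul_le_mul_right (h' j).lintegral_le _
          _ ≤ _ := by rw [ENNReal.tsum_mul_right]; exact mul_le_mul_left (hz j) _
    _ = _ := by simp

theorem memSeq_const (a : ℂ) : MemSeq ∞ (fun _ : Fin n → ℤ => a) := by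
  refine lt_of_le_of_lt ?_ (enorm_lt_top (x := a))
  rw [seqNorm, eLpNorm_exponent_top]
  exact eLpNormEssSup_le_of_ae_enorm_bound (by simp)

theorem measurable_projOne (hm : ∀ j, Measurable (φ j)) : Measurable (projOne φ φ') :=
  Finset.measurable_fun_sum (f := fun (j : Fin N) x => sy (φ j) (fun _ => ∫ y, conj (φ' j y)) x)
    Finset.univ fun j _ => Measurable.tsum fun ν =>
      ((hm j).comp (measurable_id.sub_const (vec ν))).const_mul (∫ y, conj (φ' j y))

theorem projOne_shift (x : Fin n → ℝ) (μ : Fin n → ℤ) :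
    projOne φ φ' (x - vec μ) = projOne φ φ' x := by
  simp only [projOne, syf, sy]
  refine Finset.sum_congr rfl fun j _ => ?_
  rw [← (Equiv.addLeft μ).tsum_eq (fun ν => (∫ y, conj (φ' j y)) * φ j (x - vec ν))]
  simp only [Equiv.coe_addLeft, vec_add, sub_sub]

/-- The error of the projection is controlled by the kernel. -/
theorem enorm_Pz_sub_le (h : ∀ j, PerBdd (φ j)) (h' : ∀ j, PerBdd (φ' j))
    (hm' : ∀ j, Measurable (φ' j))
    {g : (Fin n → ℝ) → ℂ} (hg : MemLp g ∞ volume) (hgm : Measurable g) :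
    ∀ᵐ z, ‖Pz φ φ' g z - g z * projOne φ φ' z‖ₑ ≤ ∫⁻ y, absKer φ φ' z y * ‖g y - g z‖ₑ := by
  have h1 : ∀ᵐ z, ∀ j, Summable fun ν => an g (φ' j) ν * φ j (z - vec ν) :=
    ae_all_iff.2 fun j => (h j).ae_summable le_top ((h' j).memSeq_an le_top hg)
  have h2 : ∀ᵐ z, ∀ j, Summable fun ν : Fin n → ℤ => (∫ y, conj (φ' j y)) * φ j (z - vec ν) :=
    ae_all_iff.2 fun j => (h j).ae_summable le_top (memSeq_const _)
  filter_upwards [h1, h2] with z hz1 hz2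
  have hcoef : ∀ j ν, an g (φ' j) ν - g z * ∫ y, conj (φ' j y) =
      ∫ y, (g y - g z) * conj (φ' j (y - vec ν)) := by
    intro j ν
    have hi1 := (h' j).integrable_mul le_top hg ν
    have hi2 := (h' j).integrable_mul le_top (memLp_top_const (g z)) ν
    simp only [sub_mul]
    rw [integral_sub hi1 hi2, integral_const_mul,
      integral_sub_right_eq_self (fun y => conj (φ' j y))]
    rfl
  have hdiff : Pz φ φ' g z - g z * projOne φ φ' z =
      ∑ j, ∑' ν, (∫ y, (g y - g z) * conj (φ' j (y - vec ν))) * φ j (z - vec ν) := by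
    simp only [Pz, projOne, syf, Finset.mul_sum, ← Finset.sum_sub_distrib]
    refine Finset.sum_congr rfl fun j _ => ?_
    simp only [sy]
    rw [← tsum_mul_left, ← (hz1 j).tsum_sub ((hz2 j).mul_left _)]
    refine tsum_congr fun ν => ?_
    rw [← hcoef]
    ring
  have hms : ∀ j (ν : Fin n → ℤ), Measurable fun y =>
      ‖φ j (z - vec ν)‖ₑ * ‖φ' j (y - vec ν)‖ₑ * ‖g y - g z‖ₑ := fun j ν =>
    (((hm' j).comp (measurable_id.sub_const (vec ν))).enorm.const_mul _).mul
      (hgm.sub_const _).enorm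
  rw [hdiff]
  simp only [absKer, Finset.sum_mul, ← ENNReal.tsum_mul_right]
  rw [lintegral_finsetSum _ fun j _ => Measurable.tsum fun ν => hms j ν]
  refine (enorm_sum_le _ _).trans (Finset.sum_le_sum fun j _ => ?_)
  rw [lintegral_tsum fun ν => (hms j ν).aemeasurable]
  refine enorm_tsum_le_tsum_enorm.trans (ENNReal.tsum_le_tsum fun ν => ?_)
  simp only [mul_assoc]
  rw [enorm_mul, lintegral_const_mul' _ _ enorm_ne_top, mul_comm]
  gcongr
  refine (enorm_integral_le_lintegral_enorm _).trans (le_of_eq ?_)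
  simp [mul_comm]

end kernel

/-! ### Density of the union of the spaces `V_l` -/

theorem norm_undil_le {M : Matrix (Fin n) (Fin n) ℤ} (hM : IsDilation M) :
    ∃ C : ℝ, ∀ l, ∀ t ∈ cube n, ‖undil M l t‖ ≤ C := by
  obtain ⟨r, hr, hle⟩ := hM.tendsto_undil
  obtain ⟨C, hC⟩ := hr.bddAbove_range
  refine ⟨max C 0, fun l t ht => (hle l t).trans ?_⟩
  have h1 : ‖t‖ ≤ 1 := by
    rw [pi_norm_le_iff_of_nonneg zero_le_one]
    intro i
    have := ht i trivial
    rw [Real.norm_eq_abs, abs_le]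
    constructor <;> linarith [this.1, this.2]
  have h2 : r l ≤ max C 0 := (hC ⟨l, rfl⟩).trans (le_max_left _ _)
  calc r l * ‖t‖ ≤ max C 0 * ‖t‖ := by gcongr
    _ ≤ max C 0 * 1 := by gcongr
    _ = _ := mul_one _

theorem tendsto_undil_apply {M : Matrix (Fin n) (Fin n) ℤ} (hM : IsDilation M) (t : Fin n → ℝ) :
    Tendsto (fun l => undil M l t) atTop (𝓝 0) := by
  obtain ⟨r, hr, hle⟩ := hM.tendsto_undil
  refine squeeze_zero_norm (fun l => hle l t) ?_
  simpa using hr.mul_const ‖t‖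

/-- Integrals over a ball of a dilated periodic function are controlled by its mean. -/
theorem setLIntegral_dil_le {M : Matrix (Fin n) (Fin n) ℤ} (hM : IsDilation M) (R : ℝ) :
    ∃ C : ℝ≥0∞, C ≠ ∞ ∧ ∀ (l : ℕ) (H : (Fin n → ℝ) → ℝ≥0∞), Measurable H →
      (∀ x (ν : Fin n → ℤ), H (x - vec ν) = H x) →
      ∫⁻ x in Metric.closedBall 0 R, H (dil M l x) ≤ C * ∫⁻ t in cube n, H t := by
  obtain ⟨C, hC⟩ := norm_undil_le hM
  set B' : Set (Fin n → ℝ) := Metric.closedBall 0 (R + C) with hB'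
  have hmB' : MeasurableSet B' := Metric.isClosed_closedBall.measurableSet
  refine ⟨volume B', (isCompact_closedBall _ _).measure_lt_top.ne, fun l H hH hper => ?_⟩
  have h1 := lintegral_average hM l hH hper (measurable_one.indicator hmB' (β := ℝ≥0∞))
  rw [lintegral_indicator_one hmB'] at h1
  rw [← h1]
  calc ∫⁻ x in Metric.closedBall 0 R, H (dil M l x)
      = ∫⁻ _ in cube n, ∫⁻ x in Metric.closedBall 0 R, H (dil M l x) := by simp [volume_cube]
    _ ≤ _ := by
        refine setLIntegral_mono' measurableSet_cube fun t ht => ?_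
        rw [← lintegral_indicator Metric.isClosed_closedBall.measurableSet]
        refine lintegral_mono fun x => ?_
        by_cases hx : x ∈ Metric.closedBall (0 : Fin n → ℝ) R
        · have : x - undil M l t ∈ B' := by
            rw [hB', mem_closedBall_zero_iff]
            rw [mem_closedBall_zero_iff] at hx
            exact (norm_sub_le _ _).trans (add_le_add hx (hC l t ht))
          simp [hx, this]
        · simp [hx]

section density
variable {M : Matrix (Fin n) (Fin n) ℤ} (hM : IsDilation M) {φ φ' : Fin N → (Fin n → ℝ) → ℂ}
include hM

/-- On bounded functions, `P_l f - f · (P 1)(M^l ·)` tends to zero locally in `L^1`. -/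
theorem tendsto_proj_sub_mul (h : ∀ j, PerBdd (φ j)) (h' : ∀ j, PerBdd (φ' j))
    (hm : ∀ j, Measurable (φ j)) (hm' : ∀ j, Measurable (φ' j))
    {f : (Fin n → ℝ) → ℂ} (hf : MemLp f ∞ volume) (hfm : Measurable f) (R : ℝ) :
    Tendsto (fun l => ∫⁻ x in Metric.closedBall 0 R,
      ‖proj M φ φ' l f x - f x * projOne φ φ' (dil M l x)‖ₑ) atTop (𝓝 0) := by
  obtain ⟨A₁, -, hA₁⟩ := exists_common_bound h
  obtain ⟨A₂, -, hA₂⟩ := exists_common_bound h'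
  set A := max A₁ A₂
  have hA : ∀ j, PerBddWith (φ j) A := fun j =>
    ⟨(hA₁ j).aesm, (hA₁ j).bound.mono fun x hx => hx.trans (by exact_mod_cast le_max_left _ _)⟩
  have hA' : ∀ j, PerBddWith (φ' j) A := fun j =>
    ⟨(hA₂ j).aesm, (hA₂ j).bound.mono fun x hx => hx.trans (by exact_mod_cast le_max_right _ _)⟩
  have hmd : ∀ l, Measurable (dil M l) := fun l => (dilEquiv hM l).measurable
  have hmu : ∀ l, Measurable (undil M l) := fun l => (dilEquiv hM l).symm.measurable
  set B : Set (Fin n → ℝ) := Metric.closedBall 0 R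
  have hmB : MeasurableSet B := Metric.isClosed_closedBall.measurableSet
  obtain ⟨CB, hCB, hdom⟩ := setLIntegral_dil_le hM R
  set Cf : ℝ≥0∞ := eLpNorm f ∞ volume with hCf
  have hfb : ∀ᵐ x, ‖f x‖ₑ ≤ Cf := by
    rw [hCf, eLpNorm_exponent_top]; exact enorm_ae_le_eLpNormEssSup f volume
  let F : ℕ → (Fin n → ℝ) → ℝ≥0∞ := fun l t =>
    ∫⁻ x in B, absKer φ φ' (dil M l x) (dil M l x - t) * ‖f (x - undil M l t) - f x‖ₑ
  have hjm : ∀ l, Measurable (Function.uncurry fun (x t : Fin n → ℝ) =>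
      absKer φ φ' (dil M l x) (dil M l x - t) * ‖f (x - undil M l t) - f x‖ₑ) := by
    intro l
    refine (measurable_absKer_comp hm hm' ((hmd l).comp measurable_fst)
      (((hmd l).comp measurable_fst).sub measurable_snd)).mul ?_
    exact ((hfm.comp (measurable_fst.sub ((hmu l).comp measurable_snd))).sub
      (hfm.comp measurable_fst)).enorm
  -- the difference is bounded pointwise by an integral of translation differences of `f`;
  -- substitute `t = M^l x - y` in it
  have hkey : ∀ l, ∫⁻ x in B, ‖proj M φ φ' l f x - f x * projOne φ φ' (dil M l x)‖ₑ ≤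
      ∫⁻ t, F l t := by
    intro l
    have h1 := hM.ae_dil l (enorm_Pz_sub_le h h' hm' (hM.memLp_undil l hf) (hfm.comp (hmu l)))
    have h2 : ∫⁻ t, F l t = ∫⁻ x in B, ∫⁻ t,
        absKer φ φ' (dil M l x) (dil M l x - t) * ‖f (x - undil M l t) - f x‖ₑ := by
      simp only [F]
      rw [lintegral_lintegral_swap (hjm l).aemeasurable]
    rw [h2]
    refine lintegral_mono_ae (ae_restrict_of_ae ?_)
    filter_upwards [h1] with x hx
    simp only [hM.undil_dil] at hx
    rw [hM.proj_eq]
    refine hx.trans (le_of_eq ?_)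
    rw [← lintegral_sub_left_eq_self _ (dil M l x)]
    refine lintegral_congr fun t => ?_
    congr 4
    rw [show undil M l (dil M l x - t) = undil M l (dil M l x) - undil M l t from
      by simp [undil, Matrix.mulVec_sub], hM.undil_dil]
  refine tendsto_of_tendsto_of_tendsto_of_le_of_le tendsto_const_nhds ?_ (fun _ => zero_le) hkey
  have hzero : (0 : ℝ≥0∞) = ∫⁻ _ : Fin n → ℝ, 0 := by simp
  rw [hzero]
  refine tendsto_lintegral_of_dominated_convergence
    (fun t => 2 * Cf * (CB * ∫⁻ z in cube n, absKer φ φ' z (z - t)))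
    (fun l => (hjm l).lintegral_prod_left') (fun l => ?_) ?_ ?_
  -- domination: `f` is bounded and the kernel is periodic along the diagonal
  · refine Eventually.of_forall fun t => ?_
    have hper : ∀ x (ν : Fin n → ℤ), absKer φ φ' (x - vec ν) (x - vec ν - t) =
        absKer φ φ' x (x - t) := by
      intro x ν; rw [sub_right_comm, absKer_shift]
    have hmk : Measurable fun z => absKer φ φ' z (z - t) :=
      measurable_absKer_comp hm hm' measurable_id (measurable_id.sub_const t)
    have h3 := hdom l (fun z => absKer φ φ' z (z - t)) hmk hper
    calc F l t ≤ ∫⁻ x in B, absKer φ φ' (dil M l x) (dil M l x - t) * (2 * Cf) := by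
          refine lintegral_mono_ae (ae_restrict_of_ae ?_)
          filter_upwards [hfb, ae_shift hfb (undil M l t)] with x h1 h2
          gcongr
          refine (enorm_sub_le).trans ?_
          rw [two_mul]
          exact add_le_add h2 h1
      _ = 2 * Cf * ∫⁻ x in B, absKer φ φ' (dil M l x) (dil M l x - t) := by
          have hml : Measurable fun x => absKer φ φ' (dil M l x) (dil M l x - t) :=
            measurable_absKer_comp hm hm' (hmd l) ((hmd l).sub_const t)
          rw [lintegral_mul_const _ hml, mul_comm]
      _ ≤ _ := mul_le_mul_right h3 _
  -- the dominating function is integrable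
  · have hmk2 : Measurable fun q : (Fin n → ℝ) × (Fin n → ℝ) => absKer φ φ' q.2 (q.2 - q.1) :=
      measurable_absKer_comp hm hm' measurable_snd (measurable_snd.sub measurable_fst)
    rw [lintegral_const_mul _ (hmk2.lintegral_prod_right'.const_mul _),
      lintegral_const_mul _ hmk2.lintegral_prod_right']
    refine ENNReal.mul_ne_top (ENNReal.mul_ne_top (by simp) hf.2.ne) (ENNReal.mul_ne_top hCB ?_)
    rw [lintegral_lintegral_swap hmk2.aemeasurable]
    refine ne_top_of_le_ne_top (b := (N * (A * A) : ℝ≥0∞)) (by finiteness) ?_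
    have h4 : ∀ᵐ z ∂(volume.restrict (cube n)), ∫⁻ t, absKer φ φ' z (z - t) ≤ N * (A * A) := by
      refine ae_restrict_of_ae ?_
      filter_upwards [lintegral_absKer_le hA hA' hm'] with z hz
      rwa [lintegral_sub_left_eq_self (fun y => absKer φ φ' z y)]
    refine (lintegral_mono_ae h4).trans (le_of_eq ?_)
    simp [volume_cube]
  -- pointwise limit: the kernel is bounded and translations are continuous in `L^1` on bounded
  -- sets
  · refine Eventually.of_forall fun t => ?_
    set g : (Fin n → ℝ) → ℂ := (Metric.closedBall 0 (R + 1)).indicator f with hg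
    have hgm : MemLp g 1 volume := by
      rw [hg, memLp_indicator_iff_restrict Metric.isClosed_closedBall.measurableSet]
      have : IsFiniteMeasure (volume.restrict (Metric.closedBall (0 : Fin n → ℝ) (R + 1))) :=
        ⟨by rw [Measure.restrict_apply_univ]; exact (isCompact_closedBall _ _).measure_lt_top⟩
      exact (hf.restrict _).mono_exponent le_top
    have h5 : Tendsto (fun l => (N * (A * A) : ℝ≥0∞) *
        ∫⁻ x, ‖g (x - undil M l t) - g x‖ₑ) atTop (𝓝 0) := by
      have := (tendsto_translate hgm).comp (tendsto_undil_apply hM t)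
      simpa using ENNReal.Tendsto.const_mul this (Or.inr (by finiteness : (N * (A * A) : ℝ≥0∞) ≠ ∞))
    refine tendsto_of_tendsto_of_tendsto_of_le_of_le' tendsto_const_nhds h5
      (Eventually.of_forall fun _ => zero_le) ?_
    have hev : ∀ᶠ l in atTop, ‖undil M l t‖ < 1 :=
      (tendsto_undil_apply hM t).norm.eventually (gt_mem_nhds (by simp))
    filter_upwards [hev] with l hl
    rw [← lintegral_const_mul' _ _ (by finiteness)]
    refine le_trans (lintegral_mono_ae (g := fun x => (N * (A * A) : ℝ≥0∞) *
      ‖g (x - undil M l t) - g x‖ₑ) ?_) (setLIntegral_le_lintegral _ _)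
    rw [ae_restrict_iff' hmB]
    filter_upwards [hM.ae_dil l (absKer_diag_le hA hA' t)] with x hx hxB
    have hxB' : ‖x‖ ≤ R := mem_closedBall_zero_iff.1 hxB
    have e1 : g x = f x := Set.indicator_of_mem (mem_closedBall_zero_iff.2 (by linarith)) _
    have e2 : g (x - undil M l t) = f (x - undil M l t) :=
      Set.indicator_of_mem (mem_closedBall_zero_iff.2
        ((norm_sub_le _ _).trans (by linarith))) _
    rw [e1, e2]
    gcongr

end density

end

section

variable {n N : ℕ}

/-! ### Reproduction of constants and convergence of the projections -/

section
variable {M : Matrix (Fin n) (Fin n) ℤ} (hM : IsDilation M) {φ φ' : Fin N → (Fin n → ℝ) → ℂ}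
include hM

/-- If the dilates of a periodic function `H ≥ 0` tend to zero locally in mean against some `|f|`,
`f ≠ 0`, then `H = 0`. -/
theorem lintegral_cube_eq_zero_of_tendsto {H : (Fin n → ℝ) → ℝ≥0∞} (hH : Measurable H)
    (hper : ∀ x (ν : Fin n → ℤ), H (x - vec ν) = H x) {CH : ℝ≥0∞} (hCH : CH ≠ ∞)
    (hHb : ∀ᵐ x, H x ≤ CH) {g : (Fin n → ℝ) → ℂ} (hgm : Measurable g) (hg : MemLp g 1 volume)
    (hg0 : ∫⁻ x, ‖g x‖ₑ ≠ 0)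
    (hlim : Tendsto (fun l => ∫⁻ x, ‖g x‖ₑ * H (dil M l x)) atTop (𝓝 0)) :
    ∫⁻ t in cube n, H t = 0 := by
  have hmd : ∀ l, Measurable (dil M l) := fun l => (dilEquiv hM l).measurable
  obtain ⟨r, hr, hrle⟩ := hM.tendsto_undil
  have hsmall : ∀ δ > 0, ∀ᶠ l in atTop, ∀ t ∈ cube n, ‖undil M l t‖ < δ := by
    intro δ hδ
    have h1 : ∀ᶠ l in atTop, |r l| < δ := by
      have := hr.abs
      rw [abs_zero] at this
      exact this.eventually (gt_mem_nhds hδ)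
    filter_upwards [h1] with l hl t ht
    have h2 : ‖t‖ ≤ 1 := by
      rw [pi_norm_le_iff_of_nonneg zero_le_one]
      intro i
      have := ht i trivial
      rw [Real.norm_eq_abs, abs_le]
      constructor <;> linarith [this.1, this.2]
    calc ‖undil M l t‖ ≤ r l * ‖t‖ := hrle l t
      _ ≤ |r l| * ‖t‖ := by gcongr; exact le_abs_self _
      _ ≤ |r l| * 1 := by gcongr
      _ < δ := by rwa [mul_one]
  have hprod : (∫⁻ x, ‖g x‖ₑ) * ∫⁻ t in cube n, H t = 0 := by
    refine le_antisymm (ENNReal.le_of_forall_pos_le_add fun ε hε _ => ?_) zero_le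
    rw [zero_add]
    -- translations by `M ^ (-l) t`, `t` in the unit cube, move `g` by at most `η` in `L^1`
    obtain ⟨η, hη0, hη⟩ : ∃ η : ℝ≥0∞, 0 < η ∧ CH * η ≤ (ε / 2 : ℝ≥0) := by
      refine ⟨(ε / 2 : ℝ≥0) / (CH + 1), ?_, ?_⟩
      · exact ENNReal.div_pos (by simpa using (half_pos hε).ne') (by finiteness)
      · rw [mul_comm]
        calc ((ε / 2 : ℝ≥0) : ℝ≥0∞) / (CH + 1) * CH
            ≤ ((ε / 2 : ℝ≥0) : ℝ≥0∞) / (CH + 1) * (CH + 1) := by gcongr; exact le_self_add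
          _ ≤ _ := by rw [mul_comm]; exact ENNReal.mul_div_le
    have hT := (tendsto_translate hg).eventually (gt_mem_nhds hη0)
    obtain ⟨δ, hδ, hball⟩ := Metric.eventually_nhds_iff.1 hT
    have hε2 : (0 : ℝ≥0∞) < (ε / 2 : ℝ≥0) := ENNReal.coe_pos.2 (half_pos hε)
    obtain ⟨l, hl1, hl2⟩ := ((hsmall δ hδ).and (hlim.eventually (gt_mem_nhds hε2))).exists
    rw [← lintegral_average hM l hH hper hgm.enorm]
    calc ∫⁻ t in cube n, ∫⁻ x, ‖g (x - undil M l t)‖ₑ * H (dil M l x)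
        ≤ ∫⁻ _ in cube n, (ε : ℝ≥0∞) := by
          refine setLIntegral_mono' measurableSet_cube fun t ht => ?_
          have h3 := (hball (y := undil M l t) (by simpa using hl1 t ht)).le
          have hmdiff : Measurable fun x => ‖g (x - undil M l t) - g x‖ₑ * CH :=
            (((hgm.comp (measurable_id.sub_const (undil M l t))).sub hgm).enorm).mul_const CH
          calc ∫⁻ x, ‖g (x - undil M l t)‖ₑ * H (dil M l x)
              ≤ ∫⁻ x, (‖g (x - undil M l t) - g x‖ₑ * CH + ‖g x‖ₑ * H (dil M l x)) := by
                refine lintegral_mono_ae ?_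
                filter_upwards [hM.ae_dil l hHb] with x hx
                calc ‖g (x - undil M l t)‖ₑ * H (dil M l x)
                    = ‖(g (x - undil M l t) - g x) + g x‖ₑ * H (dil M l x) := by
                      rw [sub_add_cancel]
                  _ ≤ (‖g (x - undil M l t) - g x‖ₑ + ‖g x‖ₑ) * H (dil M l x) := by
                      gcongr; exact enorm_add_le _ _
                  _ ≤ _ := by rw [add_mul]; gcongr
            _ = (∫⁻ x, ‖g (x - undil M l t) - g x‖ₑ) * CH + ∫⁻ x, ‖g x‖ₑ * H (dil M l x) := by
                rw [lintegral_add_left hmdiff, lintegral_mul_const' _ _ hCH]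
            _ ≤ (ε / 2 : ℝ≥0) + (ε / 2 : ℝ≥0) := by
                refine add_le_add ?_ hl2.le
                refine le_trans ?_ hη
                rw [mul_comm]
                gcongr
            _ = ε := by rw [← ENNReal.coe_add, add_halves]
      _ = ε := by simp [volume_cube]
  exact (mul_eq_zero.1 hprod).resolve_left hg0

/-- The operator `P_0` reproduces constants: `P_l φ_j = φ_j` for all `l` by refinability, while
`P_l φ_j - φ_j · (P 1)(M^l ·)` tends to zero. -/
theorem projOne_eq_one (hN : 0 < N) (hb : Biorth φ φ') (hm : ∀ j, Measurable (φ j))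
    (hm' : ∀ j, Measurable (φ' j)) (href : Refinable M φ) : ∀ᵐ x, projOne φ φ' x = 1 := by
  let j₀ : Fin N := ⟨0, hN⟩
  set f := φ j₀ with hf
  have hfL : ∀ p, 1 ≤ p → MemLp f p volume := fun p hp => (hb.left j₀).memLp hp
  -- `f` is fixed by all projections
  have hfix : ∀ l, proj M φ φ' l f =ᵐ[volume] f := by
    intro l
    refine proj_of_inV hM le_top hb (InV.mono hM le_top hb.left href (Nat.zero_le l) ?_)
    refine ⟨fun j => if j = j₀ then dl 0 else 0, fun j => ?_, ?_⟩
    · by_cases h : j = j₀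
      · simp only [h, if_true]; exact memSeq_dl _ _
      · simp only [h, if_false]; exact memSeq_const 0
    · refine Eventually.of_forall fun x => ?_
      rw [synth_eq]
      simp only [syf, dil_zero]
      rw [Finset.sum_eq_single j₀]
      · simp [sy_dl, hf]
      · intro j _ h; simp [h, sy]
      · simp
  -- `f` does not vanish on some ball
  have hf0 : ∃ R : ℝ, ∫⁻ x in Metric.closedBall 0 R, ‖f x‖ₑ ≠ 0 := by
    by_contra hc
    push Not at hc
    have hall : ∀ᵐ x, f x = 0 := by
      have h1 : ∀ k : ℕ, ∀ᵐ x, x ∈ Metric.closedBall (0 : Fin n → ℝ) k → f x = 0 := by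
        intro k
        have := hc k
        rw [lintegral_eq_zero_iff (hm j₀).enorm] at this
        have h2 := (ae_restrict_iff' Metric.isClosed_closedBall.measurableSet).1 this
        filter_upwards [h2] with x hx hxB
        simpa using hx hxB
      filter_upwards [ae_all_iff.2 h1] with x hx
      obtain ⟨k, hk⟩ := exists_nat_ge ‖x‖
      exact hx k (mem_closedBall_zero_iff.2 hk)
    have h3 := hb.an_eq j₀ j₀ 0
    rw [an, integral_eq_zero_of_ae] at h3
    · simp at h3
    · filter_upwards [hall] with x hx
      simp [← hf, hx]
  obtain ⟨R, hR⟩ := hf0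
  have hmB : MeasurableSet (Metric.closedBall (0 : Fin n → ℝ) R) :=
    Metric.isClosed_closedBall.measurableSet
  set g : (Fin n → ℝ) → ℂ := (Metric.closedBall 0 R).indicator f with hg
  have hgm : Measurable g := (hm j₀).indicator hmB
  have hgL : MemLp g 1 volume := (hfL 1 le_rfl).indicator hmB
  have hgi : ∀ K : (Fin n → ℝ) → ℝ≥0∞, ∫⁻ x, ‖g x‖ₑ * K x =
      ∫⁻ x in Metric.closedBall 0 R, ‖f x‖ₑ * K x := by
    intro K
    rw [← lintegral_indicator hmB]
    refine lintegral_congr fun x => ?_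
    by_cases hx : x ∈ Metric.closedBall (0 : Fin n → ℝ) R <;> simp [hg, hx]
  -- comparing the two limits, the dilates of `|1 - P 1|` tend to zero in mean against `|f|`
  have hlim := tendsto_proj_sub_mul hM hb.left hb.right hm hm' (hfL ∞ le_top) (hm j₀) R
  have hum := measurable_projOne (φ := φ) (φ' := φ') hm
  have huL : MemLp (projOne φ φ') ∞ volume := memLp_syf hb.left le_top fun j => memSeq_const _
  have hz : ∫⁻ t in cube n, ‖1 - projOne φ φ' t‖ₑ = 0 := by
    have hsub : MemLp (fun x => 1 - projOne φ φ' x) ∞ volume := (memLp_top_const (1 : ℂ)).sub huL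
    refine lintegral_cube_eq_zero_of_tendsto hM (measurable_const.sub hum).enorm
      (fun x ν => by rw [projOne_shift]) (CH := eLpNorm (fun x => 1 - projOne φ φ' x) ∞ volume)
      hsub.2.ne ?_ hgm hgL ?_ ?_
    · rw [eLpNorm_exponent_top]
      exact enorm_ae_le_eLpNormEssSup _ _
    · have := hgi 1
      simp only [Pi.one_apply, mul_one] at this
      rwa [this]
    · refine hlim.congr fun l => ?_
      rw [hgi]
      refine lintegral_congr_ae (ae_restrict_of_ae ?_)
      filter_upwards [hfix l] with x hx
      rw [hx, ← enorm_mul, mul_sub, mul_one]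
  have hsm : Measurable fun x => ‖1 - projOne φ φ' x‖ₑ := (measurable_const.sub hum).enorm
  rw [lintegral_eq_zero_iff hsm] at hz
  have hz' := (ae_restrict_iff' measurableSet_cube).1 hz
  filter_upwards [ae_all_shift hz'] with x hx
  obtain ⟨ν, hν, -⟩ := existsUnique_sub_mem_cube x
  have := hx ν hν
  simp only [Pi.zero_apply, enorm_eq_zero, projOne_shift, sub_eq_zero] at this
  exact this.symm

theorem Refinable.congr {φ₂ : Fin N → (Fin n → ℝ) → ℂ} (he : ∀ j, φ j =ᵐ[volume] φ₂ j)
    (h : Refinable M φ) : Refinable M φ₂ := by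
  obtain ⟨c, hc, hφ⟩ := h
  refine ⟨c, hc, fun j => ?_⟩
  have h1 : ∀ᵐ x, ∀ k, sy (φ k) (c j k) (dil M 1 x) = sy (φ₂ k) (c j k) (dil M 1 x) :=
    ae_all_iff.2 fun k => hM.ae_dil 1 (sy_congr (he k) (c j k))
  filter_upwards [hφ j, he j, h1] with x hx hx1 hx2
  rw [← hx1, hx]
  exact Finset.sum_congr rfl fun k _ => hx2 k

omit hM in
theorem Biorth.congr {φ₂ φ₂' : Fin N → (Fin n → ℝ) → ℂ} (he : ∀ j, φ j =ᵐ[volume] φ₂ j)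
    (he' : ∀ j, φ' j =ᵐ[volume] φ₂' j) (h : Biorth φ φ') : Biorth φ₂ φ₂' where
  left j := (h.left j).congr (he j)
  right j := (h.right j).congr (he' j)
  an_eq j k ν := by rw [← an_congr (he j) (he' k), h.an_eq]

theorem proj_congr_family {φ₂ φ₂' : Fin N → (Fin n → ℝ) → ℂ} (he : ∀ j, φ j =ᵐ[volume] φ₂ j)
    (he' : ∀ j, φ' j =ᵐ[volume] φ₂' j) (l : ℕ) (f : (Fin n → ℝ) → ℂ) :
    proj M φ φ' l f =ᵐ[volume] proj M φ₂ φ₂' l f := by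
  rw [hM.proj_eq, hM.proj_eq, Pz, Pz]
  have : (fun j => an (fun x => f (undil M l x)) (φ' j)) =
      fun j => an (fun x => f (undil M l x)) (φ₂' j) := by
    ext1 j; exact an_congr (ae_eq_refl _) (he' j)
  rw [this]
  exact hM.ae_dil l (syf_congr he _)

/-- The projections of a bounded function tend to it locally in `L^1`. -/
theorem tendsto_proj_top (hN : 0 < N) (hb : Biorth φ φ') (href : Refinable M φ)
    {f : (Fin n → ℝ) → ℂ} (hf : MemLp f ∞ volume) (R : ℝ) :
    Tendsto (fun l => ∫⁻ x in Metric.closedBall 0 R, ‖proj M φ φ' l f x - f x‖ₑ) atTop (𝓝 0) := by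
  have he : ∀ j, φ j =ᵐ[volume] (hb.left j).aesm.mk := fun j => (hb.left j).aesm.ae_eq_mk
  have he' : ∀ j, φ' j =ᵐ[volume] (hb.right j).aesm.mk := fun j => (hb.right j).aesm.ae_eq_mk
  have hm : ∀ j, Measurable ((hb.left j).aesm.mk) :=
    fun j => (hb.left j).aesm.stronglyMeasurable_mk.measurable
  have hm' : ∀ j, Measurable ((hb.right j).aesm.mk) :=
    fun j => (hb.right j).aesm.stronglyMeasurable_mk.measurable
  have hb2 := hb.congr he he'
  have h1 := projOne_eq_one hM hN hb2 hm hm' (href.congr hM he)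
  have h2 := tendsto_proj_sub_mul hM hb2.left hb2.right hm hm' (hf.ae_eq hf.1.ae_eq_mk)
    hf.1.stronglyMeasurable_mk.measurable R
  refine h2.congr fun l => lintegral_congr_ae (ae_restrict_of_ae ?_)
  rw [← proj_congr hM l hf.1.ae_eq_mk]
  filter_upwards [hM.ae_dil l h1, hf.1.ae_eq_mk, proj_congr_family hM he he' l f] with x hx1 hx2 hx3
  rw [hx1, mul_one, hx3, ← hx2]

/-- The projections of an `L^p` function tend to it locally in `L^1`. -/
theorem tendsto_proj (hN : 0 < N) (hb : Biorth φ φ') (href : Refinable M φ) {p : ℝ≥0∞}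
    (hp : 1 ≤ p) {f : (Fin n → ℝ) → ℂ} (hf : MemLp f p volume) (R : ℝ) :
    Tendsto (fun l => ∫⁻ x in Metric.closedBall 0 R, ‖proj M φ φ' l f x - f x‖ₑ) atTop (𝓝 0) := by
  by_cases hpt : p = ∞
  · subst hpt; exact tendsto_proj_top hM hN hb href hf R
  obtain ⟨K, hK1, hK⟩ := exists_proj_bound hM hb.left hb.right
  set B : Set (Fin n → ℝ) := Metric.closedBall 0 R
  have hBfin : volume B ≠ ∞ := (isCompact_closedBall _ _).measure_lt_top.ne
  set CB : ℝ≥0∞ := volume B ^ (1 - 1 / p.toReal) with hCB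
  have hr : 1 ≤ p.toReal := by
    rw [← ENNReal.toReal_one]; exact ENNReal.toReal_mono hpt hp
  have hCBt : CB ≠ ∞ := by
    refine ENNReal.rpow_ne_top_of_nonneg ?_ hBfin
    rw [sub_nonneg, div_le_one (by linarith)]
    exact hr
  have hloc : ∀ h : (Fin n → ℝ) → ℂ, AEStronglyMeasurable h volume →
      ∫⁻ x in B, ‖h x‖ₑ ≤ eLpNorm h p volume * CB := by
    intro h hh
    have := eLpNorm_le_eLpNorm_mul_rpow_measure_univ hp (hh.restrict (s := B))
    rw [eLpNorm_one_eq_lintegral_enorm, Measure.restrict_apply_univ] at this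
    refine this.trans ?_
    rw [ENNReal.toReal_one, div_one]
    gcongr
    exact Measure.restrict_le_self
  rw [ENNReal.tendsto_nhds_zero]
  intro ε hε
  obtain ⟨η, hη0, hη⟩ : ∃ η : ℝ≥0∞, η ≠ 0 ∧ (K * η + η) * CB ≤ ε / 2 := by
    refine ⟨(ε / 2) / ((K + 1) * CB + 1), ?_, ?_⟩
    · refine (ENNReal.div_pos (ENNReal.half_pos hε.ne').ne' (by finiteness)).ne'
    · set D : ℝ≥0∞ := (K + 1) * CB + 1
      calc (K * ((ε / 2) / D) + (ε / 2) / D) * CB = (ε / 2) / D * ((K + 1) * CB) := by ring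
        _ ≤ (ε / 2) / D * D := by gcongr; exact le_self_add
        _ ≤ ε / 2 := by rw [mul_comm]; exact ENNReal.mul_div_le
  -- approximation by a continuous function with compact support, using the uniform bounds of
  -- `P_l`
  obtain ⟨g, hgc, hgle, hgcont, hgL⟩ := hf.exists_hasCompactSupport_eLpNorm_sub_le hpt hη0
  have hgtop : MemLp g ∞ volume := by
    obtain ⟨C, hC⟩ := hgc.exists_bound_of_continuous hgcont
    exact memLp_top_of_bound hgcont.aestronglyMeasurable C (Eventually.of_forall hC)
  have hlim := tendsto_proj_top hM hN hb href hgtop R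
  have hε2 : 0 < ε / 2 := ENNReal.half_pos hε.ne'
  filter_upwards [hlim.eventually (gt_mem_nhds hε2)] with l hl
  have hfg : MemLp (fun x => f x - g x) p volume := hf.sub hgL
  have hPfg : AEStronglyMeasurable (proj M φ φ' l fun x => f x - g x) volume :=
    (memLp_proj hM hp hb.left hb.right l hfg).1
  have hPg : AEStronglyMeasurable (proj M φ φ' l g) volume :=
    (memLp_proj hM hp hb.left hb.right l hgL).1
  calc ∫⁻ x in B, ‖proj M φ φ' l f x - f x‖ₑ
      ≤ ∫⁻ x in B, ((‖proj M φ φ' l (fun x => f x - g x) x‖ₑ + ‖f x - g x‖ₑ) +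
          ‖proj M φ φ' l g x - g x‖ₑ) := by
        refine lintegral_mono_ae (ae_restrict_of_ae ?_)
        filter_upwards [proj_sub hM hp hb.left hb.right l hf hgL] with x hx
        rw [hx]
        calc ‖proj M φ φ' l f x - f x‖ₑ
            = ‖((proj M φ φ' l f x - proj M φ φ' l g x) - (f x - g x)) +
                (proj M φ φ' l g x - g x)‖ₑ := by congr 1; ring
          _ ≤ _ := (enorm_add_le _ _).trans (by gcongr; exact enorm_sub_le)
    _ = ((∫⁻ x in B, ‖proj M φ φ' l (fun x => f x - g x) x‖ₑ) + ∫⁻ x in B, ‖f x - g x‖ₑ) +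
          ∫⁻ x in B, ‖proj M φ φ' l g x - g x‖ₑ := by
        have hmg : AEMeasurable (fun x => ‖proj M φ φ' l g x - g x‖ₑ) (volume.restrict B) :=
          (hPg.sub hgL.1).restrict.enorm
        rw [lintegral_add_right' _ hmg,
          lintegral_add_left' hPfg.restrict.enorm]
    _ ≤ ((K * η) * CB + η * CB) + ε / 2 := by
        refine add_le_add (add_le_add ?_ ?_) hl.le
        · refine (hloc _ hPfg).trans ?_
          gcongr
          exact (hK p hp l _ hfg).trans (by gcongr; exact hgle)
        · refine (hloc _ hfg.1).trans ?_
          gcongr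
          exact hgle
    _ ≤ ε / 2 + ε / 2 := by rw [← add_mul]; gcongr
    _ = ε := ENNReal.add_halves ε

omit hM in
theorem detail_eq_sub (l k : ℕ) (f : (Fin n → ℝ) → ℂ) (x : Fin n → ℝ) :
    proj M φ φ' (l + k) f x - proj M φ φ' l f x =
      ∑ i ∈ Finset.range k, detail M φ φ' (l + i) f x := by
  induction k with
  | zero => simp
  | succ k ih => rw [Finset.sum_range_succ, ← ih, detail, ← add_assoc]; ring

/-- The error of `P_l` is bounded by the sum of the norms of the subsequent details. -/
theorem eLpNorm_sub_proj_le (hN : 0 < N) (hb : Biorth φ φ') (href : Refinable M φ) {p : ℝ≥0∞}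
    (hp : 1 ≤ p) {f : (Fin n → ℝ) → ℂ} (hf : MemLp f p volume) (l : ℕ) :
    eLpNorm (fun x => f x - proj M φ φ' l f x) p volume ≤
      ∑' k, eLpNorm (detail M φ φ' (l + k) f) p volume := by
  have hP : ∀ k, AEStronglyMeasurable (proj M φ φ' k f) volume := fun k =>
    (memLp_proj hM hp hb.left hb.right k hf).1
  have hD : ∀ k, AEStronglyMeasurable (detail M φ φ' k f) volume := fun k =>
    (hP (k + 1)).sub (hP k)
  set S := ∑' k, eLpNorm (detail M φ φ' (l + k) f) p volume
  have hstep : ∀ k, eLpNorm (fun x => proj M φ φ' (l + k) f x - proj M φ φ' l f x) p volume ≤ S := by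
    intro k
    have h1 : (fun x => proj M φ φ' (l + k) f x - proj M φ φ' l f x) =
        ∑ i ∈ Finset.range k, detail M φ φ' (l + i) f := by
      ext x; rw [detail_eq_sub]; simp
    rw [h1]
    exact (eLpNorm_sum_le (fun i _ => hD _) hp).trans (ENNReal.sum_le_tsum _)
  -- the limit `l → ∞` exists almost everywhere along a subsequence on every ball: Fatou's lemma
  have hball : ∀ R : ℕ, eLpNorm ((Metric.closedBall 0 (R : ℝ)).indicator
      (fun x => f x - proj M φ φ' l f x)) p volume ≤ S := by
    intro R
    have hmB : MeasurableSet (Metric.closedBall (0 : Fin n → ℝ) R) :=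
      Metric.isClosed_closedBall.measurableSet
    rw [eLpNorm_indicator_eq_eLpNorm_restrict hmB]
    have hlim := tendsto_proj hM hN hb href hp hf R
    have hmeas : TendstoInMeasure (volume.restrict (Metric.closedBall (0 : Fin n → ℝ) R))
        (fun k => proj M φ φ' k f) atTop f := by
      refine tendstoInMeasure_of_tendsto_eLpNorm one_ne_zero (fun k => (hP k).restrict)
        hf.1.restrict ?_
      simpa only [eLpNorm_one_eq_lintegral_enorm, Pi.sub_apply] using hlim
    obtain ⟨ns, hns, hae⟩ := hmeas.exists_seq_tendsto_ae
    have h2 := Lp.eLpNorm_lim_le_liminf_eLpNorm (p := p)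
      (μ := volume.restrict (Metric.closedBall (0 : Fin n → ℝ) R))
      (f := fun i x => proj M φ φ' (ns i) f x - proj M φ φ' l f x)
      (fun i => ((hP _).sub (hP _)).restrict) (fun x => f x - proj M φ φ' l f x)
      (by filter_upwards [hae] with x hx; exact hx.sub_const _)
    refine h2.trans (liminf_le_of_frequently_le' (Eventually.frequently ?_))
    filter_upwards [hns.tendsto_atTop.eventually_ge_atTop l] with i hi
    obtain ⟨k, hk⟩ := Nat.exists_eq_add_of_le hi
    rw [hk]
    exact (eLpNorm_mono_measure _ Measure.restrict_le_self).trans (hstep k)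
  -- Fatou's lemma again, for balls exhausting the space
  have h3 := Lp.eLpNorm_lim_le_liminf_eLpNorm (p := p) (μ := volume)
    (f := fun R : ℕ => (Metric.closedBall 0 (R : ℝ)).indicator (fun x => f x - proj M φ φ' l f x))
    (fun R => (hf.1.sub (hP l)).indicator Metric.isClosed_closedBall.measurableSet)
    (fun x => f x - proj M φ φ' l f x) (Eventually.of_forall fun x => by
      refine tendsto_const_nhds.congr' ?_
      filter_upwards [eventually_ge_atTop ⌈‖x‖⌉₊] with R hR
      rw [Set.indicator_of_mem]
      exact mem_closedBall_zero_iff.2 (Nat.ceil_le.1 hR))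
  exact h3.trans (liminf_le_of_frequently_le' (Eventually.of_forall hball).frequently)

end

end

section

variable {n N : ℕ}

/-! ### Weighted sequence norms -/

theorem seqNorm_mono {q : ℝ≥0∞} {a b : ℕ → ℝ≥0∞} (h : ∀ l, a l ≤ b l) :
    seqNorm q a ≤ seqNorm q b :=
  eLpNorm_mono_enorm (by simpa using h)

theorem seqNorm_le_mul {q : ℝ≥0∞} {a b : ℕ → ℝ≥0∞} {C : ℝ≥0} (h : ∀ l, a l ≤ C * b l) :
    seqNorm q a ≤ C * seqNorm q b :=
  eLpNorm_le_nnreal_smul_eLpNorm_of_ae_le_mul' (Eventually.of_forall (by simpa using h)) q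

theorem seqNorm_kernel_le {q : ℝ≥0∞} (hq : 1 ≤ q) (k : ℕ → ℕ → ℝ≥0∞) {A : ℝ≥0}
    (h1 : ∀ l, ∑' j, k l j ≤ A) (h2 : ∀ j, ∑' l, k l j ≤ A) (a : ℕ → ℝ≥0∞) :
    seqNorm q (fun l => ∑' j, k l j * a j) ≤ A * seqNorm q a := by
  have := eLpNorm_lintegral_kernel_le (Measure.count : Measure ℕ) (Measure.count : Measure ℕ)
    (k := k) (A := A) (measurable_of_countable _)
    (Eventually.of_forall (by simpa [lintegral_count] using h1))
    (Eventually.of_forall (by simpa [lintegral_count] using h2)) hq (measurable_of_countable a)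
  simpa only [lintegral_count, seqNorm] using this

theorem seqNorm_succ_le {q : ℝ≥0∞} (hq : 1 ≤ q) (a : ℕ → ℝ≥0∞) :
    seqNorm q (fun l => a (l + 1)) ≤ seqNorm q a := by
  have := seqNorm_kernel_le hq (fun l j => if j = l + 1 then 1 else 0) (A := 1)
    (fun l => by simp) (fun j => ?_) a
  · simpa using this
  · rcases j with _ | j
    · simp
    · simp [eq_comm (a := j)]

theorem seqNorm_single_le {q : ℝ≥0∞} (hq : 1 ≤ q) (t : ℝ≥0∞) :
    seqNorm q (fun l : ℕ => if l = 0 then t else 0) ≤ t := by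
  have := eLpNorm_lintegral_kernel_le (Measure.count : Measure ℕ) (Measure.dirac ())
    (k := fun l _ => if l = 0 then 1 else 0) (A := 1) (measurable_of_countable _)
    (Eventually.of_forall fun l => by by_cases h : l = 0 <;> simp [h])
    (Eventually.of_forall (by simp [lintegral_count])) hq (F := fun _ => t) measurable_const
  have h0 : q ≠ 0 := (zero_lt_one.trans_le hq).ne'
  rw [eLpNorm_const _ h0 (NeZero.ne _)] at this
  simpa [seqNorm] using this

theorem seqNorm_le_zero_add_succ {q : ℝ≥0∞} (hq : 1 ≤ q) (a : ℕ → ℝ≥0∞) :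
    seqNorm q a ≤ a 0 + seqNorm q (fun l => a (l + 1)) := by
  have h1 := seqNorm_kernel_le hq (fun l j => if l = j + 1 then 1 else 0) (A := 1)
    (fun l => ?_) (fun j => by simp) (fun l => a (l + 1))
  · have h2 : a = (fun l => if l = 0 then a 0 else 0) +
        fun l => ∑' j, (if l = j + 1 then 1 else 0) * a (j + 1) := by
      ext l
      rcases l with _ | l
      · simp
      · simp only [Pi.add_apply, Nat.succ_ne_zero, if_false, zero_add, Nat.add_right_cancel_iff]
        rw [tsum_eq_single l] <;> simp +contextual [eq_comm]
    nth_rewrite 1 [h2]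
    refine (eLpNorm_add_le (by exact .of_discrete) (by exact .of_discrete) hq).trans ?_
    exact add_le_add (seqNorm_single_le hq _) (by simpa [seqNorm] using h1)
  · rcases l with _ | l
    · simp
    · simp [eq_comm (a := l)]

theorem le_seqNorm {q : ℝ≥0∞} (hq : 1 ≤ q) (a : ℕ → ℝ≥0∞) (l : ℕ) : a l ≤ seqNorm q a := by
  simpa using enorm_le_seqNorm hq a l

theorem wt_zero_exp (b : ℝ) : wt b 0 = 1 := by simp [wt]

/-- A discrete **Hardy inequality**: tail sums are bounded for the weights `λ^{lα}`. -/
theorem exists_hardy {lam α : ℝ} (hlam : 1 < lam) (hα : 0 < α) :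
    ∃ C : ℝ≥0, ∀ (q : ℝ≥0∞), 1 ≤ q → ∀ e : ℕ → ℝ≥0∞,
      seqNorm q (fun l : ℕ => wt lam (l * α) * ∑' k, e (l + k)) ≤
        C * seqNorm q (fun l : ℕ => wt lam (l * α) * e l) ∧
      ∑' k, e k ≤ C * seqNorm q (fun l : ℕ => wt lam (l * α) * e l) := by
  have hlam0 : 0 < lam := by linarith
  set r : ℝ≥0∞ := wt lam (-α) with hr
  have hr1 : r < 1 := by
    rw [hr, wt, ENNReal.ofReal_lt_one]
    exact Real.rpow_lt_one_of_one_lt_of_neg hlam (by linarith)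
  have hgeo : ∑' k : ℕ, r ^ k ≠ ∞ := by
    rw [ENNReal.tsum_geometric]
    exact ENNReal.inv_ne_top.2 (tsub_pos_of_lt hr1).ne'
  set C : ℝ≥0 := (∑' k : ℕ, r ^ k).toNNReal
  have hC : (C : ℝ≥0∞) = ∑' k : ℕ, r ^ k := ENNReal.coe_toNNReal hgeo
  have hpow : ∀ k : ℕ, r ^ k = wt lam (-(k * α)) := by
    intro k
    rw [hr, wt, wt, ← ENNReal.ofReal_pow (Real.rpow_nonneg hlam0.le _), ← Real.rpow_natCast,
      ← Real.rpow_mul hlam0.le]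
    congr 2; ring
  have hw : ∀ l k : ℕ, wt lam (l * α) = r ^ k * wt lam ((l + k : ℕ) * α) := by
    intro l k
    rw [hpow, ← wt_add hlam0]
    congr 1; push_cast; ring
  have hsplit : ∀ (l : ℕ) (f : ℕ → ℝ≥0∞), (∀ j, j < l → f j = 0) →
      ∑' j, f j = ∑' k, f (l + k) := by
    intro l f hf
    rw [← ENNReal.summable.sum_add_tsum_nat_add' (f := f) (k := l)]
    rw [Finset.sum_eq_zero fun j hj => hf j (Finset.mem_range.1 hj), zero_add]
    simp only [add_comm l]
  have main : ∀ (q : ℝ≥0∞), 1 ≤ q → ∀ e : ℕ → ℝ≥0∞,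
      seqNorm q (fun l : ℕ => wt lam (l * α) * ∑' k, e (l + k)) ≤
        C * seqNorm q (fun l : ℕ => wt lam (l * α) * e l) := by
    intro q hq e
    -- Schur's test for the kernel `λ^{-α(j - l)}`, `l ≤ j`
    have h1 := seqNorm_kernel_le hq (fun l j => if l ≤ j then r ^ (j - l) else 0) (A := C)
      (fun l => ?_) (fun j => ?_) (fun l : ℕ => wt lam (l * α) * e l)
    · refine le_trans (le_of_eq ?_) h1
      congr 1
      ext l
      rw [hsplit l (fun j => (if l ≤ j then r ^ (j - l) else 0) * (wt lam (j * α) * e j))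
        (fun j hj => by simp [not_le.2 hj]), ← ENNReal.tsum_mul_left]
      refine tsum_congr fun k => ?_
      simp only [le_add_iff_nonneg_right, zero_le, if_true, add_tsub_cancel_left]
      rw [hw l k, mul_assoc]
    · rw [hsplit l (fun j => if l ≤ j then r ^ (j - l) else 0)
        (fun j hj => by simp [not_le.2 hj]), hC]
      simp
    · rw [tsum_eq_sum (s := Finset.range (j + 1)), hC]
      · refine le_trans (le_of_eq ?_) (ENNReal.sum_le_tsum (Finset.range (j + 1)))
        rw [← Finset.sum_range_reflect]
        refine Finset.sum_congr rfl fun l hl => ?_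
        have : l ≤ j := Nat.lt_succ_iff.1 (Finset.mem_range.1 hl)
        rw [if_pos (by omega)]
        congr 1; omega
      · intro l hl
        have : ¬ l ≤ j := by simpa using hl
        simp [this]
  refine ⟨C, fun q hq e => ⟨main q hq e, ?_⟩⟩
  refine le_trans ?_ (main q hq e)
  refine le_trans (le_of_eq ?_)
    (le_seqNorm hq (fun l : ℕ => wt lam (l * α) * ∑' k, e (l + k)) 0)
  simp [wt_zero_exp]

/-! ### Domination of functionals on `L^p` -/

/-- `A ≤ C B` on `L^p` for some constant `C`. -/
def BddBy (p : ℝ≥0∞) (A B : ((Fin n → ℝ) → ℂ) → ℝ≥0∞) : Prop :=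
  ∃ C : ℝ≥0, ∀ f : (Fin n → ℝ) → ℂ, MemLp f p volume → A f ≤ C * B f

theorem BddBy.trans {p : ℝ≥0∞} {A B D : ((Fin n → ℝ) → ℂ) → ℝ≥0∞} (h : BddBy p A B)
    (h' : BddBy p B D) : BddBy p A D := by
  obtain ⟨C, hC⟩ := h
  obtain ⟨C', hC'⟩ := h'
  refine ⟨C * C', fun f hf => (hC f hf).trans ?_⟩
  push_cast
  rw [mul_assoc]
  gcongr
  exact hC' f hf

theorem BddBy.add {p : ℝ≥0∞} {A A' B : ((Fin n → ℝ) → ℂ) → ℝ≥0∞} (h : BddBy p A B)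
    (h' : BddBy p A' B) : BddBy p (fun f => A f + A' f) B := by
  obtain ⟨C, hC⟩ := h
  obtain ⟨C', hC'⟩ := h'
  refine ⟨C + C', fun f hf => ?_⟩
  push_cast
  rw [add_mul]
  exact add_le_add (hC f hf) (hC' f hf)

theorem normEquiv_iff {p : ℝ≥0∞} {A B : ((Fin n → ℝ) → ℂ) → ℝ≥0∞} :
    NormEquiv p A B ↔ BddBy p A B ∧ BddBy p B A := by
  constructor
  · rintro ⟨C, -, h⟩
    exact ⟨⟨C, fun f hf => (h f hf).1⟩, ⟨C, fun f hf => (h f hf).2⟩⟩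
  · rintro ⟨⟨C, hC⟩, ⟨C', hC'⟩⟩
    refine ⟨1 + C + C', by positivity, fun f hf => ⟨(hC f hf).trans ?_, (hC' f hf).trans ?_⟩⟩
    · gcongr
      exact_mod_cast (le_add_self.trans le_self_add : C ≤ 1 + C + C')
    · gcongr
      exact_mod_cast (le_add_self : C' ≤ 1 + C + C')

/-! ### The norms through the projections and the details -/

section
variable {M : Matrix (Fin n) (Fin n) ℤ} (hM : IsDilation M) {φ φ' : Fin N → (Fin n → ℝ) → ℂ}
  {p q : ℝ≥0∞} (hp : 1 ≤ p) (hq : 1 ≤ q) {lam α : ℝ}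
include hM

/-- The projections realize the best approximation up to a constant. -/
theorem exists_sub_proj_le (hb : Biorth φ φ') :
    ∃ K : ℝ≥0, ∀ (p : ℝ≥0∞), 1 ≤ p → ∀ (l : ℕ) (f : (Fin n → ℝ) → ℂ), MemLp f p volume →
      eLpNorm (fun x => f x - proj M φ φ' l f x) p volume ≤ K * approxError M p φ l f := by
  obtain ⟨K, hK1, hK⟩ := exists_proj_bound hM hb.left hb.right
  refine ⟨1 + K, fun p hp l f hf => ?_⟩
  have h0 : ((1 + K : ℝ≥0) : ℝ≥0∞) ≠ 0 := by positivity
  rw [← ENNReal.inv_mul_le_iff h0 ENNReal.coe_ne_top]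
  refine le_iInf₂ fun S hS => ?_
  rw [ENNReal.inv_mul_le_iff h0 ENNReal.coe_ne_top]
  obtain ⟨c, hc, hSc⟩ := mem_V_iff.1 hS
  have hIn : InV M p φ l S := ⟨c, hc, by rw [hSc]⟩
  have hSL := hIn.memLp hM hp hb.left
  have hfS : MemLp (fun x => f x - S x) p volume := hf.sub hSL
  have he : (fun x => f x - proj M φ φ' l f x) =ᵐ[volume]
      (fun x => f x - S x) - proj M φ φ' l (fun x => f x - S x) := by
    filter_upwards [proj_sub hM hp hb.left hb.right l hf hSL, proj_of_inV hM hp hb hIn]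
      with x h1 h2
    simp only [Pi.sub_apply]
    rw [h1, h2]; ring
  rw [eLpNorm_congr_ae he]
  refine (eLpNorm_sub_le hfS.1 (memLp_proj hM hp hb.left hb.right l hfS).1 hp).trans ?_
  push_cast
  rw [add_mul, one_mul]
  exact add_le_add le_rfl (hK p hp l _ hfS)

include hp

theorem besov_bddBy_proj (hb : Biorth φ φ') :
    BddBy p (besovNorm M p q α lam φ) (normProj M p q α lam φ φ') := by
  refine ⟨1, fun f hf => ?_⟩
  rw [ENNReal.coe_one, one_mul]
  refine add_le_add le_rfl (seqNorm_mono fun l => ?_)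
  gcongr
  exact approxError_le (inV_proj hM hp hb.right l hf) f

theorem proj_bddBy_besov (hb : Biorth φ φ') :
    BddBy p (normProj M p q α lam φ φ') (besovNorm M p q α lam φ) := by
  obtain ⟨K, hK⟩ := exists_sub_proj_le hM hb
  refine ⟨1 + K, fun f hf => ?_⟩
  have h1 : seqNorm q (fun l : ℕ =>
      wt lam (l * α) * eLpNorm (fun x => f x - proj M φ φ' l f x) p volume) ≤
      K * seqNorm q (fun l : ℕ => wt lam (l * α) * approxError M p φ l f) := by
    refine seqNorm_le_mul fun l => ?_
    rw [mul_left_comm]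
    gcongr
    exact hK p hp l f hf
  rw [normProj, besovNorm]
  push_cast
  rw [add_mul, one_mul, mul_add]
  exact add_le_add le_self_add (h1.trans le_add_self)

theorem detail_bddBy_proj (hb : Biorth φ φ') (href : Refinable M φ) :
    BddBy p (normDetail M p q α lam φ φ') (normProj M p q α lam φ φ') := by
  obtain ⟨K, hK1, hK⟩ := exists_proj_bound hM hb.left hb.right
  refine ⟨K, fun f hf => ?_⟩
  rw [normDetail, normProj, mul_add]
  refine add_le_add (hK p hp 0 f hf) (seqNorm_le_mul fun l => ?_)
  rw [mul_left_comm]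
  gcongr
  have hPL := memLp_proj hM hp hb.left hb.right l hf
  have he : detail M φ φ' l f =ᵐ[volume] proj M φ φ' (l + 1) (fun x => f x - proj M φ φ' l f x) := by
    filter_upwards [proj_sub hM hp hb.left hb.right (l + 1) hf hPL, proj_of_inV hM hp hb
      ((inV_proj hM hp hb.right l hf).succ hM hp hb.left href)] with x h1 h2
    rw [h1, h2, detail]
  rw [eLpNorm_congr_ae he]
  exact hK p hp (l + 1) _ (hf.sub hPL)

include hq

theorem proj_bddBy_detail (hlam : 1 < lam) (hα : 0 < α) (hN : 0 < N) (hb : Biorth φ φ')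
    (href : Refinable M φ) :
    BddBy p (normProj M p q α lam φ φ') (normDetail M p q α lam φ φ') := by
  obtain ⟨C, hC⟩ := exists_hardy hlam hα
  refine ⟨1 + 2 * C, fun f hf => ?_⟩
  obtain ⟨h1, h2⟩ := hC q hq fun l => eLpNorm (detail M φ φ' l f) p volume
  set D := seqNorm q (fun l : ℕ => wt lam (l * α) * eLpNorm (detail M φ φ' l f) p volume)
  have hle := eLpNorm_sub_proj_le hM hN hb href hp hf
  have hPL := memLp_proj hM hp hb.left hb.right 0 hf
  have h3 : eLpNorm f p volume ≤ eLpNorm (proj M φ φ' 0 f) p volume + C * D := by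
    have hs : f = (proj M φ φ' 0 f) + fun x => f x - proj M φ φ' 0 f x := by
      ext x; simp
    nth_rewrite 1 [hs]
    refine (eLpNorm_add_le hPL.1 (hf.sub hPL).1 hp).trans ?_
    refine add_le_add le_rfl (le_trans ?_ h2)
    have h0 := hle 0
    simp only [zero_add] at h0
    exact h0
  have h4 : seqNorm q (fun l : ℕ =>
      wt lam (l * α) * eLpNorm (fun x => f x - proj M φ φ' l f x) p volume) ≤ C * D := by
    refine (seqNorm_mono fun l => ?_).trans h1
    gcongr
    exact hle l
  calc normProj M p q α lam φ φ' f
      ≤ (eLpNorm (proj M φ φ' 0 f) p volume + C * D) + C * D := add_le_add h3 h4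
    _ ≤ _ := by
        rw [normDetail]
        push_cast
        calc _ = eLpNorm (proj M φ φ' 0 f) p volume + 2 * C * D := by ring
          _ ≤ (1 + 2 * C) * eLpNorm (proj M φ φ' 0 f) p volume + (1 + 2 * C) * D := by
              refine add_le_add (le_mul_of_one_le_left zero_le le_self_add) ?_
              gcongr
              exact le_add_self
          _ = _ := by rw [mul_add]

omit hq hp

/-! ### Coefficients -/

/-- The size of a function in `V_l^p` is that of its coefficients. -/
theorem exists_synth_equiv (hb : Biorth φ φ') :
    ∃ K : ℝ≥0, ∀ (p : ℝ≥0∞), 1 ≤ p → ∀ (l : ℕ) (c : Fin N → (Fin n → ℤ) → ℂ),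
      (∀ j, MemSeq p (c j)) →
      eLpNorm (synth M φ l c) p volume ≤
        K * (wt (idx M) (-(l * p⁻¹.toReal)) * ∑ j, seqNorm p (c j)) ∧
      wt (idx M) (-(l * p⁻¹.toReal)) * ∑ j, seqNorm p (c j) ≤
        K * eLpNorm (synth M φ l c) p volume := by
  obtain ⟨A, -, hA⟩ := exists_common_bound hb.left
  obtain ⟨B, -, hB⟩ := exists_common_bound hb.right
  refine ⟨A + N * B, fun p hp l c hc => ?_⟩
  have hs : eLpNorm (synth M φ l c) p volume =
      wt (idx M) (-(l * p⁻¹.toReal)) * eLpNorm (syf φ c) p volume := hM.eLpNorm_dil l p (syf φ c)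
  rw [hs]
  push_cast
  constructor
  · rw [mul_left_comm]
    gcongr
    refine (eLpNorm_syf_le hA hp hc).trans ?_
    gcongr
    exact le_self_add
  · rw [mul_left_comm]
    gcongr
    calc ∑ j, seqNorm p (c j) ≤ ∑ _j : Fin N, B * eLpNorm (syf φ c) p volume :=
          Finset.sum_le_sum fun j _ => hb.seqNorm_le hB hp hc j
      _ = N * B * eLpNorm (syf φ c) p volume := by simp [mul_assoc]
      _ ≤ _ := by gcongr; exact le_add_self

include hp

theorem synth_injective (hb : Biorth φ φ') {l : ℕ} {c d : Fin N → (Fin n → ℤ) → ℂ}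
    (hc : ∀ j, MemSeq p (c j)) (hd : ∀ j, MemSeq p (d j))
    (h : synth M φ l c =ᵐ[volume] synth M φ l d) : c = d := by
  have h1 : syf φ c =ᵐ[volume] syf φ d := by
    filter_upwards [hM.ae_undil l h] with x hx
    simpa only [synth_eq, hM.dil_undil] using hx
  ext1 j
  rw [← hb.an_syf hp hc j, ← hb.an_syf hp hd j, an_congr h1 (ae_eq_refl _)]

theorem existsUnique_isCoeff (hb : Biorth φ φ') (href : Refinable M φ) {f : (Fin n → ℝ) → ℂ}
    (hf : MemLp f p volume) : ∃! a, IsCoeff M p φ φ' f a := by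
  have h1 := inV_proj hM hp hb.right (φ := φ) 0 hf
  have h2 : ∀ l, InV M p φ (l + 1) (detail M φ φ' l f) := fun l =>
    InV.sub hM hp hb.left (inV_proj hM hp hb.right (l + 1) hf)
      ((inV_proj hM hp hb.right l hf).succ hM hp hb.left href)
  obtain ⟨c, hc, hce⟩ := h1
  choose d hd hde using h2
  let a₀ : ℕ → Fin N → (Fin n → ℤ) → ℂ := fun l => Nat.casesOn l c d
  have ha₀ : a₀ 0 = c := rfl
  have ha₁ : ∀ l, a₀ (l + 1) = d l := fun l => rfl
  clear_value a₀
  refine ⟨a₀, ⟨fun l => ?_, by rw [ha₀]; exact hce, fun l => by rw [ha₁]; exact hde l⟩, ?_⟩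
  · rcases l with _ | l
    · rw [ha₀]; exact hc
    · rw [ha₁]; exact hd l
  · rintro a ⟨ha, ha0, ha1⟩
    ext1 l
    rcases l with _ | l
    · rw [ha₀]; exact synth_injective hM hp hb (ha 0) hc (ha0.symm.trans hce)
    · rw [ha₁]; exact synth_injective hM hp hb (ha (l + 1)) (hd l) ((ha1 l).symm.trans (hde l))

include hq

/-- The coefficient norm is equivalent to the norm through the details. -/
theorem exists_coeffNorm_equiv (hlam : 1 < lam) (hα : 0 < α) (hb : Biorth φ φ') :
    ∃ C : ℝ≥0, ∀ (f : (Fin n → ℝ) → ℂ) (a : ℕ → Fin N → (Fin n → ℤ) → ℂ),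
      IsCoeff M p φ φ' f a →
      coeffNorm M p q α lam a ≤ C * normDetail M p q α lam φ φ' f ∧
      normDetail M p q α lam φ φ' f ≤ C * coeffNorm M p q α lam a := by
  obtain ⟨K, hK⟩ := exists_synth_equiv hM hb
  have hlam0 : 0 < lam := by linarith
  -- `a (l + 1)` belongs to the detail of index `l`, which shifts the weights by a factor `λ^α`
  set w : ℝ≥0 := (wt lam α).toNNReal
  have hw : (w : ℝ≥0∞) = wt lam α := ENNReal.coe_toNNReal (wt_ne_top _ _)
  have hw1 : 1 ≤ (w : ℝ≥0∞) := by
    rw [hw, wt, ENNReal.one_le_ofReal]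
    exact Real.one_le_rpow hlam.le hα.le
  have hwsucc : ∀ l : ℕ, wt lam ((l + 1 : ℕ) * α) = w * wt lam (l * α) := by
    intro l
    rw [hw, ← wt_add hlam0]
    congr 1; push_cast; ring
  refine ⟨w * K + 2 * K, fun f a ⟨ha, ha0, ha1⟩ => ?_⟩
  set t : ℕ → ℝ≥0∞ := fun l =>
    wt lam (l * α) * wt (idx M) (-(l * p⁻¹.toReal)) * ∑ j, seqNorm p (a l j) with ht
  have e0 : eLpNorm (proj M φ φ' 0 f) p volume = eLpNorm (synth M φ 0 (a 0)) p volume :=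
    eLpNorm_congr_ae ha0
  have e1 : ∀ l, eLpNorm (detail M φ φ' l f) p volume =
      eLpNorm (synth M φ (l + 1) (a (l + 1))) p volume := fun l => eLpNorm_congr_ae (ha1 l)
  have ht0 : t 0 = wt (idx M) (-((0 : ℕ) * p⁻¹.toReal)) * ∑ j, seqNorm p (a 0 j) := by
    simp [ht, wt_zero_exp]
  have hcn : coeffNorm M p q α lam a = seqNorm q t := rfl
  rw [hcn, normDetail, e0]
  simp only [e1]
  set D := seqNorm q (fun l : ℕ =>
    wt lam (l * α) * eLpNorm (synth M φ (l + 1) (a (l + 1))) p volume)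
  constructor
  · refine (seqNorm_le_zero_add_succ hq t).trans ?_
    have h1 : t 0 ≤ K * eLpNorm (synth M φ 0 (a 0)) p volume := by
      rw [ht0]; exact (hK p hp 0 (a 0) (ha 0)).2
    have h2 : seqNorm q (fun l => t (l + 1)) ≤ (w * K : ℝ≥0) * D := by
      refine seqNorm_le_mul fun l => ?_
      simp only [ht]
      rw [hwsucc]
      push_cast
      calc _ = w * wt lam (l * α) * (wt (idx M) (-(((l + 1 : ℕ) : ℝ) * p⁻¹.toReal)) *
            ∑ j, seqNorm p (a (l + 1) j)) := by push_cast; ring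
        _ ≤ w * wt lam (l * α) * (K * eLpNorm (synth M φ (l + 1) (a (l + 1))) p volume) := by
            exact mul_le_mul_right (hK p hp (l + 1) (a (l + 1)) (ha (l + 1))).2 _
        _ = _ := by ring
    refine (add_le_add h1 h2).trans ?_
    push_cast
    rw [mul_add]
    refine add_le_add ?_ ?_
    · gcongr
      calc (K : ℝ≥0∞) ≤ 2 * K := le_mul_of_one_le_left zero_le one_le_two
        _ ≤ _ := le_add_self
    · gcongr
      exact le_self_add
  · have h1 : eLpNorm (synth M φ 0 (a 0)) p volume ≤ K * seqNorm q t := by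
      refine ((hK p hp 0 (a 0) (ha 0)).1).trans ?_
      rw [← ht0]
      gcongr
      exact le_seqNorm hq t 0
    have h2 : D ≤ K * seqNorm q t := by
      refine le_trans (seqNorm_le_mul (b := fun l => t (l + 1)) fun l => ?_)
        (mul_le_mul_right (seqNorm_succ_le hq t) _)
      simp only [ht]
      rw [hwsucc]
      calc wt lam (l * α) * eLpNorm (synth M φ (l + 1) (a (l + 1))) p volume
          ≤ (w * wt lam (l * α)) * (K * (wt (idx M) (-(((l + 1 : ℕ) : ℝ) * p⁻¹.toReal)) *
            ∑ j, seqNorm p (a (l + 1) j))) := by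
            refine mul_le_mul' ?_ ?_
            · exact le_mul_of_one_le_left zero_le hw1
            · exact (hK p hp (l + 1) (a (l + 1)) (ha (l + 1))).1
        _ = _ := by push_cast; ring
    refine (add_le_add h1 h2).trans ?_
    rw [← two_mul, ← mul_assoc]
    gcongr
    push_cast
    exact le_add_self

theorem besov_bddBy_inf (hlam : 1 < lam) (hα : 0 < α) (hb : Biorth φ φ')
    (href : Refinable M φ) :
    BddBy p (besovNorm M p q α lam φ) (normInf M p q α lam φ) := by
  obtain ⟨K, hK⟩ := exists_synth_equiv hM hb
  obtain ⟨C, hC⟩ := exists_hardy hlam hα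
  refine ⟨1 + 2 * (C * K), fun f hf => ?_⟩
  have h0 : ((1 + 2 * (C * K) : ℝ≥0) : ℝ≥0∞) ≠ 0 := by positivity
  rw [← ENNReal.inv_mul_le_iff h0 ENNReal.coe_ne_top]
  refine le_iInf₂ fun c hcr => ?_
  rw [ENNReal.inv_mul_le_iff h0 ENNReal.coe_ne_top]
  obtain ⟨hc, hlim⟩ := hcr
  have hsIn : ∀ l, InV M p φ l (synth M φ l (c l)) := fun l => ⟨c l, hc l, ae_eq_refl _⟩
  have hsL : ∀ l, MemLp (synth M φ l (c l)) p volume := fun l => (hsIn l).memLp hM hp hb.left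
  set s : ℕ → ℝ≥0∞ := fun l => eLpNorm (synth M φ l (c l)) p volume with hs
  have hpart : ∀ L, MemLp (fun x => ∑ l ∈ Finset.range L, synth M φ l (c l) x) p volume :=
    fun L => memLp_finsetSum _ fun l _ => hsL l
  -- tails of the series
  have htail : ∀ L, eLpNorm (fun x => f x - ∑ l ∈ Finset.range L, synth M φ l (c l) x) p volume ≤
      ∑' k, s (L + k) := by
    intro L
    refine le_of_tendsto_of_tendsto' (b := atTop) (f := fun _ : ℕ => eLpNorm (fun x => f x -
      ∑ l ∈ Finset.range L, synth M φ l (c l) x) p volume) (g := fun k : ℕ =>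
      eLpNorm (fun x => f x - ∑ l ∈ Finset.range (L + k), synth M φ l (c l) x) p volume +
        ∑' k, s (L + k)) tendsto_const_nhds ?_ fun k => ?_
    · have : Tendsto (fun k : ℕ => L + k) atTop atTop := tendsto_atTop_mono (fun k => Nat.le_add_left k L)
        tendsto_id
      simpa using (hlim.comp this).add_const (∑' k, s (L + k))
    · have he : (fun x => f x - ∑ l ∈ Finset.range L, synth M φ l (c l) x) =
          (fun x => f x - ∑ l ∈ Finset.range (L + k), synth M φ l (c l) x) +
            ∑ i ∈ Finset.range k, synth M φ (L + i) (c (L + i)) := by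
        ext x
        simp only [Pi.add_apply, Finset.sum_apply, Finset.sum_range_add]
        ring
      rw [he]
      refine (eLpNorm_add_le (hf.sub (hpart _)).1
        (Finset.aestronglyMeasurable_sum _ fun i _ => (hsL _).1) hp).trans ?_
      refine add_le_add le_rfl ?_
      exact (eLpNorm_sum_le (fun i _ => (hsL _).1) hp).trans (ENNReal.sum_le_tsum _)
  have happ : ∀ l, approxError M p φ l f ≤ ∑' k, s (l + k) := by
    intro l
    refine (approxError_le (S := fun x => ∑ i ∈ Finset.range l, synth M φ i (c i) x) ?_ f).trans
      (htail l)
    have : ∀ L ≤ l, InV M p φ l (fun x => ∑ i ∈ Finset.range L, synth M φ i (c i) x) := by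
      intro L
      induction L with
      | zero =>
        intro _
        refine ⟨fun _ => 0, fun j => ?_, Eventually.of_forall fun x => ?_⟩
        · simp [MemSeq, seqNorm]
        · simp [synth]
      | succ L ih =>
        intro hL
        simp only [Finset.sum_range_succ]
        exact InV.add hM hp hb.left (ih (by omega))
          ((hsIn L).mono hM hp hb.left href (by omega))
    exact this l le_rfl
  obtain ⟨h1, h2⟩ := hC q hq s
  have h3 : seqNorm q (fun l : ℕ => wt lam (l * α) * s l) ≤ K * coeffNorm M p q α lam c := by
    refine seqNorm_le_mul fun l => ?_
    calc wt lam (l * α) * s l ≤ wt lam (l * α) *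
          (K * (wt (idx M) (-(l * p⁻¹.toReal)) * ∑ j, seqNorm p (c l j))) := by
          gcongr; exact (hK p hp l (c l) (hc l)).1
      _ = _ := by ring
  have h4 : eLpNorm f p volume ≤ C * (K * coeffNorm M p q α lam c) := by
    have := htail 0
    simp only [Finset.range_zero, Finset.sum_empty, sub_zero, zero_add] at this
    exact this.trans (h2.trans (by gcongr))
  have h5 : seqNorm q (fun l : ℕ => wt lam (l * α) * approxError M p φ l f) ≤
      C * (K * coeffNorm M p q α lam c) := by
    refine (seqNorm_mono fun l => ?_).trans (h1.trans (by gcongr))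
    gcongr
    exact happ l
  refine (add_le_add h4 h5).trans ?_
  rw [← two_mul]
  push_cast
  calc 2 * (C * (K * coeffNorm M p q α lam c)) = 2 * (C * K) * coeffNorm M p q α lam c := by ring
    _ ≤ _ := by gcongr; exact le_add_self

theorem inf_bddBy_besov (hlam : 1 < lam) (hα : 0 < α) (hb : Biorth φ φ')
    (href : Refinable M φ) :
    BddBy p (normInf M p q α lam φ) (besovNorm M p q α lam φ) := by
  obtain ⟨C₁, hC₁⟩ := exists_coeffNorm_equiv hM hp hq hlam hα hb
  obtain ⟨C₂, hC₂⟩ := detail_bddBy_proj hM hp (q := q) (α := α) (lam := lam) hb href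
  obtain ⟨C₃, hC₃⟩ := proj_bddBy_besov hM hp (q := q) (α := α) (lam := lam) hb
  obtain ⟨C, hC⟩ := exists_hardy hlam hα
  refine ⟨1 + C₁ * (C₂ * C₃), fun f hf => ?_⟩
  by_cases htop : besovNorm M p q α lam φ f = ∞
  · rw [htop, ENNReal.mul_top (by positivity)]; exact le_top
  obtain ⟨a, ha, -⟩ := existsUnique_isCoeff hM hp hb href hf
  have hfin : normProj M p q α lam φ φ' f ≠ ∞ :=
    ne_top_of_le_ne_top (by finiteness) (hC₃ f hf)
  -- finiteness of the norm forces `P_l f → f`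
  have hsum : ∑' l, eLpNorm (fun x => f x - proj M φ φ' l f x) p volume ≠ ∞ :=
    ne_top_of_le_ne_top (ENNReal.mul_ne_top ENNReal.coe_ne_top
      (ne_top_of_le_ne_top hfin le_add_self)) (hC q hq _).2
  have hlim := ENNReal.tendsto_atTop_zero_of_tsum_ne_top hsum
  have hrep : IsRep M p φ f a := by
    refine ⟨ha.1, ?_⟩
    rw [← tendsto_add_atTop_iff_nat 1]
    refine hlim.congr fun l => eLpNorm_congr_ae ?_
    filter_upwards [ha.2.1, ae_all_iff.2 ha.2.2] with x h1 h2
    rw [Finset.sum_range_succ', ← h1]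
    have := detail_eq_sub (M := M) (φ := φ) (φ' := φ') 0 l f x
    simp only [zero_add] at this
    simp only [← h2, ← this]
    ring
  calc normInf M p q α lam φ f ≤ coeffNorm M p q α lam a := iInf₂_le a hrep
    _ ≤ C₁ * (C₂ * (C₃ * besovNorm M p q α lam φ f)) := by
        refine ((hC₁ f a ha).1).trans ?_
        gcongr
        refine (hC₂ f hf).trans ?_
        gcongr
        exact hC₃ f hf
    _ = (C₁ * (C₂ * C₃)) * besovNorm M p q α lam φ f := by ring
    _ ≤ _ := by push_cast; gcongr; exact le_add_self

end

end

section

/-! ### Square roots in Banach star algebras -/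

theorem abs_choose_le_one {r : ℝ} (hr0 : 0 ≤ r) (hr1 : r ≤ 1) (k : ℕ) : |Ring.choose r k| ≤ 1 := by
  induction k with
  | zero => simp
  | succ k ih =>
    have h : Ring.choose r (k + 1) = Ring.choose r k * ((r - k) / (k + 1)) := by
      rw [Ring.choose_eq_smul, Ring.choose_eq_smul, descPochhammer_succ_right,
        Polynomial.smeval_mul, Nat.factorial_succ]
      simp [Polynomial.smeval_sub, Polynomial.smeval_natCast]
      field_simp
    rw [h, abs_mul]
    refine mul_le_one₀ ih (abs_nonneg _) ?_
    rw [abs_div, abs_of_pos (by positivity : (0 : ℝ) < k + 1), div_le_one (by positivity), abs_le]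
    constructor <;> linarith [(Nat.cast_nonneg k : (0 : ℝ) ≤ k)]

theorem summable_norm_pow_of_spectralRadius_lt_one {A : Type*} [NormedRing A] [NormedAlgebra ℂ A]
    [CompleteSpace A] {b : A} (hb : spectralRadius ℂ b < 1) : Summable fun k : ℕ => ‖b ^ k‖ := by
  obtain ⟨r, hr, hr1⟩ := ENNReal.lt_iff_exists_nnreal_btwn.1 hb
  have hr1' : r < 1 := by exact_mod_cast hr1
  have h := (spectrum.pow_nnnorm_pow_one_div_tendsto_nhds_spectralRadius b).eventually_lt_const hr
  refine Summable.of_norm_bounded_eventually_nat (g := fun k => (r : ℝ) ^ k)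
    (summable_geometric_of_lt_one r.2 hr1') ?_
  filter_upwards [h, eventually_gt_atTop 0] with k hk hk0
  rw [norm_norm]
  have hk' : (0 : ℝ) < k := by exact_mod_cast hk0
  rw [one_div, ENNReal.rpow_inv_lt_iff hk', ENNReal.rpow_natCast] at hk
  have : ‖b ^ k‖₊ < r ^ k := by exact_mod_cast hk
  exact_mod_cast this.le

/-- A selfadjoint element of a Banach star algebra with spectrum in `(0, ∞)` has a selfadjoint
fourth root, given by the binomial series. The fourth root, rather than the square root, is
recorded because its square is visibly a positive square root. -/
theorem exists_selfAdjoint_fourthRoot {A : Type*} [NormedRing A] [NormedAlgebra ℂ A]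
    [CompleteSpace A] [StarRing A] [ContinuousStar A] [StarModule ℂ A] {a : A} (ha : star a = a)
    (hs : ∀ z ∈ spectrum ℂ a, ∃ r : ℝ, 0 < r ∧ z = r) :
    ∃ t : A, star t = t ∧ t * t * (t * t) = a := by
  rcases subsingleton_or_nontrivial A with _ | _
  · exact ⟨a, ha, Subsingleton.elim _ _⟩
  set C : ℝ := ‖a‖ * ‖(1 : A)‖ + 1 with hC
  have hC0 : 0 < C := by positivity
  -- after scaling, `a = C (1 - b)` with the spectrum of `b` in `[0, 1)`
  set b : A := 1 - (C⁻¹ : ℂ) • a with hbdef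
  have hb : star b = b := by simp [hbdef, ha]
  have hrad : spectralRadius ℂ b < 1 := by
    refine spectrum.spectralRadius_lt_of_forall_lt b (r := 1) fun z hz => ?_
    have h1 : (C : ℂ) * (1 - z) ∈ spectrum ℂ a := by
      have hu : IsUnit (C : ℂ) := by simp [hC0.ne']
      rw [spectrum.mem_iff] at hz ⊢
      intro hunit
      apply hz
      have he : algebraMap ℂ A z - b =
          -((C⁻¹ : ℂ) • (algebraMap ℂ A ((C : ℂ) * (1 - z)) - a)) := by
        rw [hbdef, Algebra.algebraMap_eq_smul_one, Algebra.algebraMap_eq_smul_one, smul_sub,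
          smul_smul, inv_mul_cancel_left₀ (by simp [hC0.ne'] : (C : ℂ) ≠ 0)]
        module
      rw [he]
      exact (hunit.smul (Units.mk0 (C⁻¹ : ℂ) (by simp [hC0.ne']))).neg
    obtain ⟨r, hr, hzr⟩ := hs _ h1
    have hle : r ≤ ‖a‖ * ‖(1 : A)‖ := by
      have := spectrum.norm_le_norm_mul_of_mem h1
      rwa [hzr, Complex.norm_real, Real.norm_of_nonneg hr.le] at this
    have hz' : z = ((1 - r / C : ℝ) : ℂ) := by
      have hC' : (C : ℂ) ≠ 0 := by simp [hC0.ne']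
      push_cast
      rw [← hzr]
      field_simp
      ring
    rw [← NNReal.coe_lt_coe, coe_nnnorm, hz', Complex.norm_real, NNReal.coe_one]
    have h2 : 0 < r / C := by positivity
    have h3 : r / C < 1 := by rw [div_lt_one hC0]; linarith
    rw [Real.norm_eq_abs, abs_lt]
    constructor <;> linarith
  have hsum := summable_norm_pow_of_spectralRadius_lt_one hrad
  -- the binomial series of `(1 - b) ^ r`
  set t : ℝ → ℕ → A := fun r k => (((-1) ^ k * Ring.choose r k : ℝ) : ℂ) • b ^ k with ht
  have htn : ∀ r : ℝ, 0 ≤ r → r ≤ 1 → Summable fun k => ‖t r k‖ := by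
    intro r hr0 hr1
    refine Summable.of_nonneg_of_le (fun _ => norm_nonneg _) (fun k => ?_) hsum
    rw [ht, norm_smul, Complex.norm_real, Real.norm_eq_abs, abs_mul, abs_pow, abs_neg,
      abs_one, one_pow, one_mul]
    exact mul_le_of_le_one_left (norm_nonneg _) (abs_choose_le_one hr0 hr1 k)
  have hmul : ∀ r r' : ℝ, 0 ≤ r → 0 ≤ r' → r ≤ 1 → r' ≤ 1 →
      (∑' k, t r k) * ∑' k, t r' k = ∑' k, t (r + r') k := by
    intro r r' hr0 hr0' hr1 hr1'
    rw [tsum_mul_tsum_eq_tsum_sum_antidiagonal_of_summable_norm (htn r hr0 hr1) (htn r' hr0' hr1')]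
    refine tsum_congr fun k => ?_
    simp only [ht]
    rw [Ring.add_choose_eq (r := r) (s := r') k (Commute.all _ _), Finset.mul_sum]
    push_cast
    rw [Finset.sum_smul]
    refine Finset.sum_congr rfl fun ij hij => ?_
    rw [← Finset.HasAntidiagonal.mem_antidiagonal.1 hij, pow_add, pow_add]
    simp only [smul_mul_assoc, mul_smul_comm, smul_smul]
    congr 1
    ring
  have hone : ∑' k, t 1 k = 1 - b := by
    have hch : ∀ k : ℕ, Ring.choose (1 : ℝ) k = (Nat.choose 1 k : ℝ) := fun k => by
      have := Ring.choose_natCast (R := ℝ) 1 k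
      simpa using this
    rw [tsum_eq_sum (s := Finset.range 2)]
    · simp [ht, Finset.sum_range_succ, hch, sub_eq_add_neg]
    · intro k hk
      have : Nat.choose 1 k = 0 := Nat.choose_eq_zero_of_lt (by simpa using hk)
      simp [ht, hch, this]
  set S : A := ∑' k, t (1 / 4) k
  have hstar : star S = S := by
    rw [tsum_star]
    refine tsum_congr fun k => ?_
    simp [ht, hb]
  have hfour : S * S * (S * S) = 1 - b := by
    rw [hmul _ _ (by norm_num) (by norm_num) (by norm_num) (by norm_num),
      hmul _ _ (by norm_num) (by norm_num) (by norm_num) (by norm_num), ← hone]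
    norm_num
  set d : ℝ := √√C with hd
  have hd4 : (d : ℂ) * d * (d * d) = C := by
    have h1 : d * d = √C := Real.mul_self_sqrt (Real.sqrt_nonneg _)
    have h2 : d * d * (d * d) = C := by rw [h1, Real.mul_self_sqrt hC0.le]
    exact_mod_cast h2
  refine ⟨(d : ℂ) • S, ?_, ?_⟩
  · rw [star_smul, hstar]; simp
  · simp only [smul_mul_assoc, mul_smul_comm, smul_smul]
    rw [hfour, hd4, hbdef, sub_sub_cancel,
      smul_smul, mul_inv_cancel₀ (by simp [hC0.ne']), one_smul]

/-- A selfadjoint element of a Banach star algebra with spectrum in `(0, ∞)` has a selfadjoint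
inverse square root `B`, which is inverse to the square of a selfadjoint element. -/
theorem exists_selfAdjoint_invSqrt {A : Type*} [NormedRing A] [NormedAlgebra ℂ A] [CompleteSpace A]
    [StarRing A] [ContinuousStar A] [StarModule ℂ A] {a : A} (ha : star a = a)
    (hs : ∀ z ∈ spectrum ℂ a, ∃ r : ℝ, 0 < r ∧ z = r) :
    ∃ B t : A, star B = B ∧ star t = t ∧ B * (t * t) = 1 ∧ t * t * B = 1 ∧ B * a * B = 1 := by
  obtain ⟨t, ht1, ht2⟩ := exists_selfAdjoint_fourthRoot ha hs
  have hu : IsUnit a := by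
    rw [← spectrum.zero_notMem_iff ℂ]
    intro h0
    obtain ⟨r, hr, h⟩ := hs 0 h0
    exact hr.ne' (by exact_mod_cast h.symm)
  obtain ⟨u, hu⟩ : IsUnit (t * t) := by
    rw [← ht2] at hu
    exact ((Commute.refl (t * t)).isUnit_mul_iff.1 hu).1
  refine ⟨↑u⁻¹, t, ?_, ht1, by rw [← hu]; simp, by rw [← hu]; simp, by rw [← ht2, ← hu]; simp⟩
  have hu1 : star u = u := Units.ext (by rw [Units.coe_star, hu, star_mul, ht1])
  rw [← Units.coe_star, star_inv, hu1]

end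

section

variable {n : ℕ}

/-! ### The convolution algebra `ℓ¹(ℤⁿ)` -/

/-- The space `ℓ¹(ℤⁿ)`, to be equipped with convolution. -/
def Wiener (n : ℕ) : Type := lp (fun _ : Fin n → ℤ => ℂ) 1

namespace Wiener

instance : NormedAddCommGroup (Wiener n) :=
  inferInstanceAs (NormedAddCommGroup (lp (fun _ : Fin n → ℤ => ℂ) 1))

instance : NormedSpace ℂ (Wiener n) :=
  inferInstanceAs (NormedSpace ℂ (lp (fun _ : Fin n → ℤ => ℂ) 1))

instance : CompleteSpace (Wiener n) :=
  inferInstanceAs (CompleteSpace (lp (fun _ : Fin n → ℤ => ℂ) 1))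

/-- The sequence underlying an element of `ℓ¹(ℤⁿ)`. -/
def coef (a : Wiener n) : (Fin n → ℤ) → ℂ :=
  let b : lp (fun _ : Fin n → ℤ => ℂ) 1 := a
  b

theorem ext {a b : Wiener n} (h : ∀ ν, coef a ν = coef b ν) : a = b := lp.ext (funext h)

theorem memSeq_coef (a : Wiener n) : MemSeq 1 (coef a) := by
  rw [memSeq_one_iff]
  have := (memℓp_gen_iff (p := 1) (by simp)).1 (lp.memℓp (show lp (fun _ : Fin n → ℤ => ℂ) 1 from a))
  simp only [ENNReal.toReal_one, Real.rpow_one] at this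
  exact this

theorem summable_coef (a : Wiener n) : Summable fun ν => ‖coef a ν‖ :=
  memSeq_one_iff.1 (memSeq_coef a)

/-- A summable sequence as an element of `ℓ¹(ℤⁿ)`. -/
def mk (c : (Fin n → ℤ) → ℂ) (h : MemSeq 1 c) : Wiener n :=
  (⟨c, (memℓp_gen_iff (p := 1) (by simp)).2 (by simpa using memSeq_one_iff.1 h)⟩ :
    lp (fun _ : Fin n → ℤ => ℂ) 1)

@[simp] theorem coef_mk (c : (Fin n → ℤ) → ℂ) (h : MemSeq 1 c) : coef (mk c h) = c := rfl

theorem norm_eq (a : Wiener n) : ‖a‖ = ∑' ν, ‖coef a ν‖ := by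
  have := lp.norm_eq_tsum_rpow (p := 1) (by simp) (show lp (fun _ : Fin n → ℤ => ℂ) 1 from a)
  simp only [ENNReal.toReal_one, Real.rpow_one, div_one] at this
  exact this

theorem enorm_eq (a : Wiener n) : ‖a‖ₑ = seqNorm 1 (coef a) := by
  rw [seqNorm_one, ← ofReal_norm, norm_eq,
    ENNReal.ofReal_tsum_of_nonneg (fun _ => norm_nonneg _) (summable_coef a)]
  simp

@[simp] theorem coef_add (a b : Wiener n) : coef (a + b) = coef a + coef b := rfl
@[simp] theorem coef_zero : coef (0 : Wiener n) = 0 := rfl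
@[simp] theorem coef_smul (z : ℂ) (a : Wiener n) : coef (z • a) = z • coef a := rfl

theorem coef_sum {κ : Type*} (s : Finset κ) (a : κ → Wiener n) :
    coef (∑ i ∈ s, a i) = ∑ i ∈ s, coef (a i) :=
  map_sum (AddMonoidHom.mk' coef fun _ _ => rfl) a s

theorem summable_mul_coef (a b : Wiener n) (ν : Fin n → ℤ) :
    Summable fun μ => coef a μ * coef b (ν - μ) := by
  refine Summable.of_norm_bounded (g := fun μ => ‖coef a μ‖ * ‖b‖) ((summable_coef a).mul_right _)
    fun μ => ?_
  rw [norm_mul]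
  gcongr
  rw [norm_eq]
  exact (summable_coef b).le_tsum (ν - μ) fun _ _ => norm_nonneg _

/-- The point mass at `μ`, as an element of `ℓ¹(ℤⁿ)`. -/
def delta (μ : Fin n → ℤ) : Wiener n := mk (dl μ) (memSeq_dl 1 μ)

@[simp] theorem coef_delta (μ : Fin n → ℤ) : coef (delta μ) = dl μ := rfl

instance : Mul (Wiener n) := ⟨fun a b => mk (cconv (coef a) (coef b))
  ((memSeq_coef a).cconv le_rfl (memSeq_coef b))⟩

instance : One (Wiener n) := ⟨delta 0⟩

theorem coef_mul (a b : Wiener n) : coef (a * b) = cconv (coef a) (coef b) := rfl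

theorem coef_one : coef (1 : Wiener n) = dl 0 := rfl

theorem mul_comm' (a b : Wiener n) : a * b = b * a := by
  refine ext fun ν => ?_
  simp only [coef_mul, cconv]
  rw [← (Equiv.subLeft ν).tsum_eq]
  refine tsum_congr fun μ => ?_
  simp [mul_comm]

theorem mul_assoc' (a b c : Wiener n) : a * b * c = a * (b * c) := by
  refine ext fun ν => ?_
  simp only [coef_mul, cconv]
  have hs : Summable (Function.uncurry fun μ κ =>
      coef a κ * coef b (μ - κ) * coef c (ν - μ)) := by
    let e : (Fin n → ℤ) × (Fin n → ℤ) ≃ (Fin n → ℤ) × (Fin n → ℤ) :=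
      { toFun := fun p => (p.2, p.1 - p.2), invFun := fun p => (p.2 + p.1, p.1)
        left_inv := fun p => by simp, right_inv := fun p => by simp }
    have h1 : Summable fun p : (Fin n → ℤ) × (Fin n → ℤ) => ‖coef a p.1‖ * ‖coef b p.2‖ :=
      (summable_coef a).mul_of_nonneg (summable_coef b) (fun _ => norm_nonneg _)
        fun _ => norm_nonneg _
    refine Summable.of_norm_bounded ((e.summable_iff.2 h1).mul_right ‖c‖) fun p => ?_
    simp only [Function.uncurry, norm_mul, e, Function.comp, Equiv.coe_fn_mk]
    gcongr
    rw [norm_eq]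
    exact (summable_coef c).le_tsum _ fun _ _ => norm_nonneg _
  calc ∑' μ, (∑' κ, coef a κ * coef b (μ - κ)) * coef c (ν - μ)
      = ∑' μ, ∑' κ, coef a κ * coef b (μ - κ) * coef c (ν - μ) :=
        tsum_congr fun μ => tsum_mul_right.symm
    _ = ∑' κ, ∑' μ, coef a κ * coef b (μ - κ) * coef c (ν - μ) := hs.tsum_comm.symm
    _ = ∑' κ, coef a κ * ∑' μ, coef b μ * coef c (ν - κ - μ) := by
        refine tsum_congr fun κ => ?_
        rw [← tsum_mul_left, ← (Equiv.addRight κ).tsum_eq]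
        refine tsum_congr fun μ => ?_
        simp only [Equiv.coe_addRight, add_sub_cancel_right, mul_assoc]
        rw [sub_sub, add_comm κ]

theorem one_mul' (a : Wiener n) : 1 * a = a := by
  refine ext fun ν => ?_
  simp only [coef_mul, cconv, coef_one, dl]
  rw [tsum_eq_single 0]
  · simp
  · intro μ hμ; simp [hμ]

theorem add_mul' (a b c : Wiener n) : (a + b) * c = a * c + b * c := by
  refine ext fun ν => ?_
  simp only [coef_add, coef_mul, cconv, Pi.add_apply, add_mul]
  exact (summable_mul_coef a c ν).tsum_add (summable_mul_coef b c ν)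

theorem norm_mul_le' (a b : Wiener n) : ‖a * b‖ ≤ ‖a‖ * ‖b‖ := by
  have := seqNorm_cconv_le le_rfl (coef a) (memSeq_coef b)
  rw [← coef_mul, ← enorm_eq, ← enorm_eq, ← enorm_eq, mul_comm] at this
  rw [← ofReal_norm, ← ofReal_norm, ← ofReal_norm, ← ENNReal.ofReal_mul (norm_nonneg _)] at this
  exact (ENNReal.ofReal_le_ofReal_iff (by positivity)).1 this

instance : NormedCommRing (Wiener n) :=
  { (inferInstance : NormedAddCommGroup (Wiener n)), (inferInstance : Mul (Wiener n)),
    (inferInstance : One (Wiener n)) with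
    left_distrib := fun a b c => by
      rw [mul_comm' a, add_mul', mul_comm' b, mul_comm' c]
    right_distrib := add_mul'
    zero_mul := fun a => ext fun ν => by simp [coef_mul, cconv]
    mul_zero := fun a => ext fun ν => by simp [coef_mul, cconv]
    mul_assoc := mul_assoc'
    one_mul := one_mul'
    mul_one := fun a => by rw [mul_comm', one_mul']
    mul_comm := mul_comm'
    norm_mul_le := norm_mul_le' }

theorem smul_mul' (z : ℂ) (a b : Wiener n) : z • a * b = z • (a * b) := by
  refine ext fun ν => ?_
  simp only [coef_smul, coef_mul, cconv, Pi.smul_apply, smul_eq_mul, mul_assoc]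
  exact tsum_mul_left

instance : Algebra ℂ (Wiener n) := Algebra.ofModule smul_mul' fun z a b => by
  rw [mul_comm, smul_mul', mul_comm]

instance : NormedAlgebra ℂ (Wiener n) :=
  { (inferInstance : Algebra ℂ (Wiener n)) with norm_smul_le := norm_smul_le }

@[simp] theorem norm_delta (μ : Fin n → ℤ) : ‖delta μ‖ = 1 := by
  rw [norm_eq, tsum_eq_single μ] <;> simp +contextual [dl]

instance : NormOneClass (Wiener n) := ⟨norm_delta 0⟩


theorem delta_mul_delta (μ ν : Fin n → ℤ) : delta μ * delta ν = delta (μ + ν) := by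
  refine ext fun κ => ?_
  simp only [coef_mul, cconv, coef_delta, dl]
  rw [tsum_eq_single μ]
  · simp [Pi.single_apply, sub_eq_iff_eq_add, add_comm]
  · intro κ' h; simp [h]

theorem delta_zero : delta (0 : Fin n → ℤ) = 1 := rfl

instance : Star (Wiener n) := ⟨fun a => mk (bstar (coef a)) (memSeq_coef a).bstar⟩

theorem coef_star (a : Wiener n) : coef (star a) = bstar (coef a) := rfl

instance : StarRing (Wiener n) where
  star_involutive a := ext fun ν => by simp [coef_star, bstar]
  star_add a b := ext fun ν => by simp [coef_star, bstar]
  star_mul a b := ext fun ν => by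
    rw [mul_comm (star b)]
    simp only [coef_star, coef_mul, bstar, cconv]
    rw [conj_tsum', ← (Equiv.neg _).tsum_eq]
    refine tsum_congr fun μ => ?_
    simp only [Equiv.neg_apply, map_mul]
    congr 4
    abel

instance : StarModule ℂ (Wiener n) := ⟨fun z a => ext fun ν => by simp [coef_star, bstar]⟩

instance : NormedStarGroup (Wiener n) := ⟨fun a => by
  rw [norm_eq, norm_eq, ← (Equiv.neg _).tsum_eq]
  simp [coef_star, bstar]⟩

theorem hasSum_delta (a : Wiener n) : HasSum (fun ν => coef a ν • delta ν) a := by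
  have h := lp.hasSum_single (p := 1) (by simp) (show lp (fun _ : Fin n → ℤ => ℂ) 1 from a)
  have he : (fun ν => coef a ν • delta ν) = fun ν =>
      (lp.single (E := fun _ : Fin n → ℤ => ℂ) 1 ν (coef a ν) : Wiener n) := by
    funext ν
    refine ext fun κ => ?_
    simp only [coef_smul, coef_delta, dl, Pi.smul_apply, smul_eq_mul]
    change _ = (lp.single (E := fun _ : Fin n → ℤ => ℂ) 1 ν (coef a ν)) κ
    rw [lp.coeFn_single]
    by_cases h : κ = ν <;> simp [h]
  rw [he]
  exact h

/-! ### Characters of `ℓ¹(ℤⁿ)` -/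

open WeakDual

theorem character_delta_mul (χ : characterSpace ℂ (Wiener n)) (μ ν : Fin n → ℤ) :
    χ (delta (μ + ν)) = χ (delta μ) * χ (delta ν) := by
  rw [← delta_mul_delta, map_mul]

theorem norm_character_le (χ : characterSpace ℂ (Wiener n)) (a : Wiener n) : ‖χ a‖ ≤ ‖a‖ :=
  spectrum.norm_le_norm_of_mem (CharacterSpace.apply_mem_spectrum χ a)

theorem norm_character_delta (χ : characterSpace ℂ (Wiener n)) (ν : Fin n → ℤ) :
    ‖χ (delta ν)‖ = 1 := by
  have h1 : ∀ μ, ‖χ (delta μ)‖ ≤ 1 := fun μ => (norm_character_le χ _).trans (norm_delta μ).le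
  have h2 : χ (delta ν) * χ (delta (-ν)) = 1 := by
    rw [← character_delta_mul, add_neg_cancel, delta_zero, map_one]
  have h3 : ‖χ (delta ν)‖ * ‖χ (delta (-ν))‖ = 1 := by rw [← norm_mul, h2, norm_one]
  nlinarith [h1 ν, h1 (-ν), norm_nonneg (χ (delta ν)), norm_nonneg (χ (delta (-ν)))]

theorem character_delta_neg (χ : characterSpace ℂ (Wiener n)) (ν : Fin n → ℤ) :
    χ (delta (-ν)) = conj (χ (delta ν)) := by
  have h2 : χ (delta ν) * χ (delta (-ν)) = 1 := by
    rw [← character_delta_mul, add_neg_cancel, delta_zero, map_one]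
  have h3 : χ (delta ν) * conj (χ (delta ν)) = 1 := by
    rw [Complex.mul_conj, Complex.normSq_eq_norm_sq, norm_character_delta]; simp
  exact mul_left_cancel₀ (left_ne_zero_of_mul_eq_one h2) (h2.trans h3.symm)

theorem hasSum_character (χ : characterSpace ℂ (Wiener n)) (a : Wiener n) :
    HasSum (fun ν => coef a ν * χ (delta ν)) (χ a) := by
  have := (hasSum_delta a).map χ (map_continuous χ)
  simpa [Function.comp_def] using this

theorem character_star (χ : characterSpace ℂ (Wiener n)) (a : Wiener n) :
    χ (star a) = conj (χ a) := by
  rw [← (hasSum_character χ a).tsum_eq, ← (hasSum_character χ (star a)).tsum_eq, conj_tsum',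
    ← (Equiv.neg _).tsum_eq]
  refine tsum_congr fun ν => ?_
  simp [coef_star, bstar, character_delta_neg]

/-- **Wiener's lemma**: an element on which no character vanishes is invertible. -/
theorem isUnit_of_character_ne_zero {a : Wiener n} (h : ∀ χ : characterSpace ℂ (Wiener n), χ a ≠ 0) :
    IsUnit a := by
  by_contra hu
  obtain ⟨χ, hχ⟩ := CharacterSpace.exists_apply_eq_zero hu
  exact h χ hχ

/-- The values of a character on the point masses are exponentials. -/
theorem exists_character_eq_exp (χ : characterSpace ℂ (Wiener n)) :
    ∃ θ : Fin n → ℝ, ∀ ν : Fin n → ℤ, χ (delta ν) =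
      Complex.exp ((∑ i, (ν i : ℝ) * θ i : ℝ) * Complex.I) := by
  refine ⟨fun i => (χ (delta (Pi.single i 1))).arg, fun ν => ?_⟩
  have hz : ∀ i, χ (delta (Pi.single i 1)) =
      Complex.exp (((χ (delta (Pi.single i 1))).arg : ℝ) * Complex.I) := by
    intro i
    have := Complex.norm_mul_exp_arg_mul_I (χ (delta (Pi.single i 1)))
    rw [norm_character_delta] at this
    simpa using this.symm
  let F : (Fin n → ℤ) →+ Additive ℂ :=
    { toFun := fun μ => Additive.ofMul (χ (delta μ))
      map_zero' := by rw [delta_zero, map_one]; rfl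
      map_add' := fun μ κ => congrArg Additive.ofMul (character_delta_mul χ μ κ) }
  let E : (Fin n → ℤ) →+ Additive ℂ :=
    { toFun := fun μ => Additive.ofMul (Complex.exp ((∑ i, (μ i : ℝ) *
        (χ (delta (Pi.single i 1))).arg : ℝ) * Complex.I))
      map_zero' := by simp
      map_add' := fun μ κ => by
        rw [← ofMul_mul, ← Complex.exp_add, ← add_mul, ← Complex.ofReal_add,
          ← Finset.sum_add_distrib]
        simp [add_mul] }
  have hFE : F = E := by
    refine AddMonoidHom.functions_ext' _ _ _ fun i => AddMonoidHom.ext_int ?_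
    change Additive.ofMul (χ (delta (Pi.single i 1))) = Additive.ofMul (Complex.exp
      ((∑ k, ((Pi.single i 1 : Fin n → ℤ) k : ℝ) * (χ (delta (Pi.single k 1))).arg : ℝ) *
        Complex.I))
    rw [Finset.sum_eq_single i, Pi.single_eq_same, Int.cast_one, one_mul, ← hz]
    · intro k _ hk; simp [hk]
    · simp
  exact congrArg Additive.toMul (DFunLike.congr_fun hFE ν)

/-! ### Selfadjoint positive elements -/

theorem exists_invSqrt {a : Wiener n} (ha : star a = a)
    (hpos : ∀ χ : characterSpace ℂ (Wiener n), ∃ r : ℝ, 0 < r ∧ χ a = r) :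
    ∃ b : Wiener n, star b = b ∧ b * a * b = 1 ∧
      ∀ χ : characterSpace ℂ (Wiener n), ∃ r : ℝ, 0 < r ∧ χ b = r := by
  obtain ⟨b, t, h1, h2, h3, -, h4⟩ := exists_selfAdjoint_invSqrt ha fun z hz => by
    obtain ⟨χ, hχ⟩ := CharacterSpace.mem_spectrum_iff_exists.1 hz
    obtain ⟨r, hr, h⟩ := hpos χ
    exact ⟨r, hr, hχ ▸ h⟩
  refine ⟨b, h1, h4, fun χ => ?_⟩
  have hre : ((χ t).re : ℂ) = χ t := Complex.conj_eq_iff_re.1 (by rw [← character_star, h2])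
  have h5 : χ b * (((χ t).re ^ 2 : ℝ) : ℂ) = 1 := by
    rw [Complex.ofReal_pow, hre, sq, ← map_mul, ← map_mul, h3, map_one]
  have h6 : (χ t).re ≠ 0 := by
    intro h; rw [h] at h5; simp at h5
  exact ⟨((χ t).re ^ 2)⁻¹, by positivity, by
    rw [Complex.ofReal_inv]; exact eq_inv_of_mul_eq_one_left h5⟩

section matrix

variable {I : Type*} [Fintype I] [DecidableEq I]

attribute [local instance] Matrix.linftyOpNormedRing Matrix.linftyOpNormedAlgebra

/-- A matrix over `ℓ¹(ℤⁿ)` which is positive definite at each character has a selfadjoint inverse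
square root. -/
theorem exists_matrix_invSqrt {G : Matrix I I (Wiener n)} (hG : Gᴴ = G)
    (hpos : ∀ χ : characterSpace ℂ (Wiener n), ∀ x : I → ℂ, x ≠ 0 →
      0 < (star x ⬝ᵥ (G.map χ) *ᵥ x).re) :
    ∃ B S : Matrix I I (Wiener n), Bᴴ = B ∧ B * S = 1 ∧ S * B = 1 ∧ B * G * B = 1 := by
  have h0 : @CompleteSpace (Matrix I I (Wiener n)) (Matrix.instUniformSpace I I (Wiener n)) :=
    inferInstance
  have h1 : @CompleteSpace (Matrix I I (Wiener n)) PseudoMetricSpace.toUniformSpace := h0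
  have h2 : @ContinuousStar (Matrix I I (Wiener n)) instTopologicalSpaceMatrix _ := inferInstance
  have h3 : @ContinuousStar (Matrix I I (Wiener n))
    PseudoMetricSpace.toUniformSpace.toTopologicalSpace _ := h2
  -- the spectrum is positive: each spectral value is an eigenvalue of the matrix at some
  -- character, which annihilates the determinant
  suffices hspec : ∀ z ∈ spectrum ℂ G, ∃ r : ℝ, 0 < r ∧ z = r by
    obtain ⟨B, t, h1, -, h2, h3, h4⟩ :=
      exists_selfAdjoint_invSqrt (A := Matrix I I (Wiener n)) hG hspec
    exact ⟨B, t * t, h1, h2, h3, h4⟩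
  intro z hz
  rw [spectrum.mem_iff, Matrix.isUnit_iff_isUnit_det] at hz
  obtain ⟨χ, hχ⟩ := CharacterSpace.exists_apply_eq_zero hz
  have hmap : (algebraMap ℂ (Matrix I I (Wiener n)) z - G).map χ =
      z • (1 : Matrix I I ℂ) - G.map χ := by
    ext i j
    simp only [Matrix.map_apply, Matrix.sub_apply, map_sub, Matrix.algebraMap_matrix_apply,
      Matrix.smul_apply, Matrix.one_apply, smul_eq_mul]
    split_ifs <;> simp [AlgHomClass.commutes]
  have hdet : (z • (1 : Matrix I I ℂ) - G.map χ).det = 0 := by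
    rw [← hmap, ← hχ]
    exact ((RingHomClass.toRingHom χ).map_det _).symm
  obtain ⟨x, hx0, hx⟩ := Matrix.exists_mulVec_eq_zero_iff.2 hdet
  have hx' : (G.map χ) *ᵥ x = z • x := by
    rw [Matrix.sub_mulVec, Matrix.smul_mulVec, Matrix.one_mulVec, sub_eq_zero] at hx
    exact hx.symm
  have hherm : (G.map χ).IsHermitian := by
    ext i j
    simp only [Matrix.conjTranspose_apply, Matrix.map_apply]
    rw [← starRingEnd_apply, ← character_star, ← Matrix.conjTranspose_apply, hG]
  have hp := hpos χ x hx0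
  have him : (star x ⬝ᵥ (G.map χ) *ᵥ x).im = 0 := hherm.im_star_dotProduct_mulVec_self x
  have hxx : star x ⬝ᵥ x = ((∑ i, ‖x i‖ ^ 2 : ℝ) : ℂ) := by
    simp only [dotProduct, Pi.star_apply, Complex.ofReal_sum]
    refine Finset.sum_congr rfl fun i _ => ?_
    rw [mul_comm]
    simpa [Complex.normSq_eq_norm_sq] using Complex.mul_conj (x i)
  rw [hx', dotProduct_smul, hxx, smul_eq_mul] at hp him
  rw [Complex.re_mul_ofReal] at hp
  rw [Complex.im_mul_ofReal] at him
  have hnn : 0 ≤ ∑ i, ‖x i‖ ^ 2 := by positivity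
  have hpos' : 0 < z.re := pos_of_mul_pos_left hp hnn
  refine ⟨z.re, hpos', Complex.ext rfl ?_⟩
  have : (∑ i, ‖x i‖ ^ 2) ≠ 0 := fun h => by rw [h] at hp; simp at hp
  simpa [this] using him

end matrix

end Wiener

end

section

variable {n N : ℕ} {I J K : Type*} [Fintype J]

/-! ### Matrices over `ℓ¹(ℤⁿ)` acting on families of functions -/

/-- The family `∑ j, B_{ij} * g_j` obtained by letting a matrix over `ℓ¹(ℤⁿ)` act on a family of
functions through their integer shifts. -/
def act (B : Matrix I J (Wiener n)) (g : J → (Fin n → ℝ) → ℂ) (i : I) : (Fin n → ℝ) → ℂ :=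
  syf g fun j => (B i j).coef

/-- A family of sequences multiplied by a matrix over `ℓ¹(ℤⁿ)` on the right. -/
def vact [Fintype I] (c : I → (Fin n → ℤ) → ℂ) (B : Matrix I J (Wiener n)) (j : J) : (Fin n → ℤ) → ℂ :=
  fun ν => ∑ i, cconv (c i) (B i j).coef ν

omit [Fintype J] in
theorem memSeq_vact [Fintype I] {p : ℝ≥0∞} (hp : 1 ≤ p) {c : I → (Fin n → ℤ) → ℂ} (hc : ∀ i, MemSeq p (c i))
    (B : Matrix I J (Wiener n)) (j : J) : MemSeq p (vact c B j) :=
  memSeq_sum _ fun i _ => (hc i).cconv hp (B i j).memSeq_coef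

theorem perBdd_act {g : J → (Fin n → ℝ) → ℂ} (hg : ∀ j, PerBdd (g j)) (B : Matrix I J (Wiener n))
    (i : I) : PerBdd (act B g i) :=
  perBdd_sum _ fun j _ => (hg j).sy (B i j).memSeq_coef

theorem syf_act [Fintype I] {g : J → (Fin n → ℝ) → ℂ} (hg : ∀ j, PerBdd (g j)) (B : Matrix I J (Wiener n))
    {p : ℝ≥0∞} (hp : 1 ≤ p) {c : I → (Fin n → ℤ) → ℂ} (hc : ∀ i, MemSeq p (c i)) :
    syf (act B g) c =ᵐ[volume] syf g (vact c B) := by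
  have h1 : ∀ᵐ x, ∀ i, sy (act B g i) (c i) x = ∑ j, sy (sy (g j) (B i j).coef) (c i) x :=
    ae_all_iff.2 fun i => sum_sy Finset.univ
      (fun j _ => (hg j).sy (B i j).memSeq_coef) hp (hc i)
  have h2 : ∀ᵐ x, ∀ i j, sy (sy (g j) (B i j).coef) (c i) x =
      sy (g j) (cconv (c i) (B i j).coef) x :=
    ae_all_iff.2 fun i => ae_all_iff.2 fun j => sy_sy (hg j) hp (hc i) (B i j).memSeq_coef
  have h3 : ∀ᵐ x, ∀ j, sy (g j) (vact c B j) x =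
      ∑ i, sy (g j) (cconv (c i) (B i j).coef) x :=
    ae_all_iff.2 fun j => sy_sum (hg j) hp Finset.univ
      fun i _ => (hc i).cconv hp (B i j).memSeq_coef
  filter_upwards [h1, h2, h3] with x h1 h2 h3
  simp only [syf, h1, h2, h3]
  exact Finset.sum_comm

theorem vact_coef (B : Matrix I J (Wiener n)) (C : Matrix J K (Wiener n)) (i : I) (k : K) :
    vact (fun j => (B i j).coef) C k = ((B * C) i k).coef := by
  ext ν
  rw [Matrix.mul_apply, Wiener.coef_sum, Finset.sum_apply]
  rfl

theorem act_mul [Fintype K] {g : K → (Fin n → ℝ) → ℂ} (hg : ∀ k, PerBdd (g k)) (B : Matrix I J (Wiener n))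
    (C : Matrix J K (Wiener n)) (i : I) : act (B * C) g i =ᵐ[volume] act B (act C g) i := by
  have h := syf_act hg C le_rfl fun j => (B i j).memSeq_coef
  have he : act (B * C) g i = syf g (vact (fun j => (B i j).coef) C) := by
    simp only [act, funext (vact_coef B C i)]
  rw [he]
  exact h.symm

omit [Fintype J] in
theorem act_one [Fintype I] [DecidableEq I] (g : I → (Fin n → ℝ) → ℂ) : act (1 : Matrix I I (Wiener n)) g = g := by
  ext i x
  rw [act, syf, Finset.sum_eq_single i]
  · rw [Matrix.one_apply_eq, Wiener.coef_one, sy_dl]; simp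
  · intro j _ hj
    rw [Matrix.one_apply_ne hj.symm]
    simp [sy]
  · simp

theorem act_congr {g g' : J → (Fin n → ℝ) → ℂ} (h : ∀ j, g j =ᵐ[volume] g' j)
    (B : Matrix I J (Wiener n)) (i : I) : act B g i =ᵐ[volume] act B g' i :=
  syf_congr h _

/-- The Gramian `⟨f_i, g_j(· - ν)⟩` of two families as a matrix over `ℓ¹(ℤⁿ)`. -/
def gram (f : I → (Fin n → ℝ) → ℂ) (g : J → (Fin n → ℝ) → ℂ) : Matrix I J (Wiener n) := by
  classical exact fun i j => if h : MemSeq 1 (an (f i) (g j)) then Wiener.mk _ h else 0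

omit [Fintype J] in
theorem coef_gram {f : I → (Fin n → ℝ) → ℂ} {g : J → (Fin n → ℝ) → ℂ} (hf : ∀ i, PerBdd (f i))
    (hg : ∀ j, PerBdd (g j)) (i : I) (j : J) : (gram f g i j).coef = an (f i) (g j) := by
  rw [gram, dif_pos ((hg j).memSeq_an le_rfl ((hf i).memLp le_rfl))]
  rfl

theorem gram_act_left {f : J → (Fin n → ℝ) → ℂ} {g : K → (Fin n → ℝ) → ℂ}
    (hf : ∀ j, PerBdd (f j)) (hg : ∀ k, PerBdd (g k)) (B : Matrix I J (Wiener n)) :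
    gram (act B f) g = B * gram f g := by
  ext i k
  refine Wiener.ext fun ν => ?_
  rw [coef_gram (perBdd_act hf B) hg, Matrix.mul_apply, Wiener.coef_sum, Finset.sum_apply]
  have h := an_sum (hg k) le_rfl Finset.univ (f := fun j => sy (f j) (B i j).coef)
    fun j _ => (hf j).memLp_sy le_rfl (B i j).memSeq_coef
  refine (congrFun h ν).trans (Finset.sum_congr rfl fun j _ => ?_)
  rw [Wiener.coef_mul, coef_gram hf hg, an_sy (hf j) (hg k) le_rfl (B i j).memSeq_coef]

omit [Fintype J] in
theorem gram_act_right [Fintype K] {f : I → (Fin n → ℝ) → ℂ} {g : K → (Fin n → ℝ) → ℂ}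
    (hf : ∀ i, PerBdd (f i)) (hg : ∀ k, PerBdd (g k)) (B : Matrix J K (Wiener n)) :
    gram f (act B g) = gram f g * Bᴴ := by
  ext i j
  refine Wiener.ext fun ν => ?_
  rw [coef_gram hf (perBdd_act hg B), Matrix.mul_apply, Wiener.coef_sum, Finset.sum_apply]
  have h := an_sum_right Finset.univ (g := fun k => sy (g k) (B j k).coef)
    (fun k _ => (hg k).sy (B j k).memSeq_coef) le_rfl ((hf i).memLp le_rfl)
  refine (congrFun h ν).trans (Finset.sum_congr rfl fun k _ => ?_)
  rw [Wiener.coef_mul, coef_gram hf hg, an_sy_right le_rfl ((hf i).memLp le_rfl) (hg k)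
    (B j k).memSeq_coef, Matrix.conjTranspose_apply, Wiener.coef_star]

theorem an_conj (f g : (Fin n → ℝ) → ℂ) : an g f = bstar (an f g) := by
  ext ν
  rw [bstar, an, an, ← integral_conj, ← integral_sub_right_eq_self _ (-vec ν)]
  simp [mul_comm]

omit [Fintype J] in
theorem gram_conjTranspose {f : I → (Fin n → ℝ) → ℂ} {g : J → (Fin n → ℝ) → ℂ}
    (hf : ∀ i, PerBdd (f i)) (hg : ∀ j, PerBdd (g j)) : (gram f g)ᴴ = gram g f := by
  ext i j
  refine Wiener.ext fun ν => ?_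
  rw [Matrix.conjTranspose_apply, Wiener.coef_star, coef_gram hf hg, coef_gram hg hf,
    an_conj (f j)]

omit [Fintype J] in
theorem biorth_iff_gram [DecidableEq I] {f g : I → (Fin n → ℝ) → ℂ} (hf : ∀ i, PerBdd (f i))
    (hg : ∀ i, PerBdd (g i)) : Biorth f g ↔ gram f g = 1 := by
  have key : ∀ i j ν, Wiener.coef ((1 : Matrix I I (Wiener n)) i j) ν =
      if ν = 0 ∧ i = j then 1 else 0 := by
    intro i j ν
    by_cases h : i = j
    · subst h; simp [Wiener.coef_one, dl, Pi.single_apply]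
    · simp [Matrix.one_apply_ne h, h]
  constructor
  · intro h
    ext i j
    refine Wiener.ext fun ν => ?_
    rw [coef_gram hf hg, key, h.an_eq]
  · intro h
    refine ⟨hf, hg, fun i j ν => ?_⟩
    rw [← coef_gram hf hg, h, key]

/-! ### Positivity of the Gramian -/

/-- The lower `L²` bound in the definition of stable shifts. -/
def LowerStable [Fintype I] (g : I → (Fin n → ℝ) → ℂ) : Prop :=
  ∃ C : ℝ≥0, 0 < C ∧ ∀ c : I → (Fin n → ℤ) → ℂ, (∀ i, MemSeq 2 (c i)) →
    C * ∑ i, seqNorm 2 (c i) ≤ eLpNorm (syf g c) 2 volume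

theorem eLpNorm_two_sq {α : Type*} [MeasurableSpace α] {μ : Measure α} (f : α → ℂ) :
    eLpNorm f 2 μ ^ 2 = ∫⁻ x, ‖f x‖ₑ ^ 2 ∂μ := by
  rw [eLpNorm_eq_lintegral_rpow_enorm_toReal (by simp) (by simp), ← ENNReal.rpow_natCast,
    ← ENNReal.rpow_mul]
  simp

theorem eLpNorm_two_sq_eq_integral {α : Type*} [MeasurableSpace α] {μ : Measure α} {f : α → ℂ}
    (hf : MemLp f 2 μ) : eLpNorm f 2 μ ^ 2 = ENNReal.ofReal (∫ x, f x * conj (f x) ∂μ).re := by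
  have h2 : ∀ x, f x * conj (f x) = ((‖f x‖ ^ 2 : ℝ) : ℂ) := by
    intro x; rw [Complex.mul_conj, Complex.normSq_eq_norm_sq]
  have h3 : ∫ x, f x * conj (f x) ∂μ = ((∫ x, ‖f x‖ ^ 2 ∂μ : ℝ) : ℂ) := by
    simp only [h2]
    exact integral_ofReal
  rw [eLpNorm_two_sq, h3, Complex.ofReal_re, ofReal_integral_eq_lintegral_ofReal
    (by simpa using hf.integrable_norm_pow (p := 2) (by simp))
    (Eventually.of_forall fun x => by positivity)]
  simp [ENNReal.ofReal_pow]

/-- The lattice points of a box with sides of length `R`. -/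
def box (n R : ℕ) : Finset (Fin n → ℤ) := Finset.Icc 0 fun _ => (R : ℤ)

theorem card_box_pos (n R : ℕ) : 0 < (box n R).card := by
  rw [Finset.card_pos]
  exact ⟨0, by simp [box, Pi.le_def]⟩

/-- Large boxes are almost invariant under a given translation. -/
theorem tendsto_card_box_inter (ν : Fin n → ℤ) :
    Tendsto (fun R : ℕ => (((box n R).filter fun μ => μ - ν ∈ box n R).card : ℝ) / (box n R).card)
      atTop (𝓝 1) := by
  have h1 : ∀ R : ℕ, (box n R).filter (fun μ => μ - ν ∈ box n R) =
      Finset.Icc (0 ⊔ ν) ((fun _ => (R : ℤ)) ⊓ fun i => R + ν i) := by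
    intro R
    ext μ
    simp only [box, Finset.mem_filter, Finset.mem_Icc, Pi.le_def, Pi.zero_apply, sup_le_iff, le_inf_iff, sub_nonneg, sub_le_iff_le_add]
    constructor
    · rintro ⟨⟨h1, h2⟩, h3, h4⟩
      exact ⟨⟨h1, h3⟩, h2, h4⟩
    · rintro ⟨⟨h1, h3⟩, h2, h4⟩
      exact ⟨⟨h1, h2⟩, h3, h4⟩
  have h2 : ∀ R : ℕ, (((box n R).filter fun μ => μ - ν ∈ box n R).card : ℝ) / (box n R).card =
      ∏ i, (((min (R : ℤ) (R + ν i) + 1 - max 0 (ν i)).toNat : ℝ) / (R + 1)) := by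
    intro R
    rw [h1, Finset.prod_div_distrib, Pi.card_Icc, box, Pi.card_Icc]
    push_cast
    simp only [Int.card_Icc, Pi.sup_apply, Pi.inf_apply, Pi.zero_apply]
    congr 1
    refine Finset.prod_congr rfl fun i _ => ?_
    have : ((R : ℤ) + 1 - 0).toNat = R + 1 := by omega
    rw [this]; push_cast; rfl
  simp only [h2]
  rw [show 𝓝 (1 : ℝ) = 𝓝 (∏ _i : Fin n, (1 : ℝ)) by simp]
  refine tendsto_finsetProd _ fun i _ => ?_
  -- each factor lies between `(R + 1 - |ν i|) / (R + 1)` and `1`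
  have hlim : Tendsto (fun R : ℕ => 1 - |(ν i : ℝ)| / ((R : ℝ) + 1)) atTop (𝓝 1) := by
    have := (tendsto_const_div_atTop_nhds_zero_nat |(ν i : ℝ)|).comp (tendsto_add_atTop_nat 1)
    simpa [Function.comp_def] using this.const_sub 1
  refine tendsto_of_tendsto_of_tendsto_of_le_of_le hlim tendsto_const_nhds (fun R => ?_) fun R => ?_
  · have hR : (0 : ℝ) < R + 1 := by positivity
    have hle : ((R : ℤ) + 1 - |ν i|) ≤ ((min (R : ℤ) (R + ν i) + 1 - max 0 (ν i)).toNat : ℤ) := by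
      rcases abs_cases (ν i) with h | h <;> omega
    have hle' : ((R : ℝ) + 1 - |(ν i : ℝ)|) ≤
        ((min (R : ℤ) (R + ν i) + 1 - max 0 (ν i)).toNat : ℝ) := by exact_mod_cast hle
    simp only
    rw [le_div_iff₀ hR, sub_mul, div_mul_cancel₀ _ hR.ne', one_mul]
    exact hle'
  · have hR : (0 : ℝ) < R + 1 := by positivity
    have hle : ((min (R : ℤ) (R + ν i) + 1 - max 0 (ν i)).toNat : ℤ) ≤ (R : ℤ) + 1 := by omega
    simp only
    rw [div_le_one hR]
    exact_mod_cast hle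

open WeakDual

/-- The conjugate of a character, cut off to a box. -/
def window (χ : characterSpace ℂ (Wiener n)) (R : ℕ) (ν : Fin n → ℤ) : ℂ :=
  ∑ μ ∈ box n R, conj (χ (Wiener.delta μ)) * dl μ ν

theorem memSeq_window (p : ℝ≥0∞) (χ : characterSpace ℂ (Wiener n)) (R : ℕ) :
    MemSeq p (window χ R) :=
  memSeq_sum _ fun μ _ => (memSeq_dl p μ).const_mul _

theorem window_apply (χ : characterSpace ℂ (Wiener n)) (R : ℕ) (ν : Fin n → ℤ) :
    window χ R ν = if ν ∈ box n R then conj (χ (Wiener.delta ν)) else 0 := by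
  simp [window, dl, Pi.single_apply]

theorem seqNorm_window (χ : characterSpace ℂ (Wiener n)) (R : ℕ) (y : ℂ) :
    seqNorm 2 (fun ν => y * window χ R ν) ^ 2 = (box n R).card * ‖y‖ₑ ^ 2 := by
  rw [seqNorm, eLpNorm_two_sq, lintegral_count, tsum_eq_sum (s := box n R)]
  · rw [Finset.sum_congr rfl fun ν hν => ?_, Finset.sum_const, nsmul_eq_mul]
    rw [window_apply, if_pos hν, enorm_mul, ← ofReal_norm (conj _), RCLike.norm_conj,
      Wiener.norm_character_delta]
    simp
  · intro ν hν
    simp [window_apply, hν]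

/-- The autocorrelation of a window, normalized by the size of its box, approximates a character. -/
theorem tendsto_window (χ : characterSpace ℂ (Wiener n)) (a : Wiener n) :
    Tendsto (fun R : ℕ => (Wiener.mk (window χ R) (memSeq_window 1 χ R) *
      star (Wiener.mk (window χ R) (memSeq_window 1 χ R)) * a).coef 0 / (box n R).card)
      atTop (𝓝 (χ a)) := by
  have hauto : ∀ (R : ℕ) ν, (Wiener.mk (window χ R) (memSeq_window 1 χ R) *
      star (Wiener.mk (window χ R) (memSeq_window 1 χ R))).coef ν =
      ((box n R).filter fun μ => μ - ν ∈ box n R).card * conj (χ (Wiener.delta ν)) := by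
    intro R ν
    rw [Wiener.coef_mul, Wiener.coef_star, Wiener.coef_mk, cconv, tsum_eq_sum (s := box n R)]
    · rw [Finset.card_filter, Nat.cast_sum, Finset.sum_mul]
      refine Finset.sum_congr rfl fun μ hμ => ?_
      rw [bstar, neg_sub, window_apply, window_apply, if_pos hμ]
      split_ifs with h
      · rw [← map_mul, ← Wiener.character_delta_neg, ← Wiener.character_delta_mul]
        simp
      · simp
    · intro μ hμ
      simp [window_apply, hμ]
  have hval : ∀ R : ℕ, (Wiener.mk (window χ R) (memSeq_window 1 χ R) *
      star (Wiener.mk (window χ R) (memSeq_window 1 χ R)) * a).coef 0 / (box n R).card =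
      ∑' ν, (((((box n R).filter fun μ => μ - (-ν) ∈ box n R).card : ℝ) /
        (box n R).card : ℝ) : ℂ) * (a.coef ν * χ (Wiener.delta ν)) := by
    intro R
    rw [Wiener.coef_mul, cconv, ← tsum_div_const, ← (Equiv.neg _).tsum_eq]
    refine tsum_congr fun ν => ?_
    rw [Equiv.neg_apply, hauto, ← Wiener.character_delta_neg, neg_neg, zero_sub, neg_neg]
    push_cast
    ring
  simp only [hval]
  rw [← (Wiener.hasSum_character χ a).tsum_eq]
  refine tendsto_tsum_of_dominated_convergence (Wiener.summable_coef a) (fun ν => ?_)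
    (Eventually.of_forall fun R ν => ?_)
  · have := (Complex.continuous_ofReal.tendsto _).comp (tendsto_card_box_inter (-ν))
    simpa [Function.comp_def] using this.mul_const (a.coef ν * χ (Wiener.delta ν))
  · rw [norm_mul, norm_mul, Wiener.norm_character_delta, mul_one, Complex.norm_real,
      Real.norm_of_nonneg (by positivity)]
    refine mul_le_of_le_one_left (norm_nonneg _) ?_
    rw [div_le_one (by exact_mod_cast card_box_pos n R)]
    exact_mod_cast Finset.card_filter_le _ _

omit [Fintype J] in
/-- Stability makes the Gramian positive definite at each character. -/
theorem gram_pos [Fintype I] {g : I → (Fin n → ℝ) → ℂ} (hg : ∀ i, PerBdd (g i))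
    (hL : LowerStable g) (χ : characterSpace ℂ (Wiener n)) {x : I → ℂ} (hx : x ≠ 0) :
    0 < (star x ⬝ᵥ ((gram g g).map χ) *ᵥ x).re := by
  obtain ⟨C, hC, hL⟩ := hL
  obtain ⟨i₀, hi₀⟩ := Function.ne_iff.1 hx
  set a : Wiener n := ∑ i, ∑ j, (conj (x i) * x j) • gram g g i j with ha
  have hχa : χ a = star x ⬝ᵥ ((gram g g).map χ) *ᵥ x := by
    simp only [ha, map_sum, map_smul, dotProduct, Matrix.mulVec, Matrix.map_apply, smul_eq_mul,
      Finset.mul_sum, Pi.star_apply]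
    refine Finset.sum_congr rfl fun i _ => Finset.sum_congr rfl fun j _ => ?_
    rw [← starRingEnd_apply]; ring
  rw [← hχa]
  -- test the lower bound on the sequences `conj (x i)` times a window
  have hlow : ∀ R : ℕ, (C : ℝ) ^ 2 * ‖x i₀‖ ^ 2 ≤
      ((Wiener.mk (window χ R) (memSeq_window 1 χ R) *
        star (Wiener.mk (window χ R) (memSeq_window 1 χ R)) * a).coef 0 / (box n R).card).re := by
    intro R
    set w := Wiener.mk (window χ R) (memSeq_window 1 χ R) with hw
    set Y : Matrix Unit I (Wiener n) := fun _ i => conj (x i) • w with hY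
    set S := act Y g () with hS
    have hSb : PerBdd S := perBdd_act hg Y ()
    have hgram : (w * star w * a).coef 0 = ∫ y, S y * conj (S y) := by
      have h1 : gram (act Y g) (act Y g) = Y * gram g g * Yᴴ := by
        rw [gram_act_left hg (perBdd_act hg Y), gram_act_right hg hg, Matrix.mul_assoc]
      have h2 := coef_gram (perBdd_act hg Y) (perBdd_act hg Y) () ()
      have h3 : (Y * gram g g * Yᴴ) () () = w * star w * a := by
        have hYH : ∀ j, Yᴴ j () = x j • star w := by
          intro j
          rw [Matrix.conjTranspose_apply, hY, star_smul]
          simp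
        have hYG : ∀ j, (Y * gram g g) () j = ∑ i, conj (x i) • w * gram g g i j :=
          fun j => Matrix.mul_apply
        rw [ha, Matrix.mul_apply]
        simp only [hYH, hYG, Finset.sum_mul, Finset.mul_sum]
        rw [Finset.sum_comm]
        refine Finset.sum_congr rfl fun i _ => Finset.sum_congr rfl fun j _ => ?_
        rw [smul_mul_assoc, smul_mul_assoc, mul_smul_comm, mul_smul_comm, smul_smul]
        congr 1
        ring
      rw [← h3, ← h1, h2, an]
      simp [hS]
    have hb := hL (fun i ν => conj (x i) * window χ R ν)
      fun i => (memSeq_window 2 χ R).const_mul _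
    have hSsyf : syf g (fun i ν => conj (x i) * window χ R ν) = S := rfl
    rw [hSsyf] at hb
    have hb' : (C : ℝ≥0∞) * seqNorm 2 (fun ν => conj (x i₀) * window χ R ν) ≤
        eLpNorm S 2 volume := by
      refine le_trans ?_ hb
      gcongr
      exact Finset.single_le_sum (f := fun i => seqNorm 2 fun ν => conj (x i) * window χ R ν)
        (fun _ _ => zero_le) (Finset.mem_univ i₀)
    have hsq := pow_le_pow_left' hb' 2
    rw [mul_pow, seqNorm_window, eLpNorm_two_sq_eq_integral (hSb.memLp (by norm_num)), ← hgram]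
      at hsq
    have hcard : (0 : ℝ) < (box n R).card := by exact_mod_cast card_box_pos n R
    have hle : (C : ℝ) ^ 2 * ((box n R).card * ‖x i₀‖ ^ 2) ≤ ((w * star w * a).coef 0).re := by
      have he : (C : ℝ≥0∞) ^ 2 * ((box n R).card * ‖conj (x i₀)‖ₑ ^ 2) =
          ENNReal.ofReal ((C : ℝ) ^ 2 * ((box n R).card * ‖x i₀‖ ^ 2)) := by
        rw [ENNReal.ofReal_mul (by positivity), ENNReal.ofReal_mul (by positivity),
          ENNReal.ofReal_pow (by positivity), ENNReal.ofReal_pow (by positivity),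
          ENNReal.ofReal_coe_nnreal, ENNReal.ofReal_natCast, ← ofReal_norm, RCLike.norm_conj]
      rw [he] at hsq
      have hpos : 0 < (C : ℝ) ^ 2 * ((box n R).card * ‖x i₀‖ ^ 2) := by
        have : 0 < ‖x i₀‖ := norm_pos_iff.2 hi₀
        have : (0 : ℝ) < C := hC
        positivity
      refine (ENNReal.ofReal_le_ofReal_iff' .. ).1 hsq |>.resolve_right ?_
      exact fun h => absurd hpos (not_lt.2 h)
    have hre : ((w * star w * a).coef 0 / (box n R).card).re =
        ((w * star w * a).coef 0).re / (box n R).card := by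
      rw [← Complex.ofReal_natCast, Complex.div_ofReal_re]
    rw [hre, le_div_iff₀ hcard]
    linarith
  have hlim := (Complex.continuous_re.tendsto _).comp (tendsto_window χ a)
  refine lt_of_lt_of_le ?_ (ge_of_tendsto' hlim hlow)
  have : 0 < ‖x i₀‖ := norm_pos_iff.2 hi₀
  have : (0 : ℝ) < C := hC
  positivity

/-- A stable family has orthonormal generators with the same shift-invariant spaces: `E = B φ` and
`φ = S E` with mutually inverse matrices over `ℓ¹(ℤⁿ)`. -/
theorem exists_orthonormal_generators [Fintype I] [DecidableEq I] {φ : I → (Fin n → ℝ) → ℂ}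
    (hφ : ∀ i, PerBdd (φ i)) (hL : LowerStable φ) :
    ∃ B S : Matrix I I (Wiener n), B * S = 1 ∧ S * B = 1 ∧ Biorth (act B φ) (act B φ) := by
  obtain ⟨B, S, h1, h2, h3, h4⟩ := Wiener.exists_matrix_invSqrt (gram_conjTranspose hφ hφ)
    fun χ x hx => gram_pos hφ hL χ hx
  refine ⟨B, S, h2, h3, ?_⟩
  rw [biorth_iff_gram (perBdd_act hφ B) (perBdd_act hφ B), gram_act_left hφ (perBdd_act hφ B),
    gram_act_right hφ hφ, h1, ← mul_assoc, h4]

/-- A stable family has a dual family in `𝓛^∞`. -/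
theorem exists_biorth [Fintype I] [DecidableEq I] {φ : I → (Fin n → ℝ) → ℂ}
    (hφ : ∀ i, PerBdd (φ i)) (hL : LowerStable φ) : ∃ φ', Biorth φ φ' := by
  obtain ⟨B, S, h1, h2, h3⟩ := exists_orthonormal_generators hφ hL
  have hE := perBdd_act hφ B
  refine ⟨act Bᴴ (act B φ), (biorth_iff_gram hφ (perBdd_act hE _)).2 ?_⟩
  rw [biorth_iff_gram hE hE, gram_act_left hφ hE] at h3
  rw [gram_act_right hφ hE, Matrix.conjTranspose_conjTranspose]
  exact mul_eq_one_comm.1 h3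

end

section

variable {n N : ℕ} {I : Type*} [Fintype I] [DecidableEq I]

/-! ### Completion of orthonormal columns over `ℓ¹(ℤⁿ)` to a unitary matrix -/

theorem star_mulVec_dotProduct_mulVec {R : Type*} [CommRing R] [StarRing R] {U : Matrix I I R}
    (hU : Uᴴ * U = 1) (x y : I → R) : star (U *ᵥ x) ⬝ᵥ (U *ᵥ y) = star x ⬝ᵥ y := by
  rw [Matrix.star_mulVec, ← Matrix.dotProduct_mulVec, Matrix.mulVec_mulVec, hU, Matrix.one_mulVec]

/-- A generalized Householder reflection `1 - (1 - v^*u)⁻¹ (u - v)(u - v)^*`, mapping a unit vector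
`u` to another unit vector `v`. -/
theorem exists_unitary_reflection {R : Type*} [CommRing R] [StarRing R] {u v : I → R}
    (hu : star u ⬝ᵥ u = 1) (hv : star v ⬝ᵥ v = 1) (h : IsUnit (1 - star v ⬝ᵥ u)) :
    ∃ H : Matrix I I R, Hᴴ * H = 1 ∧ H *ᵥ u = v ∧
      ∀ i, u i = 0 → v i = 0 → H *ᵥ Pi.single i 1 = Pi.single i 1 := by
  obtain ⟨c, hc⟩ := h.exists_left_inv
  set z : I → R := u - v with hz
  have hzu : star z ⬝ᵥ u = 1 - star v ⬝ᵥ u := by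
    rw [hz, star_sub, sub_dotProduct, hu]
  have huv : star u ⬝ᵥ v = star (star v ⬝ᵥ u) := by
    rw [Matrix.star_dotProduct]
  have hzz : star z ⬝ᵥ z = (1 - star v ⬝ᵥ u) + star (1 - star v ⬝ᵥ u) := by
    nth_rewrite 2 [hz]
    rw [dotProduct_sub, hzu, hz, star_sub, sub_dotProduct, hv, huv, star_sub, star_one]
    ring
  have hmul : ∀ y, (1 - c • Matrix.vecMulVec z (star z)) *ᵥ y = y - (c * (star z ⬝ᵥ y)) • z := by
    intro y
    rw [Matrix.sub_mulVec, Matrix.one_mulVec, Matrix.smul_mulVec, Matrix.vecMulVec_mulVec,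
      op_smul_eq_smul, smul_smul]
  refine ⟨1 - c • Matrix.vecMulVec z (star z), ?_, ?_, fun i h1 h2 => ?_⟩
  · have hstar : (1 - c • Matrix.vecMulVec z (star z))ᴴ =
        1 - star c • Matrix.vecMulVec z (star z) := by
      rw [Matrix.conjTranspose_sub, Matrix.conjTranspose_one, Matrix.conjTranspose_smul,
        Matrix.conjTranspose_vecMulVec, star_star]
    have hsq : Matrix.vecMulVec z (star z) * Matrix.vecMulVec z (star z) =
        (star z ⬝ᵥ z) • Matrix.vecMulVec z (star z) := by
      rw [Matrix.vecMulVec_mul_vecMulVec]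
      ext i j
      simp only [Matrix.smul_apply, Matrix.vecMulVec_apply, Pi.smul_apply, smul_eq_mul]
      ring
    have hcs : star c * star (1 - star v ⬝ᵥ u) = 1 := by
      rw [← star_mul, mul_comm, hc, star_one]
    rw [hstar, sub_mul, mul_sub, mul_sub, one_mul, one_mul, mul_one, smul_mul_smul_comm, hsq,
      smul_smul, hzz]
    have : star c * c * (1 - star v ⬝ᵥ u + star (1 - star v ⬝ᵥ u)) = star c + c := by
      linear_combination star c * hc + c * hcs
    rw [this, add_smul]
    abel
  · rw [hmul, hzu, hc, one_smul, hz, sub_sub_cancel]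
  · rw [hmul]
    have : star z ⬝ᵥ Pi.single i 1 = 0 := by simp [hz, h1, h2]
    rw [this, mul_zero, zero_smul, sub_zero]

open scoped ComplexOrder in
omit [DecidableEq I] in
theorem eq_of_star_dotProduct_eq_one {u v : I → ℂ} (hu : star u ⬝ᵥ u = 1) (hv : star v ⬝ᵥ v = 1)
    (h : star v ⬝ᵥ u = 1) : u = v := by
  have huv : star u ⬝ᵥ v = 1 := by
    have := Matrix.star_dotProduct u v
    rw [h, star_one] at this
    exact this
  rw [← sub_eq_zero, ← dotProduct_star_self_eq_zero (v := u - v), star_sub, sub_dotProduct, dotProduct_sub, dotProduct_sub, hu, hv, h, huv]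
  ring

omit [DecidableEq I] in
theorem star_dotProduct_self_eq (u : I → ℂ) : star u ⬝ᵥ u = ((∑ i, ‖u i‖ ^ 2 : ℝ) : ℂ) := by
  simp only [dotProduct, Pi.star_apply, Complex.ofReal_sum]
  refine Finset.sum_congr rfl fun i _ => ?_
  rw [mul_comm]
  simpa [Complex.normSq_eq_norm_sq] using Complex.mul_conj (u i)

/-- Families of exponential polynomials in `n` variables, up to real multiples, cannot cover the
unit sphere of `ℂ^I` if `n + 1 < 2 |I|`. -/
theorem exists_unit_vector_ne_exp_sum (hcard : n + 1 < 2 * Fintype.card I) (i₀ : I)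
    (F : Finset (Fin n → ℤ)) (a : I → (Fin n → ℤ) → ℂ) :
    ∃ w : I → ℂ, star w ⬝ᵥ w = 1 ∧ w i₀ ≠ -1 ∧ ∀ (θ : Fin n → ℝ) (t : ℝ), w ≠ fun i =>
      t * ∑ ν ∈ F, a i ν * Complex.exp ((∑ k, (ν k : ℝ) * θ k : ℝ) * Complex.I) := by
  let f : (Fin n → ℝ) × ℝ → (I → ℂ) := fun q i =>
    q.2 * ∑ ν ∈ F, a i ν * Complex.exp ((∑ k, (ν k : ℝ) * q.1 k : ℝ) * Complex.I)
  have hf : ContDiff ℝ 1 f := by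
    rw [contDiff_pi]
    intro i
    have h1 : ContDiff ℝ 1 fun q : (Fin n → ℝ) × ℝ => (q.2 : ℂ) :=
      Complex.ofRealCLM.contDiff.comp contDiff_snd
    refine h1.mul (ContDiff.sum fun ν _ => contDiff_const.mul ?_)
    have h2 : ContDiff ℝ 1 fun q : (Fin n → ℝ) × ℝ => ∑ k, (ν k : ℝ) * q.1 k :=
      ContDiff.sum fun k _ => contDiff_const.mul ((contDiff_apply ℝ ℝ k).comp contDiff_fst)
    have h3 : ContDiff ℝ 1 fun q : (Fin n → ℝ) × ℝ => ((∑ k, (ν k : ℝ) * q.1 k : ℝ) : ℂ) :=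
      Complex.ofRealCLM.contDiff.comp h2
    exact (h3.mul contDiff_const).cexp
  -- the range of a smooth map from dimension `n + 1` has dense complement in dimension `2 |I|`;
  -- take a value near a coordinate vector, so that `w i₀ ≠ -1` after normalization
  have hdense := hf.dense_compl_range_of_finrank_lt_finrank (by
    simp [Module.finrank_prod, Module.finrank_pi_fintype]
    omega)
  obtain ⟨w, hw, hdist⟩ := Metric.dense_iff.1 hdense (Pi.single i₀ 1) 1 one_pos
  have hre : 0 < (w i₀).re := by
    have h1 : ‖w i₀ - 1‖ < 1 := by
      have := (dist_pi_lt_iff one_pos).1 hw i₀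
      simpa [dist_eq_norm] using this
    have h2 := (abs_lt.1 ((Complex.abs_re_le_norm (w i₀ - 1)).trans_lt h1)).1
    simp at h2
    linarith
  set r : ℝ := √(∑ i, ‖w i‖ ^ 2) with hr
  have hpos : 0 < ∑ i, ‖w i‖ ^ 2 := by
    have h0 : w i₀ ≠ 0 := fun h => by simp [h] at hre
    have h1 : 0 < ‖w i₀‖ ^ 2 := by positivity
    exact h1.trans_le (Finset.single_le_sum (f := fun i => ‖w i‖ ^ 2)
      (fun _ _ => by positivity) (Finset.mem_univ i₀))
  have hr0 : 0 < r := Real.sqrt_pos.2 hpos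
  refine ⟨fun i => ((r⁻¹ : ℝ) : ℂ) * w i, ?_, fun h => ?_, fun θ t h => ?_⟩
  · rw [star_dotProduct_self_eq]
    simp only [norm_mul, mul_pow, Complex.norm_real]
    rw [← Finset.mul_sum, Real.norm_of_nonneg (by positivity), inv_pow, hr, Real.sq_sqrt hpos.le,
      inv_mul_cancel₀ hpos.ne', Complex.ofReal_one]
  · have := congrArg Complex.re h
    rw [Complex.re_ofReal_mul] at this
    have h2 : 0 < r⁻¹ * (w i₀).re := by positivity
    simp at this
    linarith
  · refine hdist ⟨(θ, r * t), ?_⟩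
    ext1 i
    have := congrFun h i
    simp only [f]
    rw [Complex.ofReal_mul, mul_assoc, ← this, ← mul_assoc, ← Complex.ofReal_mul,
      mul_inv_cancel₀ hr0.ne', Complex.ofReal_one, one_mul]

open WeakDual

omit [DecidableEq I] in
theorem character_dotProduct (χ : characterSpace ℂ (Wiener n)) (u v : I → Wiener n) :
    χ (star u ⬝ᵥ v) = star (fun i => χ (u i)) ⬝ᵥ fun i => χ (v i) := by
  simp only [dotProduct, map_sum, map_mul, Pi.star_apply, Wiener.character_star]
  rfl

omit [DecidableEq I] in
theorem isUnit_one_sub_dotProduct {u v : I → Wiener n} (hu : star u ⬝ᵥ u = 1)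
    (hv : star v ⬝ᵥ v = 1)
    (h : ∀ χ : characterSpace ℂ (Wiener n), (fun i => χ (u i)) ≠ fun i => χ (v i)) :
    IsUnit (1 - star v ⬝ᵥ u) := by
  refine Wiener.isUnit_of_character_ne_zero fun χ h0 => h χ (eq_of_star_dotProduct_eq_one ?_ ?_ ?_)
  · rw [← character_dotProduct, hu, map_one]
  · rw [← character_dotProduct, hv, map_one]
  · rw [← character_dotProduct]
    rw [map_sub, map_one, sub_eq_zero] at h0
    exact h0.symm

omit [DecidableEq I] in
/-- Approximation of a vector over `ℓ¹(ℤⁿ)` by truncation, uniformly over the characters. -/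
theorem exists_truncation (x : I → Wiener n) : ∃ F : Finset (Fin n → ℤ),
    ∀ χ : characterSpace ℂ (Wiener n),
      ∑ i, ‖χ (x i) - χ (∑ ν ∈ F, (x i).coef ν • Wiener.delta ν)‖ ^ 2 < 1 := by
  have h1 : ∀ i, Tendsto (fun F : Finset (Fin n → ℤ) =>
      ‖x i - ∑ ν ∈ F, (x i).coef ν • Wiener.delta ν‖ ^ 2) atTop (𝓝 0) := by
    intro i
    have := ((tendsto_const_nhds (x := x i)).sub (Wiener.hasSum_delta (x i))).norm.pow 2
    simpa using this
  have h2 := tendsto_finsetSum Finset.univ fun i _ => h1 i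
  rw [Finset.sum_const_zero] at h2
  obtain ⟨F, hF⟩ := (h2.eventually_lt_const one_pos).exists
  refine ⟨F, fun χ => lt_of_le_of_lt ?_ hF⟩
  gcongr with i
  rw [← map_sub]
  exact Wiener.norm_character_le χ _

/-- Each unit vector over `ℓ¹(ℤⁿ)` in at least `(n + 2) / 2` coordinates is the image of a
coordinate vector under a unitary matrix that fixes the coordinates where the vector vanishes. -/
theorem exists_unitary_mulVec_single {x : I → Wiener n} (hx : star x ⬝ᵥ x = 1) (Z : Finset I)
    (hZ : ∀ i ∈ Z, x i = 0) {i₀ : I} (hi₀ : i₀ ∉ Z)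
    (hcard : n + 1 < 2 * (Fintype.card I - Z.card)) :
    ∃ U : Matrix I I (Wiener n), Uᴴ * U = 1 ∧ U *ᵥ Pi.single i₀ 1 = x ∧
      ∀ i ∈ Z, U *ᵥ Pi.single i 1 = Pi.single i 1 := by
  obtain ⟨F, hF⟩ := exists_truncation x
  set x₀ : I → Wiener n := fun i => ∑ ν ∈ F, (x i).coef ν • Wiener.delta ν with hx₀
  have hx₀Z : ∀ i ∈ Z, x₀ i = 0 := fun i hi => by simp [hx₀, hZ i hi]
  have hxχ : ∀ χ : characterSpace ℂ (Wiener n), ∑ i, ‖χ (x i)‖ ^ 2 = 1 := by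
    intro χ
    have := character_dotProduct χ x x
    rw [hx, map_one, star_dotProduct_self_eq] at this
    exact_mod_cast this.symm
  -- normalization of the truncation
  have hnz : ∀ χ : characterSpace ℂ (Wiener n), ∃ r : ℝ, 0 < r ∧ χ (star x₀ ⬝ᵥ x₀) = r := by
    intro χ
    refine ⟨∑ i, ‖χ (x₀ i)‖ ^ 2, ?_, by rw [character_dotProduct, star_dotProduct_self_eq]⟩
    refine lt_of_le_of_ne (by positivity) fun h0 => ?_
    have h1 : ∀ i, χ (x₀ i) = 0 := by
      intro i
      have := (Finset.sum_eq_zero_iff_of_nonneg fun i _ => by positivity).1 h0.symm i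
        (Finset.mem_univ i)
      simpa using this
    have h2 := hF χ
    simp only [hx₀] at h1
    simp only [h1, sub_zero, hxχ, lt_irrefl] at h2
  obtain ⟨s, hs1, hs2, hs3⟩ := Wiener.exists_invSqrt (a := star x₀ ⬝ᵥ x₀)
    (by rw [← Matrix.star_dotProduct]) hnz
  set x₁ : I → Wiener n := fun i => s * x₀ i with hx₁
  have hx₁1 : star x₁ ⬝ᵥ x₁ = 1 := by
    rw [← hs2]
    simp only [dotProduct, hx₁, Pi.star_apply, star_mul, hs1, Finset.mul_sum, Finset.sum_mul]
    exact Finset.sum_congr rfl fun i _ => by ring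
  have hx₁Z : ∀ i ∈ Z, x₁ i = 0 := fun i hi => by simp [hx₁, hx₀Z i hi]
  -- a constant vector that is at no character a multiple of the truncation
  obtain ⟨w, hw1, hw2, hw3⟩ := exists_unit_vector_ne_exp_sum (n := n) (I := {i // i ∉ Z})
    (by rw [Fintype.card_subtype_compl, Fintype.card_coe]; exact hcard) ⟨i₀, hi₀⟩ F
    fun i ν => (x i).coef ν
  set W : I → Wiener n := fun i => if h : i ∉ Z then algebraMap ℂ (Wiener n) (w ⟨i, h⟩) else 0
    with hW
  have hWZ : ∀ i ∈ Z, W i = 0 := fun i hi => by simp [hW, hi]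
  have hW' : ∀ i : {i // i ∉ Z}, W i = algebraMap ℂ (Wiener n) (w i) := fun i => by
    simp [hW, i.2]
  have hW1 : star W ⬝ᵥ W = 1 := by
    have h1 : star W ⬝ᵥ W = ∑ i : {i // i ∉ Z}, star (W i) * W i := by
      rw [← Finset.sum_subtype (Finset.univ.filter (· ∉ Z)) (by simp)
        (fun i => star (W i) * W i), dotProduct]
      refine (Finset.sum_subset (Finset.filter_subset _ _) fun i _ hi => ?_).symm
      have hi' : i ∈ Z := by simpa using hi
      simp [hWZ i hi']
    rw [h1]
    simp only [hW']
    rw [← map_one (algebraMap ℂ (Wiener n)), ← hw1, dotProduct, map_sum]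
    refine Finset.sum_congr rfl fun i _ => ?_
    rw [map_mul, Pi.star_apply, algebraMap_star_comm]
  have hWx₁ : ∀ χ : characterSpace ℂ (Wiener n), (fun i => χ (W i)) ≠ fun i => χ (x₁ i) := by
    intro χ h
    obtain ⟨r, -, hr⟩ := hs3 χ
    obtain ⟨θ, hθ⟩ := Wiener.exists_character_eq_exp χ
    refine hw3 θ r (funext fun i => ?_)
    have := congrFun h i
    simp only [hW', AlgHomClass.commutes, hx₁, map_mul, hr, hx₀, map_sum, map_smul, hθ,
      smul_eq_mul] at this
    exact this
  -- three reflections: the first maps `W` to the normalized truncation `x₁`; at no character is `x` a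
  -- negative multiple of its truncation, so its pull-back `y` along the first is nowhere `-W`, and a
  -- second reflection maps `-W` to `y`; the third maps the coordinate vector to `-W`
  obtain ⟨U₁, hU₁, hU₁W, hU₁Z⟩ := exists_unitary_reflection hW1 hx₁1
    (isUnit_one_sub_dotProduct hW1 hx₁1 hWx₁)
  have hU₁' : U₁ * U₁ᴴ = 1 := mul_eq_one_comm.1 hU₁
  have hnW1 : star (-W) ⬝ᵥ (-W) = 1 := by simp [hW1]
  set y : I → Wiener n := U₁ᴴ *ᵥ x with hy
  have hU₁y : U₁ *ᵥ y = x := by rw [hy, Matrix.mulVec_mulVec, hU₁', Matrix.one_mulVec]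
  have hy1 : star y ⬝ᵥ y = 1 := by
    rw [← star_mulVec_dotProduct_mulVec hU₁, hU₁y, hx]
  have hyZ : ∀ i ∈ Z, y i = 0 := by
    intro i hi
    have := star_mulVec_dotProduct_mulVec hU₁ (Pi.single i 1) y
    rw [hU₁y, hU₁Z i (hWZ i hi) (hx₁Z i hi)] at this
    simpa [hZ i hi] using this.symm
  have hWy : ∀ χ : characterSpace ℂ (Wiener n), (fun i => χ ((-W) i)) ≠ fun i => χ (y i) := by
    intro χ h
    obtain ⟨r, hr0, hr⟩ := hs3 χ
    -- applying the first reflection gives `χ(x) = -r χ(x₀)`, too far from `χ(x₀)`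
    have h1 : ∀ i, χ (x i) = -(r * χ (x₀ i)) := by
      intro i
      have e1 : χ (x i) = ∑ j, χ (U₁ i j) * χ (y j) := by
        rw [← hU₁y]; simp [Matrix.mulVec, dotProduct]
      have e2 : χ (x₁ i) = ∑ j, χ (U₁ i j) * χ (W j) := by
        rw [← hU₁W]; simp [Matrix.mulVec, dotProduct]
      have e3 : ∀ j, χ (y j) = -χ (W j) := fun j => by rw [← congrFun h j]; simp
      rw [e1, ← hr, ← map_mul]
      change _ = -χ (x₁ i)
      rw [e2, ← Finset.sum_neg_distrib]
      exact Finset.sum_congr rfl fun j _ => by rw [e3]; ring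
    have h2 := hF χ
    rw [← hxχ χ] at h2
    refine absurd h2 (not_lt.2 (Finset.sum_le_sum fun i _ => ?_))
    have e : χ (x i) - χ (x₀ i) = -(((r + 1 : ℝ) : ℂ) * χ (x₀ i)) := by
      rw [h1]; push_cast; ring
    change ‖χ (x i)‖ ^ 2 ≤ ‖χ (x i) - χ (x₀ i)‖ ^ 2
    rw [e, h1, norm_neg, norm_neg, norm_mul, norm_mul, Complex.norm_real, Complex.norm_real,
      Real.norm_of_nonneg hr0.le, Real.norm_of_nonneg (by positivity)]
    gcongr
    linarith
  obtain ⟨U₂, hU₂, hU₂W, hU₂Z⟩ := exists_unitary_reflection hnW1 hy1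
    (isUnit_one_sub_dotProduct hnW1 hy1 hWy)
  have he1 : star (Pi.single i₀ (1 : Wiener n)) ⬝ᵥ Pi.single i₀ (1 : Wiener n) = 1 := by simp
  obtain ⟨U₃, hU₃, hU₃e, hU₃Z⟩ := exists_unitary_reflection he1 hnW1
    (isUnit_one_sub_dotProduct he1 hnW1 fun χ h => hw2 (by
      have := congrFun h i₀
      have e := hW' ⟨i₀, hi₀⟩
      simp only at e
      simp only [Pi.single_eq_same, map_one, Pi.neg_apply, map_neg, e, AlgHomClass.commutes] at this
      rw [eq_neg_iff_add_eq_zero] at this ⊢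
      rw [add_comm]
      exact this))
  have hnWZ : ∀ i ∈ Z, (-W) i = 0 := fun i hi => by simp [hWZ i hi]
  have heZ : ∀ i ∈ Z, (Pi.single i₀ (1 : Wiener n) : I → Wiener n) i = 0 := fun i hi =>
    Pi.single_eq_of_ne (ne_of_mem_of_not_mem hi hi₀) _
  refine ⟨U₁ * (U₂ * U₃), ?_, ?_, fun i hi => ?_⟩
  · rw [Matrix.conjTranspose_mul, Matrix.conjTranspose_mul, Matrix.mul_assoc,
      ← Matrix.mul_assoc U₁ᴴ, hU₁, Matrix.one_mul, Matrix.mul_assoc, ← Matrix.mul_assoc U₂ᴴ, hU₂,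
      Matrix.one_mul, hU₃]
  · rw [← Matrix.mulVec_mulVec, ← Matrix.mulVec_mulVec, hU₃e, hU₂W, hU₁y]
  · rw [← Matrix.mulVec_mulVec, ← Matrix.mulVec_mulVec, hU₃Z i (heZ i hi) (hnWZ i hi),
      hU₂Z i (hnWZ i hi) (hyZ i hi), hU₁Z i (hWZ i hi) (hx₁Z i hi)]

/-- Orthonormal columns over `ℓ¹(ℤⁿ)` extend to a unitary matrix if there are enough
coordinates. -/
theorem exists_unitary_completion {k : ℕ} (v : Fin k → I → Wiener n)
    (hv : ∀ i j, star (v i) ⬝ᵥ v j = if i = j then 1 else 0) (e : Fin k ↪ I)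
    (hcard : n + 1 < 2 * (Fintype.card I + 1 - k)) :
    ∃ U : Matrix I I (Wiener n), Uᴴ * U = 1 ∧ ∀ j, U *ᵥ Pi.single (e j) 1 = v j := by
  induction k with
  | zero => exact ⟨1, by simp, fun j => j.elim0⟩
  | succ k ih =>
    obtain ⟨U, hU, hUe⟩ := ih (fun j => v j.castSucc) (fun i j => by simp [hv])
      ((Fin.castSuccEmb).trans e) (by omega)
    have hU' : U * Uᴴ = 1 := mul_eq_one_comm.1 hU
    set r : I → Wiener n := Uᴴ *ᵥ v (Fin.last k) with hr
    have hUr : U *ᵥ r = v (Fin.last k) := by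
      rw [hr, Matrix.mulVec_mulVec, hU', Matrix.one_mulVec]
    have hr1 : star r ⬝ᵥ r = 1 := by
      rw [← star_mulVec_dotProduct_mulVec hU, hUr, hv, if_pos rfl]
    have hr0 : ∀ j : Fin k, r (e j.castSucc) = 0 := by
      intro j
      have h1 := star_mulVec_dotProduct_mulVec hU (Pi.single (e j.castSucc) 1) r
      have h2 := hUe j
      simp only [Function.Embedding.trans_apply, Fin.castSuccEmb_apply] at h2
      rw [hUr, h2, hv, if_neg (Fin.castSucc_lt_last j).ne] at h1
      simpa using h1.symm
    obtain ⟨U', hU'1, hU'2, hU'3⟩ := exists_unitary_mulVec_single hr1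
      (Finset.univ.map ((Fin.castSuccEmb).trans e)) (by
        intro i hi
        obtain ⟨j, -, rfl⟩ := Finset.mem_map.1 hi
        exact hr0 j) (i₀ := e (Fin.last k)) (by
        intro hi
        obtain ⟨j, -, hj⟩ := Finset.mem_map.1 hi
        exact (Fin.castSucc_lt_last j).ne (e.injective hj)) (by
        rw [Finset.card_map, Finset.card_univ, Fintype.card_fin]
        omega)
    refine ⟨U * U', ?_, fun j => ?_⟩
    · rw [Matrix.conjTranspose_mul, Matrix.mul_assoc, ← Matrix.mul_assoc Uᴴ, hU, Matrix.one_mul,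
        hU'1]
    · rw [← Matrix.mulVec_mulVec]
      induction j using Fin.lastCases with
      | last => rw [hU'2, hUr]
      | cast j =>
        have := hU'3 (e j.castSucc) (Finset.mem_map.2 ⟨j, Finset.mem_univ _, rfl⟩)
        rw [this]
        exact hUe j

end

section

variable {n N : ℕ} {ι : Type*}

/-! ### Shift-invariant subspaces of `L²` -/

theorem PerBdd.shift {φ : (Fin n → ℝ) → ℂ} (h : PerBdd φ) (ν : Fin n → ℤ) :
    PerBdd fun x => φ (x - vec ν) := by
  rw [← sy_dl]
  exact h.sy (memSeq_dl 1 ν)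

/-- The integer shifts of a family, as elements of `L²`. -/
def shiftLp {w : ι → (Fin n → ℝ) → ℂ} (hw : ∀ i, PerBdd (w i)) (q : ι × (Fin n → ℤ)) :
    Lp ℂ 2 (volume : Measure (Fin n → ℝ)) :=
  (((hw q.1).shift q.2).memLp (p := 2) (by norm_num)).toLp _

theorem coeFn_shiftLp {w : ι → (Fin n → ℝ) → ℂ} (hw : ∀ i, PerBdd (w i)) (q : ι × (Fin n → ℤ)) :
    shiftLp hw q =ᵐ[volume] fun x => w q.1 (x - vec q.2) := MemLp.coeFn_toLp _

/-- The closed subspace of `L²` spanned by the integer shifts of a family. -/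
def shiftSpace {w : ι → (Fin n → ℝ) → ℂ} (hw : ∀ i, PerBdd (w i)) :
    Submodule ℂ (Lp ℂ 2 (volume : Measure (Fin n → ℝ))) :=
  (Submodule.span ℂ (Set.range (shiftLp hw))).topologicalClosure

theorem inner_shiftLp {w : ι → (Fin n → ℝ) → ℂ} (hw : ∀ i, PerBdd (w i)) (i : ι)
    (ν : Fin n → ℤ) (f : Lp ℂ 2 (volume : Measure (Fin n → ℝ))) :
    inner ℂ (shiftLp hw (i, ν)) f = an f (w i) ν := by
  rw [L2.inner_def, an]
  refine integral_congr_ae ?_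
  filter_upwards [coeFn_shiftLp hw (i, ν)] with x hx
  rw [hx, RCLike.inner_apply]

theorem mem_shiftSpace_orthogonal {w : ι → (Fin n → ℝ) → ℂ} (hw : ∀ i, PerBdd (w i))
    {f : Lp ℂ 2 (volume : Measure (Fin n → ℝ))} :
    f ∈ (shiftSpace hw)ᗮ ↔ ∀ i, an f (w i) = 0 := by
  rw [shiftSpace, Submodule.orthogonal_closure]
  constructor
  · intro h i
    ext ν
    rw [← inner_shiftLp hw]
    exact h _ (Submodule.subset_span ⟨(i, ν), rfl⟩)
  · intro h g hg
    induction hg using Submodule.span_induction with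
    | mem g hg =>
      obtain ⟨⟨i, ν⟩, rfl⟩ := hg
      rw [inner_shiftLp hw, h]
      rfl
    | zero => simp
    | add a b _ _ ha hb => rw [inner_add_left, ha, hb, add_zero]
    | smul z a _ ha => rw [inner_smul_left, ha, mul_zero]

variable [Fintype ι]

theorem syf_const_mul (φ : ι → (Fin n → ℝ) → ℂ) (z : ℂ) (c : ι → (Fin n → ℤ) → ℂ)
    (x : Fin n → ℝ) : syf φ (fun i ν => z * c i ν) x = z * syf φ c x := by
  simp only [syf, Finset.mul_sum, sy_const_mul]

variable [DecidableEq ι]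

/-- For orthonormal shifts, the closed span of the shifts consists of the series with square
summable coefficients. -/
theorem mem_shiftSpace_iff {w : ι → (Fin n → ℝ) → ℂ} (hb : Biorth w w)
    {f : Lp ℂ 2 (volume : Measure (Fin n → ℝ))} :
    f ∈ shiftSpace hb.left ↔ ∃ c : ι → (Fin n → ℤ) → ℂ, (∀ i, MemSeq 2 (c i)) ∧
      f =ᵐ[volume] syf w c := by
  have h2 : (1 : ℝ≥0∞) ≤ 2 := by norm_num
  have hP : ∀ f : Lp ℂ 2 (volume : Measure (Fin n → ℝ)), (∃ c : ι → (Fin n → ℤ) → ℂ,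
      (∀ i, MemSeq 2 (c i)) ∧ f =ᵐ[volume] syf w c) ↔ Pz w w f =ᵐ[volume] f := by
    intro f
    constructor
    · rintro ⟨c, hc, hf⟩
      rw [Pz_congr w w hf, hb.Pz_syf h2 hc]
      exact hf.symm
    · intro h
      exact ⟨_, fun i => (hb.left i).memSeq_an h2 (Lp.memLp f), h.symm⟩
  -- the fixed space of the projection is closed and contains the shifts
  obtain ⟨K, hK1, hK⟩ := exists_Pz_bound hb.left hb.left
  have hsub : ∀ f g : Lp ℂ 2 (volume : Measure (Fin n → ℝ)),
      Pz w w (f - g : Lp ℂ 2 (volume : Measure (Fin n → ℝ))) =ᵐ[volume]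
        fun x => Pz w w f x - Pz w w g x := by
    intro f g
    rw [Pz_congr w w (Lp.coeFn_sub f g)]
    exact Pz_sub hb.left hb.left h2 (Lp.memLp f) (Lp.memLp g)
  let S : Submodule ℂ (Lp ℂ 2 (volume : Measure (Fin n → ℝ))) :=
    { carrier := {f | ∃ c : ι → (Fin n → ℤ) → ℂ, (∀ i, MemSeq 2 (c i)) ∧ f =ᵐ[volume] syf w c}
      zero_mem' := ⟨fun _ => 0, fun i => by simp [MemSeq, seqNorm], by
        filter_upwards [Lp.coeFn_zero ℂ 2 (volume : Measure (Fin n → ℝ))] with x hx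
        rw [hx]; simp [syf, sy]⟩
      add_mem' := by
        rintro f g ⟨c, hc, hf⟩ ⟨d, hd, hg⟩
        refine ⟨fun i => c i + d i, fun i => (hc i).add (hd i), ?_⟩
        filter_upwards [Lp.coeFn_add f g, hf, hg, syf_add hb.left h2 hc hd] with x h1 h2 h3 h4
        rw [h1, h4, Pi.add_apply, h2, h3]
      smul_mem' := by
        rintro z f ⟨c, hc, hf⟩
        refine ⟨fun i ν => z * c i ν, fun i => (hc i).const_mul z, ?_⟩
        filter_upwards [Lp.coeFn_smul z f, hf] with x h1 h2
        rw [h1, Pi.smul_apply, h2, syf_const_mul, smul_eq_mul] }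
  have hclosed : IsClosed (S : Set (Lp ℂ 2 (volume : Measure (Fin n → ℝ)))) := by
    refine isClosed_of_closure_subset fun f hf => ?_
    refine (hP f).2 ?_
    have hle : eLpNorm (fun x => f x - Pz w w f x) 2 volume ≤ 0 := by
      refine le_of_forall_pos_le_add fun ε hε => ?_
      rw [zero_add]
      have hK0 : (1 + K : ℝ≥0∞) ≠ ∞ := by finiteness
      obtain ⟨g, hg, hfg⟩ := EMetric.mem_closure_iff.1 hf (ε / (1 + K))
        (ENNReal.div_pos hε.ne' hK0)
      have hgP := (hP g).1 hg
      have he : (fun x => f x - Pz w w f x) =ᵐ[volume]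
          (f - g : Lp ℂ 2 (volume : Measure (Fin n → ℝ))) -
            Pz w w (f - g : Lp ℂ 2 (volume : Measure (Fin n → ℝ))) := by
        filter_upwards [hsub f g, Lp.coeFn_sub f g, hgP] with x h1 h2 h3
        rw [Pi.sub_apply, h1, h2, Pi.sub_apply, h3]; ring
      rw [eLpNorm_congr_ae he]
      have hm := Lp.memLp (f - g)
      refine (eLpNorm_sub_le hm.1 (memLp_Pz hb.left hb.left h2 hm).1 h2).trans ?_
      have h3 : eLpNorm (f - g : Lp ℂ 2 (volume : Measure (Fin n → ℝ))) 2 volume ≤ ε / (1 + K) := by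
        rw [← Lp.enorm_def, ← edist_eq_enorm_sub]
        exact hfg.le
      calc _ ≤ eLpNorm (f - g : Lp ℂ 2 (volume : Measure (Fin n → ℝ))) 2 volume +
            K * eLpNorm (f - g : Lp ℂ 2 (volume : Measure (Fin n → ℝ))) 2 volume :=
            add_le_add le_rfl (hK 2 h2 _ hm)
        _ = (1 + K) * eLpNorm (f - g : Lp ℂ 2 (volume : Measure (Fin n → ℝ))) 2 volume := by ring
        _ ≤ (1 + K) * (ε / (1 + K)) := by gcongr
        _ ≤ ε := ENNReal.mul_div_le
    have h0 := (eLpNorm_eq_zero_iff ((Lp.memLp f).1.sub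
      (memLp_Pz hb.left hb.left h2 (Lp.memLp f)).1) (by norm_num)).1 (le_zero_iff.1 hle)
    filter_upwards [h0] with x hx
    exact (sub_eq_zero.1 hx).symm
  have hle : shiftSpace hb.left ≤ S := by
    refine Submodule.topologicalClosure_minimal _ (Submodule.span_le.2 ?_) hclosed
    rintro _ ⟨⟨i, ν⟩, rfl⟩
    refine ⟨Pi.single i (dl ν), fun j => ?_, ?_⟩
    · by_cases h : j = i
      · subst h; simpa using memSeq_dl 2 ν
      · simp [h, MemSeq, seqNorm]
    · filter_upwards [coeFn_shiftLp hb.left (i, ν)] with x hx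
      rw [hx, syf, Finset.sum_eq_single i]
      · rw [Pi.single_eq_same, sy_dl]
      · intro j _ hj; simp [hj, sy]
      · simp
  refine ⟨fun h => hle h, fun h => ?_⟩
  have : CompleteSpace (shiftSpace hb.left) :=
    (Submodule.isClosed_topologicalClosure _).completeSpace_coe
  obtain ⟨a, ha, b, hbo, rfl⟩ := (shiftSpace hb.left).exists_add_mem_mem_orthogonal f
  have hb0 : Pz w w b =ᵐ[volume] 0 := by
    have := (mem_shiftSpace_orthogonal hb.left).1 hbo
    refine Eventually.of_forall fun x => ?_
    simp [Pz, syf, this, sy]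
  have hbS : b ∈ S := by
    have := S.sub_mem h (hle ha)
    rwa [add_sub_cancel_left] at this
  have hbz : b = 0 := by
    refine (Lp.eq_zero_iff_ae_eq_zero).2 ?_
    exact ((hP b).1 hbS).symm.trans hb0
  rw [hbz, add_zero]
  exact ha

omit [Fintype ι] in
/-- The shifts of a self-dual family are orthonormal. -/
theorem orthonormal_shiftLp_iff {w : ι → (Fin n → ℝ) → ℂ} (hw : ∀ i, PerBdd (w i)) :
    Orthonormal ℂ (shiftLp hw) ↔ Biorth w w := by
  have key : ∀ (i j : ι) (μ ν : Fin n → ℤ), inner ℂ (shiftLp hw (i, μ)) (shiftLp hw (j, ν)) =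
      an (w j) (w i) (μ - ν) := by
    intro i j μ ν
    rw [inner_shiftLp, an, an, ← integral_sub_right_eq_self
      (fun x => w j x * conj (w i (x - vec (μ - ν)))) (vec ν)]
    refine integral_congr_ae ?_
    filter_upwards [coeFn_shiftLp hw (j, ν)] with x hx
    simp only [hx, vec_sub]
    congr 3
    abel
  rw [orthonormal_iff_ite]
  constructor
  · intro h
    refine ⟨hw, hw, fun i j ν => ?_⟩
    have := key j i ν 0
    rw [h, sub_zero] at this
    rw [← this]
    simp only [Prod.mk.injEq, and_comm, eq_comm]
  · rintro h ⟨i, μ⟩ ⟨j, ν⟩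
    rw [key, h.an_eq]
    simp only [Prod.mk.injEq, and_comm, eq_comm, sub_eq_zero]

end

section

variable {n N : ℕ}

/-! ### Digits -/

section digits
variable {M : Matrix (Fin n) (Fin n) ℤ} {Γ₀ : Finset (Fin n → ℤ)} {T : Set (Fin n → ℝ)}

theorem IsSelfAffineTile.eq_of_add_eq (hM : IsDilation M) (hT : IsSelfAffineTile M Γ₀ T)
    {d d' : Fin n → ℤ} (hd : d ∈ Γ₀) (hd' : d' ∈ Γ₀) {μ μ' : Fin n → ℤ}
    (h : d + M *ᵥ μ = d' + M *ᵥ μ') : d = d' ∧ μ = μ' := by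
  obtain ⟨e, -, he⟩ := hT.digits (d + M *ᵥ μ)
  have h1 := he d ⟨hd, μ, rfl⟩
  have h2 := he d' ⟨hd', μ', h⟩
  have h3 : d = d' := h1.trans h2.symm
  subst h3
  exact ⟨rfl, hM.mulVec_injective (add_left_cancel h)⟩

/-- The number of digits is `|det M|`, since `M T` is tiled by that many translates of `T`. -/
theorem IsSelfAffineTile.card_digits (hT : IsSelfAffineTile M Γ₀ T) :
    Γ₀.card = idx M := by
  have hfin : volume T ≠ ∞ := hT.compact.measure_lt_top.ne
  have htr : ∀ ν : Fin n → ℤ, volume ((fun x => x + vec ν) '' T) = volume T := fun ν => by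
    rw [Set.image_add_right, measure_preimage_add_right]
  have hpos : volume T ≠ 0 := by
    intro h0
    have : volume (Set.univ : Set (Fin n → ℝ)) = 0 := by
      rw [← hT.cover, measure_iUnion_null_iff]
      intro ν; rw [htr, h0]
    exact (isOpen_univ.measure_pos volume ⟨0, trivial⟩).ne' this
  have hclosed : ∀ ν : Fin n → ℤ, IsClosed ((fun x => x + vec ν) '' T) := fun ν =>
    (hT.compact.image (by fun_prop)).isClosed
  have h1 : volume (dil M 1 '' T) = Γ₀.card * volume T := by
    rw [← hT.selfAffine, measure_biUnion_finset₀]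
    · simp_rw [htr]
      simp
    · intro d _ d' _ hdd
      exact hT.disjoint d d' hdd
    · exact fun d _ => (hclosed d).measurableSet.nullMeasurableSet
  have h2 : volume (dil M 1 '' T) = idx M * volume T := by
    have := Measure.addHaar_image_linearMap (volume : Measure (Fin n → ℝ))
      (Matrix.toLin' (M.map (Int.cast : ℤ → ℝ))) T
    rw [LinearMap.det_toLin'] at this
    have hdet : (M.map (Int.cast : ℤ → ℝ)).det = (M.det : ℝ) := by
      have := (Int.castRingHom ℝ).map_det M
      simpa using this.symm
    have hd : dil M 1 '' T = (Matrix.toLin' (M.map (Int.cast : ℤ → ℝ))) '' T := by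
      refine Set.image_congr fun x _ => ?_
      simp [dil]
    rw [hd, this, hdet, idx, ← Int.cast_abs, Int.abs_eq_natAbs, Int.cast_natCast,
      ENNReal.ofReal_natCast]
  have h3 := h1.symm.trans h2
  rw [ENNReal.mul_left_inj hpos hfin] at h3
  exact_mod_cast h3

/-- The generators `m^{1/2} φ_k(M · - d)` of `V_1` for the lattice `ℤⁿ`. -/
def fine (M : Matrix (Fin n) (Fin n) ℤ) (Γ₀ : Finset (Fin n → ℤ))
    (φ : Fin N → (Fin n → ℝ) → ℂ) (i : Fin N × Γ₀) (x : Fin n → ℝ) : ℂ :=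
  ((√(idx M : ℝ) : ℝ) : ℂ) * φ i.1 (dil M 1 x - vec i.2)

theorem perBdd_fine (hM : IsDilation M) {φ : Fin N → (Fin n → ℝ) → ℂ} (hφ : ∀ j, PerBdd (φ j))
    (i : Fin N × Γ₀) : PerBdd (fine M Γ₀ φ i) :=
  (((hφ i.1).shift i.2).comp_dil hM).const_mul _

theorem Biorth.fine (hM : IsDilation M) (hT : IsSelfAffineTile M Γ₀ T)
    {φ : Fin N → (Fin n → ℝ) → ℂ} (hb : Biorth φ φ) : Biorth (fine M Γ₀ φ) (fine M Γ₀ φ) := by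
  refine ⟨perBdd_fine hM hb.left, perBdd_fine hM hb.left, ?_⟩
  -- a change of variables reduces the pairing to one of shifts of `φ` by `d` and `d' + M ν`,
  -- which agree only for `d = d'` and `ν = 0`
  rintro ⟨j, d⟩ ⟨k, d'⟩ ν
  have hm : (0 : ℝ) ≤ idx M := by positivity
  have h1 : an (SelfAffine.fine M Γ₀ φ (j, d)) (SelfAffine.fine M Γ₀ φ (k, d')) ν =
      an (φ j) (φ k) (M *ᵥ ν + (d' : Fin n → ℤ) - (d : Fin n → ℤ)) := by
    have h2 := hM.integral_dil 1 fun y => (idx M : ℂ) * (φ j (y - vec d) *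
      conj (φ k (y - vec (M *ᵥ ν) - vec d')))
    have h3 : ∀ x, SelfAffine.fine M Γ₀ φ (j, d) x *
        conj (SelfAffine.fine M Γ₀ φ (k, d') (x - vec ν)) = (idx M : ℂ) *
        (φ j (dil M 1 x - vec d) * conj (φ k (dil M 1 x - vec (M *ᵥ ν) - vec d'))) := by
      intro x
      have h4 : ((√(idx M : ℝ) : ℝ) : ℂ) * ((√(idx M : ℝ) : ℝ) : ℂ) = idx M := by
        rw [← Complex.ofReal_mul, Real.mul_self_sqrt hm]; simp
      simp only [SelfAffine.fine, map_mul, Complex.conj_ofReal, dil_sub, dil_vec, pow_one]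
      linear_combination φ j (dil M 1 x - vec d) *
        conj (φ k (dil M 1 x - vec (M *ᵥ ν) - vec d')) * h4
    have hm0 : (idx M : ℂ) ≠ 0 := by exact_mod_cast hM.idx_pos.ne'
    have h6 := integral_sub_right_eq_self (μ := (volume : Measure (Fin n → ℝ)))
      (fun y => φ j y * conj (φ k (y - vec (M *ᵥ ν + (d' : Fin n → ℤ) - (d : Fin n → ℤ))))) (vec d)
    rw [an, an, ← h6]
    simp only [h3]
    rw [h2, integral_const_mul, pow_one, inv_mul_cancel_left₀ hm0]
    refine integral_congr_ae (Eventually.of_forall fun y => ?_)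
    simp only [vec_sub, vec_add]
    congr 3
    abel
  rw [h1, hb.an_eq]
  have h5 : (M *ᵥ ν + d' - d = 0 ∧ j = k) ↔ (ν = 0 ∧ (j, d) = (k, d')) := by
    rw [sub_eq_zero, Prod.mk.injEq]
    constructor
    · rintro ⟨h, rfl⟩
      obtain ⟨h6, h7⟩ := hT.eq_of_add_eq hM d'.2 d.2 (μ := ν) (μ' := 0) (by
        rw [add_comm, h]; simp)
      exact ⟨h7, rfl, Subtype.ext h6.symm⟩
    · rintro ⟨rfl, rfl, rfl⟩
      simp
  simp only [h5]

/-- Series in the fine generators are functions in `V_1`. -/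
theorem syf_fine (hM : IsDilation M) {φ : Fin N → (Fin n → ℝ) → ℂ} (hφ : ∀ j, PerBdd (φ j))
    {p : ℝ≥0∞} (hp : 1 ≤ p) {c : Fin N × Γ₀ → (Fin n → ℤ) → ℂ} (hc : ∀ i, MemSeq p (c i)) :
    syf (fine M Γ₀ φ) c =ᵐ[volume] fun x => syf φ (fun k ν =>
      ((√(idx M : ℝ) : ℝ) : ℂ) * ∑ d : Γ₀, dconv M (c (k, d)) (dl d) ν) (dil M 1 x) := by
  have hmem : ∀ i : Fin N × Γ₀, MemSeq p (dconv M (c i) (dl i.2)) := fun i =>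
    (hc i).dconv hM hp (memSeq_dl 1 _)
  have h1 : ∀ᵐ x, ∀ i : Fin N × Γ₀, sy (fun x => sy (φ i.1) (dl i.2) (dil M 1 x)) (c i) x =
      sy (φ i.1) (dconv M (c i) (dl i.2)) (dil M 1 x) :=
    ae_all_iff.2 fun i => sy_comp_dil hM (hφ i.1) hp (hc i) (memSeq_dl 1 _)
  have h2 : ∀ᵐ x, ∀ k, sy (φ k) (fun ν => ∑ d : Γ₀, dconv M (c (k, d)) (dl d) ν) (dil M 1 x) =
      ∑ d : Γ₀, sy (φ k) (dconv M (c (k, d)) (dl d)) (dil M 1 x) :=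
    ae_all_iff.2 fun k => hM.ae_dil 1 (sy_sum (hφ k) hp Finset.univ fun d _ => hmem (k, d))
  filter_upwards [h1, h2] with x h1 h2
  rw [syf_const_mul, syf, syf]
  simp only [h2]
  rw [Fintype.sum_prod_type, Finset.mul_sum]
  refine Finset.sum_congr rfl fun k _ => ?_
  rw [Finset.mul_sum]
  refine Finset.sum_congr rfl fun d _ => ?_
  rw [← h1 (k, d)]
  simp only [sy_dl]
  simp only [sy, fine, ← tsum_mul_left]
  exact tsum_congr fun ν => by ring

theorem sum_dconv_digits (hM : IsDilation M) (hT : IsSelfAffineTile M Γ₀ T)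
    (c : (Fin n → ℤ) → ℂ) (σ : Fin n → ℤ) :
    ∑ d : Γ₀, dconv M (fun μ => c (d + M *ᵥ μ)) (dl d) σ = c σ := by
  obtain ⟨d, ⟨hd, μ, rfl⟩, hu⟩ := hT.digits σ
  rw [Finset.sum_eq_single ⟨d, hd⟩]
  · rw [dconv, tsum_eq_single μ]
    · simp [dl]
    · intro κ hκ
      rw [dl, Pi.single_eq_of_ne, mul_zero]
      intro h
      refine hκ (hM.mulVec_injective ?_)
      simpa [add_sub_assoc, sub_eq_zero, eq_comm] using h
  · rintro ⟨d', hd'⟩ _ hne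
    rw [dconv, ← tsum_zero]
    refine tsum_congr fun κ => ?_
    rw [dl, Pi.single_eq_of_ne, mul_zero]
    intro h
    refine hne (Subtype.ext ?_)
    exact ((hT.eq_of_add_eq hM hd hd' (μ := μ) (μ' := κ) (sub_eq_iff_eq_add.1 h)).1).symm
  · simp

theorem MemSeq.comp_injective {p : ℝ≥0∞} {c : (Fin n → ℤ) → ℂ} (hc : MemSeq p c)
    {f : (Fin n → ℤ) → (Fin n → ℤ)} (hf : Function.Injective f) : MemSeq p fun ν => c (f ν) := by
  have h1 : Measure.map f Measure.count ≤ Measure.count := by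
    refine Measure.le_iff.2 fun s hs => ?_
    rw [Measure.map_apply (measurable_of_countable f) hs,
      ← Measure.count_injective_image hf (f ⁻¹' s)]
    exact measure_mono (Set.image_preimage_subset f s)
  have h2 : MeasurableEmbedding f :=
    ⟨hf, measurable_of_countable f, fun _ _ => .of_discrete⟩
  refine lt_of_le_of_lt (le_of_eq ?_) ((eLpNorm_mono_measure c h1).trans_lt hc)
  exact (h2.eLpNorm_map_measure (g := c)).symm

theorem IsDilation.sqrt_idx_ne_zero (hM : IsDilation M) : ((√(idx M : ℝ) : ℝ) : ℂ) ≠ 0 := by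
  have : (0 : ℝ) < idx M := by exact_mod_cast hM.idx_pos
  exact_mod_cast (Real.sqrt_pos.2 this).ne'

theorem MemSeq.digit (hM : IsDilation M) {p : ℝ≥0∞} {b : (Fin n → ℤ) → ℂ} (hb : MemSeq p b)
    (d : Fin n → ℤ) : MemSeq p fun μ => ((√(idx M : ℝ) : ℝ) : ℂ)⁻¹ * b (d + M *ᵥ μ) :=
  (hb.comp_injective (f := fun μ => d + M *ᵥ μ) fun _ _ h =>
    hM.mulVec_injective (add_left_cancel h)).const_mul _

theorem synth_one_eq_syf_fine (hM : IsDilation M) (hT : IsSelfAffineTile M Γ₀ T)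
    {φ : Fin N → (Fin n → ℝ) → ℂ} (hφ : ∀ j, PerBdd (φ j)) {p : ℝ≥0∞} (hp : 1 ≤ p)
    {b : Fin N → (Fin n → ℤ) → ℂ} (hb : ∀ j, MemSeq p (b j)) :
    synth M φ 1 b =ᵐ[volume] syf (fine M Γ₀ φ)
      fun i μ => ((√(idx M : ℝ) : ℝ) : ℂ)⁻¹ * b i.1 (i.2 + M *ᵥ μ) := by
  refine EventuallyEq.trans ?_ (syf_fine hM hφ hp fun i => (hb i.1).digit hM i.2).symm
  refine Eventually.of_forall fun x => ?_
  simp only [synth_eq]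
  congr 1
  ext k ν
  rw [← sum_dconv_digits hM hT (b k) ν, Finset.mul_sum]
  refine Finset.sum_congr rfl fun d _ => ?_
  simp only [dconv, ← tsum_mul_left, mul_assoc]
  exact tsum_congr fun μ => by rw [mul_inv_cancel_left₀ hM.sqrt_idx_ne_zero]

/-- Functions in `V_1` are the series in the fine generators. -/
theorem inV_one_iff (hM : IsDilation M) (hT : IsSelfAffineTile M Γ₀ T)
    {φ : Fin N → (Fin n → ℝ) → ℂ} (hφ : ∀ j, PerBdd (φ j)) {p : ℝ≥0∞} (hp : 1 ≤ p)
    {S : (Fin n → ℝ) → ℂ} :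
    InV M p φ 1 S ↔ ∃ c : Fin N × Γ₀ → (Fin n → ℤ) → ℂ, (∀ i, MemSeq p (c i)) ∧
      S =ᵐ[volume] syf (fine M Γ₀ φ) c := by
  constructor
  · rintro ⟨b, hb, hS⟩
    exact ⟨_, fun i => (hb i.1).digit hM i.2, hS.trans (synth_one_eq_syf_fine hM hT hφ hp hb)⟩
  · rintro ⟨c, hc, hS⟩
    refine ⟨_, fun k => MemSeq.const_mul (memSeq_sum Finset.univ fun d _ =>
      (hc (k, d)).dconv hM hp (memSeq_dl 1 _)) _, hS.trans (syf_fine hM hφ hp hc)⟩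

/-- The projection onto `V_1` in terms of the fine generators. -/
theorem proj_one_eq_Pz_fine (hM : IsDilation M) (hT : IsSelfAffineTile M Γ₀ T)
    {φ : Fin N → (Fin n → ℝ) → ℂ} (hφ : ∀ j, PerBdd (φ j)) {p : ℝ≥0∞} (hp : 1 ≤ p)
    {f : (Fin n → ℝ) → ℂ} (hf : MemLp f p volume) :
    proj M φ φ 1 f =ᵐ[volume] Pz (fine M Γ₀ φ) (fine M Γ₀ φ) f := by
  have hb : ∀ j, MemSeq p (fun ν => (idx M : ℂ) ^ 1 * pairing M f (φ j) 1 ν) := fun j => by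
    simp only [hM.pairing_eq]
    exact (hφ j).memSeq_an hp (hM.memLp_undil 1 hf)
  refine (synth_one_eq_syf_fine hM hT hφ hp hb).trans (Eventually.of_forall fun x => ?_)
  rw [Pz]
  congr 1
  ext i μ
  have h1 : ((√(idx M : ℝ) : ℝ) : ℂ) * ((√(idx M : ℝ) : ℝ) : ℂ) = idx M := by
    rw [← Complex.ofReal_mul, Real.mul_self_sqrt (by positivity)]; simp
  rw [pow_one, ← mul_assoc, ← h1, inv_mul_cancel_left₀ hM.sqrt_idx_ne_zero, pairing, an,
    ← integral_const_mul]
  refine integral_congr_ae (Eventually.of_forall fun y => ?_)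
  simp only [SelfAffine.fine, map_mul, Complex.conj_ofReal, dil_sub, dil_vec, pow_one, vec_add]
  rw [mul_left_comm, sub_sub, add_comm (vec _)]

end digits

end

section

variable {n N : ℕ}

/-! ### Changing generators -/

section change
variable {I J : Type*} [Fintype I] [Fintype J]

omit [Fintype I] [Fintype J] in
theorem gram_congr {f f' : I → (Fin n → ℝ) → ℂ} {g g' : J → (Fin n → ℝ) → ℂ}
    (hf : ∀ i, f i =ᵐ[volume] f' i) (hg : ∀ j, g j =ᵐ[volume] g' j) : gram f g = gram f' g' := by
  ext i j
  classical
  exact congrArg (fun c => if h : MemSeq 1 c then Wiener.mk c h else 0) (an_congr (hf i) (hg j))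

/-- Let the orthonormal shifts of a family `w` be combinations of the orthonormal shifts of a family
`F` of the same size. As square isometric matrices over the commutative ring `ℓ¹(ℤⁿ)` are unitary,
the two families span the same space, in every `L^p`. -/
theorem Pz_eq_of_act [DecidableEq I] [DecidableEq J] {F : I → (Fin n → ℝ) → ℂ}
    {w : J → (Fin n → ℝ) → ℂ} (hF : Biorth F F) (hw : Biorth w w) (U : Matrix J I (Wiener n))
    (hU : ∀ j, w j =ᵐ[volume] act U F j) (e : J ≃ I) {p : ℝ≥0∞} (hp : 1 ≤ p)
    {f : (Fin n → ℝ) → ℂ} (hf : MemLp f p volume) : Pz F F f =ᵐ[volume] Pz w w f := by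
  have h1 : U * Uᴴ = 1 := by
    rw [← (biorth_iff_gram hw.left hw.left).1 hw, gram_congr hU hU,
      gram_act_left hF.left (perBdd_act hF.left U), gram_act_right hF.left hF.left,
      (biorth_iff_gram hF.left hF.left).1 hF, Matrix.one_mul]
  have h2 : Uᴴ * U = 1 := (Matrix.mul_eq_one_comm_of_equiv e).1 h1
  have h3 : ∀ i, F i =ᵐ[volume] act Uᴴ w i := by
    intro i
    refine EventuallyEq.trans ?_ (act_congr (fun j => hU j) Uᴴ i).symm
    refine EventuallyEq.trans ?_ (act_mul hF.left Uᴴ U i)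
    rw [h2, act_one]
  have hc : ∀ i, MemSeq p (an f (F i)) := fun i => (hF.left i).memSeq_an hp hf
  refine (syf_congr h3 _).trans ((syf_act hw.left Uᴴ hp hc).trans ?_)
  refine Eventually.of_forall fun x => ?_
  rw [Pz]
  congr 1
  ext j ν
  rw [an_congr (EventuallyEq.refl _ f) (hU j), act]
  have h4 := an_sum_right Finset.univ (g := fun i => sy (F i) (U j i).coef)
    (fun i _ => (hF.left i).sy (U j i).memSeq_coef) hp hf
  have h5 : syf F (fun i => (U j i).coef) = fun x => ∑ i, sy (F i) (U j i).coef x := rfl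
  rw [h5, h4]
  simp only [vact]
  refine Finset.sum_congr rfl fun i _ => ?_
  rw [an_sy_right hp hf (hF.left i) (U j i).memSeq_coef, Matrix.conjTranspose_apply,
    Wiener.coef_star]

variable {M : Matrix (Fin n) (Fin n) ℤ} {φ E : Fin N → (Fin n → ℝ) → ℂ}

theorem InV.of_act (hM : IsDilation M) (hE : ∀ j, PerBdd (E j)) {S : Matrix (Fin N) (Fin N) (Wiener n)}
    (h : ∀ j, φ j =ᵐ[volume] act S E j) {p : ℝ≥0∞} (hp : 1 ≤ p) {l : ℕ} {g : (Fin n → ℝ) → ℂ}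
    (hg : InV M p φ l g) : InV M p E l g := by
  obtain ⟨c, hc, hg⟩ := hg
  refine ⟨vact c S, fun j => memSeq_vact hp hc S j, hg.trans ?_⟩
  filter_upwards [hM.ae_dil l (syf_congr h c), hM.ae_dil l (syf_act hE S hp hc)] with x h1 h2
  simp only [synth_eq, h1, h2]

theorem approxError_congr {p : ℝ≥0∞} {l : ℕ} (h : ∀ g, InV M p φ l g ↔ InV M p E l g)
    (f : (Fin n → ℝ) → ℂ) : approxError M p φ l f = approxError M p E l f := by
  refine le_antisymm (le_iInf₂ fun S hS => ?_) (le_iInf₂ fun S hS => ?_)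
  · obtain ⟨c, hc, rfl⟩ := mem_V_iff.1 hS
    exact approxError_le ((h _).2 ⟨c, hc, EventuallyEq.rfl⟩) f
  · obtain ⟨c, hc, rfl⟩ := mem_V_iff.1 hS
    exact approxError_le ((h _).1 ⟨c, hc, EventuallyEq.rfl⟩) f

theorem inV_zero_self {p : ℝ≥0∞} (j : Fin N) : InV M p φ 0 (φ j) := by
  refine ⟨Pi.single j (dl 0), fun k => ?_, Eventually.of_forall fun x => ?_⟩
  · by_cases h : k = j
    · subst h; simpa using memSeq_dl p 0
    · simp [h, MemSeq, seqNorm]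
  · simp only [synth_eq, dil_zero]
    rw [syf, Finset.sum_eq_single j]
    · simp [sy_dl]
    · intro k _ hk; simp [hk, sy]
    · simp

/-- Refinability depends only on the spaces `V_0` and `V_1`. -/
theorem Refinable.of_inV_iff (hM : IsDilation M) (hφ : ∀ j, PerBdd (φ j)) (href : Refinable M φ)
    (h : ∀ l g, InV M 1 φ l g ↔ InV M 1 E l g) : Refinable M E := by
  have h1 : ∀ j, InV M 1 E 1 (E j) := fun j =>
    (h 1 _).1 (((h 0 _).2 (inV_zero_self j)).succ hM le_rfl hφ href)
  choose c hc he using h1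
  exact ⟨c, hc, he⟩

/-- Refinable families with stable shifts have orthonormal refinable generators of the same
spaces `V_l`. -/
theorem exists_orthonormal_refinable (hM : IsDilation M) (hφ : ∀ j, PerBdd (φ j))
    (hL : LowerStable φ) (href : Refinable M φ) :
    ∃ E : Fin N → (Fin n → ℝ) → ℂ, Biorth E E ∧ Refinable M E ∧
      ∀ (p : ℝ≥0∞), 1 ≤ p → ∀ l g, InV M p φ l g ↔ InV M p E l g := by
  obtain ⟨B, S, -, hSB, hE⟩ := exists_orthonormal_generators hφ hL
  have h1 : ∀ j, φ j =ᵐ[volume] act S (act B φ) j := fun j => by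
    refine EventuallyEq.trans ?_ (act_mul hφ S B j)
    rw [hSB, act_one]
  have h2 : ∀ (p : ℝ≥0∞), 1 ≤ p → ∀ l g, InV M p φ l g ↔ InV M p (act B φ) l g :=
    fun p hp l g => ⟨fun h => h.of_act hM hE.left h1 hp,
      fun h => h.of_act hM hφ (fun _ => EventuallyEq.rfl) hp⟩
  exact ⟨act B φ, hE, href.of_inV_iff hM hφ (h2 1 le_rfl), h2⟩

theorem mem_V₂_iff {l : ℕ} {g : Lp ℂ 2 (volume : Measure (Fin n → ℝ))} :
    g ∈ V₂ M φ l ↔ InV M 2 φ l g := by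
  constructor
  · rintro ⟨S, hS, hg⟩
    obtain ⟨c, hc, rfl⟩ := mem_V_iff.1 hS
    exact ⟨c, hc, hg⟩
  · rintro ⟨c, hc, hg⟩
    exact ⟨_, mem_V_iff.2 ⟨c, hc, rfl⟩, hg⟩

theorem W₀_congr (h : ∀ l g, InV M 2 φ l g ↔ InV M 2 E l g) : W₀ M φ = W₀ M E := by
  have : ∀ l, V₂ M φ l = V₂ M E l := fun l => Set.ext fun g => by rw [mem_V₂_iff, mem_V₂_iff, h]
  simp only [W₀, this]

/-- For orthonormal generators, orthogonality to `V_0` is the vanishing of the coefficients. -/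
theorem forall_V₂_zero_inner_iff (hE : Biorth E E) {g : Lp ℂ 2 (volume : Measure (Fin n → ℝ))} :
    (∀ h ∈ V₂ M E 0, inner ℂ h g = 0) ↔ ∀ j, an g (E j) = 0 := by
  rw [← mem_shiftSpace_orthogonal hE.left]
  have : ∀ h, h ∈ V₂ M E 0 ↔ h ∈ shiftSpace hE.left := fun h => by
    rw [mem_V₂_iff, mem_shiftSpace_iff hE, InV]
    simp only [synth_eq, dil_zero]
  simp only [this]
  rfl

end change

end

section

variable {n N : ℕ}

/-! ### Wavelets -/

/-- The orthonormal shifts of the family `w` lie in `V_1` and are orthogonal to `V_0`, where the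
generators `E` of these spaces have orthonormal shifts. -/
structure IsOrthoCompl {K : Type*} [DecidableEq K] (M : Matrix (Fin n) (Fin n) ℤ)
    (E : Fin N → (Fin n → ℝ) → ℂ) (w : K → (Fin n → ℝ) → ℂ) : Prop where
  biorth : Biorth w w
  inV : ∀ k, InV M 1 E 1 (w k)
  orth : ∀ j k, an (w k) (E j) = 0

section wavelets
variable {K : Type*} [DecidableEq K] [Fintype K] {M : Matrix (Fin n) (Fin n) ℤ}
  {Γ₀ : Finset (Fin n → ℤ)} {T : Set (Fin n → ℝ)} {E : Fin N → (Fin n → ℝ) → ℂ}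
  {w : K → (Fin n → ℝ) → ℂ}

omit [Fintype K] in
theorem IsOrthoCompl.biorth_sum (hE : Biorth E E) (hw : IsOrthoCompl M E w) :
    Biorth (Sum.elim E w) (Sum.elim E w) := by
  have hP : ∀ i, PerBdd (Sum.elim E w i) := by
    rintro (j | k)
    exacts [hE.left j, hw.biorth.left k]
  refine ⟨hP, hP, ?_⟩
  rintro (i | i) (j | j) ν
  · simp [hE.an_eq]
  · simp only [Sum.elim_inl, Sum.elim_inr, reduceCtorEq, and_false, if_false]
    rw [an_conj (w j), hw.orth]
    simp [bstar]
  · simp [hw.orth]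
  · simp [hw.biorth.an_eq]

/-- The projection onto `V_1` splits into those onto `V_0` and onto the span of the wavelets. -/
theorem IsOrthoCompl.proj_one_eq (hM : IsDilation M) (hT : IsSelfAffineTile M Γ₀ T)
    (hE : Biorth E E) (href : Refinable M E) (hw : IsOrthoCompl M E w)
    (e : Fin N ⊕ K ≃ Fin N × Γ₀) {p : ℝ≥0∞} (hp : 1 ≤ p) {f : (Fin n → ℝ) → ℂ}
    (hf : MemLp f p volume) :
    proj M E E 1 f =ᵐ[volume] fun x => Pz E E f x + Pz w w f x := by
  have h1 : ∀ i, InV M 1 E 1 (Sum.elim E w i) := by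
    rintro (j | k)
    exacts [(inV_zero_self j).succ hM le_rfl hE.left href, hw.inV k]
  choose c hc he using fun i => (inV_one_iff hM hT hE.left le_rfl).1 (h1 i)
  have h2 := Pz_eq_of_act (hE.fine hM hT) (hw.biorth_sum hE)
    (fun i k => Wiener.mk (c i k) (hc i k)) he e hp hf
  refine (proj_one_eq_Pz_fine hM hT hE.left hp hf).trans (h2.trans ?_)
  refine Eventually.of_forall fun x => ?_
  simp [Pz, syf, Fintype.sum_sum_type]

/-- The closed span of the shifts of the wavelets is the orthogonal complement of `V_0` in
`V_1`. -/
theorem IsOrthoCompl.shiftSpace_eq (hM : IsDilation M) (hT : IsSelfAffineTile M Γ₀ T)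
    (hE : Biorth E E) (href : Refinable M E) (hw : IsOrthoCompl M E w)
    (e : Fin N ⊕ K ≃ Fin N × Γ₀) :
    (shiftSpace hw.biorth.left : Set (Lp ℂ 2 (volume : Measure (Fin n → ℝ)))) = W₀ M E := by
  have h2 : (1 : ℝ≥0∞) ≤ 2 := by norm_num
  ext g
  rw [SetLike.mem_coe, mem_shiftSpace_iff hw.biorth, W₀, Set.mem_ofPred_eq, mem_V₂_iff,
    forall_V₂_zero_inner_iff hE]
  have hg := Lp.memLp g
  have hsplit := hw.proj_one_eq hM hT hE href e h2 hg
  have hz : (∀ j, an g (E j) = 0) → ∀ x, Pz E E g x = 0 := fun h x => by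
    simp [Pz, syf, h, sy]
  constructor
  · rintro ⟨c, hc, hgc⟩
    have h3 : ∀ j, an g (E j) = 0 := by
      intro j
      have h4 := an_sum (hE.left j) h2 Finset.univ (f := fun k => sy (w k) (c k))
        fun k _ => (hw.biorth.left k).memLp_sy h2 (hc k)
      rw [an_congr hgc (EventuallyEq.refl _ (E j))]
      refine Eq.trans h4 ?_
      ext ν
      refine Finset.sum_eq_zero fun k _ => ?_
      rw [an_sy (hw.biorth.left k) (hE.left j) h2 (hc k), hw.orth]
      simp [cconv]
    refine ⟨?_, h3⟩
    obtain ⟨b, hb, hgb⟩ := inV_proj (M := M) (φ := E) hM h2 hE.left 1 hg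
    refine ⟨b, hb, EventuallyEq.trans ?_ hgb⟩
    have h5 : Pz w w g =ᵐ[volume] g := by
      rw [Pz_congr w w hgc, hw.biorth.Pz_syf h2 hc]
      exact hgc.symm
    filter_upwards [hsplit, h5] with x h6 h7
    rw [h6, h7, hz h3, zero_add]
  · rintro ⟨hV, h3⟩
    refine ⟨_, fun k => (hw.biorth.left k).memSeq_an h2 hg, ?_⟩
    filter_upwards [hsplit, proj_of_inV hM h2 hE hV] with x h6 h7
    rw [← h7, h6, hz h3, zero_add]
    rfl

end wavelets

section exist
variable {M : Matrix (Fin n) (Fin n) ℤ} {Γ₀ : Finset (Fin n → ℤ)} {T : Set (Fin n → ℝ)}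
  {E : Fin N → (Fin n → ℝ) → ℂ} {ψ : Fin (idx M - 1) → Fin N → (Fin n → ℝ) → ℂ}

theorem nonempty_index_equiv (hM : IsDilation M) (hT : IsSelfAffineTile M Γ₀ T) (N : ℕ) :
    Nonempty (Fin N ⊕ (Fin (idx M - 1) × Fin N) ≃ Fin N × Γ₀) := by
  refine ⟨Fintype.equivOfCardEq ?_⟩
  simp only [Fintype.card_sum, Fintype.card_prod, Fintype.card_fin, Fintype.card_coe,
    hT.card_digits]
  obtain ⟨m, hm⟩ := Nat.exists_eq_add_of_lt hM.idx_pos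
  rw [hm]
  simp
  ring

/-- Orthonormality in `L²` is biorthogonality of the shifts, and completeness is automatic: the
number of wavelets already forces their span to be the whole complement. -/
theorem isWavelet_iff (hM : IsDilation M) (hT : IsSelfAffineTile M Γ₀ T) (hE : Biorth E E)
    (href : Refinable M E) :
    IsWavelet M T E ψ ↔ IsOrthoCompl M E fun k : Fin (idx M - 1) × Fin N => ψ k.1 k.2 := by
  have h2 : (1 : ℝ≥0∞) ≤ 2 := by norm_num
  obtain ⟨e⟩ := nonempty_index_equiv hM hT N
  constructor
  · rintro ⟨hψ, Ψ, hΨ, hon, hspan⟩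
    have hw : ∀ k : Fin (idx M - 1) × Fin N, PerBdd (ψ k.1 k.2) := fun k =>
      (memPer_top_iff hT).1 (hψ k.1 k.2)
    have hΨw : ∀ ε j ν, Ψ (ε, j, ν) = shiftLp hw ((ε, j), ν) := fun ε j ν =>
      Lp.ext ((hΨ ε j ν).trans (coeFn_shiftLp hw ((ε, j), ν)).symm)
    have hb : Biorth (fun k : Fin (idx M - 1) × Fin N => ψ k.1 k.2) fun k => ψ k.1 k.2 := by
      rw [← orthonormal_shiftLp_iff hw]
      have : shiftLp hw = Ψ ∘ Equiv.prodAssoc _ _ _ := by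
        ext1 ⟨⟨ε, j⟩, ν⟩
        exact (hΨw ε j ν).symm
      rw [this]
      exact hon.comp _ (Equiv.injective _)
    have hmem : ∀ k : Fin (idx M - 1) × Fin N, Ψ (k.1, k.2, 0) ∈ W₀ M E := fun k => by
      rw [← hspan]
      exact Submodule.le_topologicalClosure _ (Submodule.subset_span ⟨_, rfl⟩)
    have hae : ∀ k : Fin (idx M - 1) × Fin N, Ψ (k.1, k.2, 0) =ᵐ[volume] ψ k.1 k.2 := fun k => by
      refine (hΨ k.1 k.2 0).trans (Eventually.of_forall fun x => ?_)
      simp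
    refine ⟨hb, fun k => ?_, fun j k => ?_⟩
    -- the square summable coefficients are pairings of functions in `𝓛^∞`, hence summable
    · obtain ⟨c, hc, he⟩ := (inV_one_iff hM hT hE.left h2).1 (mem_V₂_iff.1 (hmem k).1)
      have he' := (hae k).symm.trans he
      have hc1 : ∀ i, MemSeq 1 (c i) := fun i => by
        rw [← (hE.fine hM hT).an_syf h2 hc i, ← an_congr he' (EventuallyEq.refl _ _)]
        exact ((hE.fine hM hT).left i).memSeq_an le_rfl ((hw k).memLp le_rfl)
      exact (inV_one_iff hM hT hE.left le_rfl).2 ⟨c, hc1, he'⟩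
    · rw [← an_congr (hae k) (EventuallyEq.refl _ (E j))]
      exact (forall_V₂_zero_inner_iff hE).1 (hmem k).2 j
  · intro h
    have hw := h.biorth.left
    refine ⟨fun ε j => (memPer_top_iff hT).2 (hw (ε, j)),
      shiftLp hw ∘ (Equiv.prodAssoc _ _ _).symm, fun ε j ν => coeFn_shiftLp hw ((ε, j), ν),
      ((orthonormal_shiftLp_iff hw).2 h.biorth).comp _ (Equiv.injective _), ?_⟩
    rw [Set.range_comp, Equiv.range_eq_univ, Set.image_univ, ← h.shiftSpace_eq hM hT hE href e]
    rfl

/-- Orthonormal generators of `V_0` extend to generators of `V_1` by completing an isometric matrix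
over `ℓ¹(ℤⁿ)` to a unitary one, which `(n + 1) / 2 < m` leaves enough room for. -/
theorem exists_isOrthoCompl (hM : IsDilation M) (hT : IsSelfAffineTile M Γ₀ T) (hE : Biorth E E)
    (href : Refinable M E) (hN : 0 < N) (hm : n + 1 < 2 * idx M) :
    ∃ ψ : Fin (idx M - 1) → Fin N → (Fin n → ℝ) → ℂ,
      IsOrthoCompl M E fun k : Fin (idx M - 1) × Fin N => ψ k.1 k.2 := by
  have hF := hE.fine (Γ₀ := Γ₀) hM hT
  -- the refinement equation expresses `E` through the fine generators by a matrix `v` with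
  -- orthonormal rows, which are completed to a square unitary matrix
  choose c hc he using fun j => (inV_one_iff hM hT hE.left le_rfl).1
    ((inV_zero_self (φ := E) j).succ hM le_rfl hE.left href)
  let v : Matrix (Fin N) (Fin N × Γ₀) (Wiener n) := fun j i => Wiener.mk (c j i) (hc j i)
  have hv : ∀ j, E j =ᵐ[volume] act v (fine M Γ₀ E) j := he
  have hvv : v * vᴴ = 1 := by
    rw [← (biorth_iff_gram hE.left hE.left).1 hE, gram_congr hv hv,
      gram_act_left hF.left (perBdd_act hF.left v), gram_act_right hF.left hF.left,
      (biorth_iff_gram hF.left hF.left).1 hF, Matrix.one_mul]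
  have hcardΓ : Fintype.card Γ₀ = idx M := by rw [Fintype.card_coe, hT.card_digits]
  have hidx := hM.idx_pos
  obtain ⟨d₀⟩ : Nonempty Γ₀ := Fintype.card_pos_iff.1 (hcardΓ ▸ hidx)
  obtain ⟨U, hU, hUv⟩ := exists_unitary_completion v
    (fun i j => by
      have := congrFun (congrFun hvv j) i
      rw [Matrix.mul_apply, Matrix.one_apply] at this
      simp only [dotProduct, Pi.star_apply, mul_comm (star _), eq_comm (a := i)]
      exact this)
    ⟨fun j => (j, d₀), fun i j h => (Prod.mk.inj h).1⟩
    (by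
      rw [Fintype.card_prod, Fintype.card_fin, hcardΓ]
      obtain ⟨m, hm'⟩ := Nat.exists_eq_add_of_lt hidx
      rw [hm'] at hm ⊢
      have : m ≤ N * m := Nat.le_mul_of_pos_left _ hN
      rw [zero_add, mul_add, mul_one]
      omega)
  set V : Matrix (Fin N × Γ₀) (Fin N × Γ₀) (Wiener n) := Uᵀ with hV
  have hVV : V * Vᴴ = 1 := by
    have := congrArg Matrix.transpose hU
    rw [Matrix.transpose_mul, Matrix.transpose_one] at this
    exact this
  have hw : Biorth (act V (fine M Γ₀ E)) (act V (fine M Γ₀ E)) := by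
    rw [biorth_iff_gram (perBdd_act hF.left V) (perBdd_act hF.left V),
      gram_act_left hF.left (perBdd_act hF.left V), gram_act_right hF.left hF.left,
      (biorth_iff_gram hF.left hF.left).1 hF, Matrix.one_mul, hVV]
  have hwE : ∀ j, act V (fine M Γ₀ E) (j, d₀) =ᵐ[volume] E j := by
    intro j
    refine EventuallyEq.trans (Eventually.of_forall fun x => ?_) (hv j).symm
    rw [act, act]
    congr 1
    ext1 i
    rw [← hUv j]
    simp only [hV, Matrix.transpose_apply, Matrix.mulVec_single_one, Matrix.col_apply]
    rfl
  -- the wavelets are the rows with a digit other than `d₀`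
  have hcard' : Fintype.card {d : Γ₀ // d ≠ d₀} = idx M - 1 := by
    rw [Fintype.card_subtype_compl, Fintype.card_subtype_eq, hcardΓ]
  let ι : Fin (idx M - 1) ≃ {d : Γ₀ // d ≠ d₀} := (Fintype.equivFinOfCardEq hcard').symm
  refine ⟨fun ε j => act V (fine M Γ₀ E) (j, (ι ε : Γ₀)), ⟨fun k => hw.left _, fun k => hw.left _,
    fun k k' ν => ?_⟩, fun k => ?_, fun j k => ?_⟩
  · rw [hw.an_eq]
    simp only [Subtype.val_inj, ι.injective.eq_iff, Prod.ext_iff, and_comm]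
  · exact (inV_one_iff hM hT hE.left le_rfl).2
      ⟨_, fun i => (V _ i).memSeq_coef, EventuallyEq.rfl⟩
  · rw [← an_congr (EventuallyEq.refl _ _) (hwE j)]
    ext ν
    rw [hw.an_eq, if_neg]
    · rfl
    · rintro ⟨-, h⟩
      exact (ι k.1).2 (Prod.mk.inj h).2

end exist

end

section

variable {n N : ℕ}

/-! ### The wavelet norm -/

theorem IsDilation.undil_undil {M : Matrix (Fin n) (Fin n) ℤ} (hM : IsDilation M) (l : ℕ)
    (x : Fin n → ℝ) : undil M l (undil M 1 x) = undil M (l + 1) x := by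
  rw [← hM.undil_dil (l + 1) (undil M l (undil M 1 x)), add_comm l 1, ← dil_dil, hM.dil_undil,
    hM.dil_undil]

theorem IsDilation.proj_succ {M : Matrix (Fin n) (Fin n) ℤ} (hM : IsDilation M)
    (φ φ' : Fin N → (Fin n → ℝ) → ℂ) (l : ℕ) (f : (Fin n → ℝ) → ℂ) :
    proj M φ φ' (l + 1) f =
      fun x => proj M φ φ' 1 (fun x => f (undil M l x)) (dil M l x) := by
  ext x
  rw [hM.proj_eq, hM.proj_eq]
  simp only [hM.undil_undil, dil_dil, add_comm 1 l]

theorem seqNorm_const_mul (p : ℝ≥0∞) (z : ℂ) (c : (Fin n → ℤ) → ℂ) :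
    seqNorm p (fun ν => z * c ν) = ‖z‖ₑ * seqNorm p c :=
  eLpNorm_const_smul z c p Measure.count

theorem waveletCoeff_eq {M : Matrix (Fin n) (Fin n) ℤ} (hM : IsDilation M)
    (f ψ : (Fin n → ℝ) → ℂ) (l : ℕ) (ν : Fin n → ℤ) :
    waveletCoeff M f ψ l ν =
      (((idx M : ℝ) ^ (-((l : ℝ) / 2)) : ℝ) : ℂ) * an (fun x => f (undil M l x)) ψ ν := by
  have hm : (0 : ℝ) < idx M := by exact_mod_cast hM.idx_pos
  have h1 := hM.pairing_eq f (fun y => (((idx M : ℝ) ^ ((l : ℝ) / 2) : ℝ) : ℂ) * ψ y) l ν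
  have hm0 : ((idx M : ℂ) ^ l) ≠ 0 := pow_ne_zero _ (by exact_mod_cast hM.idx_pos.ne')
  have h2 : (((idx M : ℝ) ^ ((l : ℝ) / 2) : ℝ) : ℂ) =
      (idx M : ℂ) ^ l * (((idx M : ℝ) ^ (-((l : ℝ) / 2)) : ℝ) : ℂ) := by
    have : ((idx M : ℂ) ^ l) = (((idx M : ℝ) ^ (l : ℝ) : ℝ) : ℂ) := by
      rw [Real.rpow_natCast]; push_cast; rfl
    rw [this, ← Complex.ofReal_mul, ← Real.rpow_add hm]
    congr 2
    ring
  rw [an_const_mul_right, Complex.conj_ofReal] at h1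
  rw [waveletCoeff]
  refine mul_left_cancel₀ hm0 ?_
  refine h1.trans ?_
  simp only [h2, mul_assoc]

theorem seqNorm_waveletCoeff {M : Matrix (Fin n) (Fin n) ℤ} (hM : IsDilation M)
    (f ψ : (Fin n → ℝ) → ℂ) (l : ℕ) (p : ℝ≥0∞) :
    wt (idx M) (l / 2) * seqNorm p (waveletCoeff M f ψ l) =
      seqNorm p (an (fun x => f (undil M l x)) ψ) := by
  have hm : (0 : ℝ) < idx M := by exact_mod_cast hM.idx_pos
  rw [funext (waveletCoeff_eq hM f ψ l), seqNorm_const_mul, ← mul_assoc]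
  have : ‖(((idx M : ℝ) ^ (-((l : ℝ) / 2)) : ℝ) : ℂ)‖ₑ = wt (idx M) (-((l : ℝ) / 2)) := by
    rw [← ofReal_norm, Complex.norm_real, Real.norm_of_nonneg (by positivity), wt]
  rw [this, mul_comm (wt _ _), wt_neg_mul hm, one_mul]

section equiv
variable {M : Matrix (Fin n) (Fin n) ℤ} {Γ₀ : Finset (Fin n → ℤ)} {T : Set (Fin n → ℝ)}
  {φ φ' E : Fin N → (Fin n → ℝ) → ℂ} {ψ : Fin (idx M - 1) → Fin N → (Fin n → ℝ) → ℂ}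
  {p q : ℝ≥0∞} {lam α : ℝ}

/-- The details of the orthogonal projections are the wavelet series. -/
theorem detail_eq_wavelet (hM : IsDilation M) (hT : IsSelfAffineTile M Γ₀ T) (hE : Biorth E E)
    (href : Refinable M E)
    (hψ : IsOrthoCompl M E fun k : Fin (idx M - 1) × Fin N => ψ k.1 k.2) (hp : 1 ≤ p) (l : ℕ)
    {f : (Fin n → ℝ) → ℂ} (hf : MemLp f p volume) :
    detail M E E l f =ᵐ[volume] fun x => Pz (fun k : Fin (idx M - 1) × Fin N => ψ k.1 k.2)
      (fun k => ψ k.1 k.2) (fun x => f (undil M l x)) (dil M l x) := by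
  obtain ⟨e⟩ := nonempty_index_equiv hM hT N
  filter_upwards [hM.ae_dil l (hψ.proj_one_eq hM hT hE href e hp (hM.memLp_undil l hf))] with x hx
  rw [detail, hM.proj_succ, hM.proj_eq _ _ l]
  simp only [hx]
  ring

/-- The size of the `l`-th detail is that of the wavelet coefficients at scale `l`. -/
theorem exists_detail_equiv_wavelet (hM : IsDilation M) (hT : IsSelfAffineTile M Γ₀ T)
    (hE : Biorth E E) (href : Refinable M E)
    (hψ : IsOrthoCompl M E fun k : Fin (idx M - 1) × Fin N => ψ k.1 k.2) (hp : 1 ≤ p) :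
    ∃ K : ℝ≥0, ∀ (l : ℕ) (f : (Fin n → ℝ) → ℂ), MemLp f p volume →
      eLpNorm (detail M E E l f) p volume ≤ K * (wt (idx M) (l * (1 / 2 - p⁻¹.toReal)) *
        ∑ j, ∑ ε, seqNorm p (waveletCoeff M f (ψ ε j) l)) ∧
      wt (idx M) (l * (1 / 2 - p⁻¹.toReal)) *
        ∑ j, ∑ ε, seqNorm p (waveletCoeff M f (ψ ε j) l) ≤
        K * eLpNorm (detail M E E l f) p volume := by
  obtain ⟨A, -, hA⟩ := exists_common_bound hψ.biorth.left
  refine ⟨A + Fintype.card (Fin (idx M - 1) × Fin N) * A, fun l f hf => ?_⟩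
  have hm : (0 : ℝ) < idx M := by exact_mod_cast hM.idx_pos
  have hg := hM.memLp_undil l hf
  set g : (Fin n → ℝ) → ℂ := fun x => f (undil M l x) with hgdef
  set w : Fin (idx M - 1) × Fin N → (Fin n → ℝ) → ℂ := fun k => ψ k.1 k.2 with hwdef
  have hc : ∀ k, MemSeq p (an g (w k)) := fun k => (hψ.biorth.left k).memSeq_an hp hg
  have h1 : eLpNorm (detail M E E l f) p volume =
      wt (idx M) (-(l * p⁻¹.toReal)) * eLpNorm (Pz w w g) p volume := by
    rw [eLpNorm_congr_ae (detail_eq_wavelet hM hT hE href hψ hp l hf)]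
    exact hM.eLpNorm_dil l p (Pz w w g)
  have h2 : wt (idx M) (l * (1 / 2 - p⁻¹.toReal)) *
      ∑ j, ∑ ε, seqNorm p (waveletCoeff M f (ψ ε j) l) =
      wt (idx M) (-(l * p⁻¹.toReal)) * ∑ k, seqNorm p (an g (w k)) := by
    rw [show (l : ℝ) * (1 / 2 - p⁻¹.toReal) = -(l * p⁻¹.toReal) + l / 2 by ring, wt_add hm,
      mul_assoc, Finset.sum_comm, ← Fintype.sum_prod_type'
        fun ε j => seqNorm p (waveletCoeff M f (ψ ε j) l), Finset.mul_sum]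
    simp only [seqNorm_waveletCoeff hM, hgdef, hwdef]
  have h3 : eLpNorm (Pz w w g) p volume ≤ A * ∑ k, seqNorm p (an g (w k)) :=
    eLpNorm_syf_le hA hp hc
  have h4 : ∑ k, seqNorm p (an g (w k)) ≤
      Fintype.card (Fin (idx M - 1) × Fin N) * (A * eLpNorm (Pz w w g) p volume) := by
    refine (Finset.sum_le_card_nsmul _ _ _ fun k _ =>
      hψ.biorth.seqNorm_le hA hp hc k).trans (le_of_eq ?_)
    rw [nsmul_eq_mul]; rfl
  rw [h1, h2]
  push_cast
  constructor
  · rw [mul_left_comm]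
    gcongr
    exact h3.trans (mul_le_mul_left le_self_add _)
  · rw [mul_left_comm]
    gcongr
    refine h4.trans ?_
    rw [← mul_assoc]
    exact mul_le_mul_left le_add_self _

/-- The wavelet norm is dominated by the Besov norm. -/
theorem wavelet_bddBy_besov (hM : IsDilation M) (hT : IsSelfAffineTile M Γ₀ T) (hp : 1 ≤ p)
    (hb : Biorth φ φ') (hE : Biorth E E) (href : Refinable M E)
    (hφE : ∀ l g, InV M p φ l g ↔ InV M p E l g)
    (hψ : IsOrthoCompl M E fun k : Fin (idx M - 1) × Fin N => ψ k.1 k.2) :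
    BddBy p (normWavelet M p q α lam φ' ψ) (besovNorm M p q α lam φ) := by
  refine BddBy.add (A := fun f => ∑ j, seqNorm p (fun ν => pairing M f (φ' j) 0 ν)) ?_ ?_
  · obtain ⟨A, -, hA⟩ := exists_common_bound hb.right
    refine ⟨N * A, fun f hf => ?_⟩
    have h1 : ∀ j, seqNorm p (fun ν => pairing M f (φ' j) 0 ν) ≤ A * eLpNorm f p volume :=
      fun j => by
        simp only [pairing, dil_zero]
        exact (hA j).seqNorm_an_le hp hf.1
    refine (Finset.sum_le_card_nsmul _ _ _ fun j _ => h1 j).trans ?_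
    rw [nsmul_eq_mul, Finset.card_univ, Fintype.card_fin, ← mul_assoc]
    push_cast
    gcongr
    exact le_self_add
  · have h1 : BddBy p (normDetail M p q α lam E E) (besovNorm M p q α lam φ) := by
      have : besovNorm M p q α lam φ = besovNorm M p q α lam E := by
        ext f
        simp only [besovNorm, approxError_congr (hφE _)]
      rw [this]
      exact (detail_bddBy_proj hM hp hE href).trans (proj_bddBy_besov hM hp hE)
    refine BddBy.trans ?_ h1
    obtain ⟨K, hK⟩ := exists_detail_equiv_wavelet hM hT hE href hψ hp
    refine ⟨K, fun f hf => ?_⟩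
    rw [normDetail, mul_add]
    refine le_trans (seqNorm_le_mul (C := K) fun l => ?_) le_add_self
    rw [mul_assoc, mul_left_comm (K : ℝ≥0∞)]
    exact mul_le_mul_right (hK l f hf).2 _

/-- The Besov norm is dominated by the wavelet norm. -/
theorem besov_bddBy_wavelet (hM : IsDilation M) (hT : IsSelfAffineTile M Γ₀ T) (hp : 1 ≤ p)
    (hq : 1 ≤ q) (hlam : 1 < lam) (hα : 0 < α) (hN : 0 < N)
    (hb : Biorth φ φ') (hE : Biorth E E) (href : Refinable M E)
    (hφE : ∀ l g, InV M p φ l g ↔ InV M p E l g)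
    (hψ : IsOrthoCompl M E fun k : Fin (idx M - 1) × Fin N => ψ k.1 k.2) :
    BddBy p (besovNorm M p q α lam φ) (normWavelet M p q α lam φ' ψ) := by
  have h1 : BddBy p (besovNorm M p q α lam φ) (normDetail M p q α lam E E) := by
    have : besovNorm M p q α lam φ = besovNorm M p q α lam E := by
      ext f
      simp only [besovNorm, approxError_congr (hφE _)]
    rw [this]
    exact (besov_bddBy_proj hM hp hE).trans (proj_bddBy_detail hM hp hq hlam hα hN hE href)
  have h2 : BddBy p (fun f => seqNorm q fun l : ℕ =>
      wt lam (l * α) * eLpNorm (detail M E E l f) p volume) (normWavelet M p q α lam φ' ψ) := by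
    obtain ⟨K, hK⟩ := exists_detail_equiv_wavelet hM hT hE href hψ hp
    refine ⟨K, fun f hf => ?_⟩
    rw [normWavelet, mul_add]
    refine le_trans (seqNorm_le_mul (C := K) fun l => ?_) le_add_self
    rw [mul_assoc, mul_left_comm (K : ℝ≥0∞)]
    exact mul_le_mul_right (hK l f hf).1 _
  refine h1.trans (BddBy.add ?_ h2)
  -- the oblique projection onto `V_0` fixes the orthogonal projection, so that the two differ by
  -- the image of the sum of the details
  obtain ⟨K, -, hK⟩ := exists_proj_bound hM hb.left hb.right
  obtain ⟨C, hC⟩ := exists_hardy hlam hα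
  obtain ⟨K', hK'⟩ := h2
  obtain ⟨A, -, hA⟩ := exists_common_bound hb.left
  refine ⟨A + K * (C * K'), fun f hf => ?_⟩
  have hQ := memLp_proj hM hp hE.left hE.right 0 hf
  have hP := memLp_proj hM hp hb.left hb.right 0 hf
  have hfQ : MemLp (fun x => f x - proj M E E 0 f x) p volume := hf.sub hQ
  have he : proj M E E 0 f =ᵐ[volume]
      proj M φ φ' 0 f - proj M φ φ' 0 (fun x => f x - proj M E E 0 f x) := by
    filter_upwards [proj_sub hM hp hb.left hb.right 0 hf hQ, proj_of_inV hM hp hb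
      ((hφE 0 _).2 (inV_proj hM hp hE.right 0 hf))] with x h3 h4
    rw [Pi.sub_apply, h3, h4]
    ring
  have h3 : eLpNorm (proj M φ φ' 0 f) p volume ≤
      A * ∑ j, seqNorm p (fun ν => pairing M f (φ' j) 0 ν) := by
    have hc : ∀ j, MemSeq p (fun ν => pairing M f (φ' j) 0 ν) := fun j => by
      simp only [pairing, dil_zero]
      exact (hb.right j).memSeq_an hp hf
    have : proj M φ φ' 0 f = syf φ (fun j ν => pairing M f (φ' j) 0 ν) := by
      ext x
      simp only [proj, synth_eq, dil_zero, pow_zero, one_mul]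
    rw [this]
    exact eLpNorm_syf_le hA hp hc
  have h4 : eLpNorm (fun x => f x - proj M E E 0 f x) p volume ≤
      C * (K' * normWavelet M p q α lam φ' ψ f) := by
    have h0 := eLpNorm_sub_proj_le hM hN hE href hp hf 0
    simp only [zero_add] at h0
    refine h0.trans ((hC q hq fun l => eLpNorm (detail M E E l f) p volume).2.trans ?_)
    gcongr
    exact hK' f hf
  calc eLpNorm (proj M E E 0 f) p volume
      ≤ eLpNorm (proj M φ φ' 0 f) p volume +
        eLpNorm (proj M φ φ' 0 (fun x => f x - proj M E E 0 f x)) p volume := by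
        rw [eLpNorm_congr_ae he]
        exact eLpNorm_sub_le hP.1 (memLp_proj hM hp hb.left hb.right 0 hfQ).1 hp
    _ ≤ A * normWavelet M p q α lam φ' ψ f +
        K * (C * (K' * normWavelet M p q α lam φ' ψ f)) := by
        refine add_le_add (h3.trans ?_) ((hK p hp 0 _ hfQ).trans ?_)
        · gcongr
          exact le_self_add
        · gcongr
    _ = _ := by push_cast; ring

end equiv

end

end SelfAffine

end

theorem theorem2 {n N : ℕ} (hn : 1 ≤ n) (hN : 1 ≤ N)
    (M : Matrix (Fin n) (Fin n) ℤ) (hM : IsDilation M)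
    (Γ₀ : Finset (Fin n → ℤ)) (T : Set (Fin n → ℝ)) (hT : IsSelfAffineTile M Γ₀ T)
    (φ : Fin N → (Fin n → ℝ) → ℂ) (hφ : ∀ j, MemPer T ∞ (φ j))
    (href : Refinable M φ) (hstab : StableShifts 2 φ)
    (lam α : ℝ) (hlam : 1 < lam) (hα : 0 < α)
    (p q : ℝ≥0∞) (hp : 1 ≤ p) (hq : 1 ≤ q) :
    (∃ φ' : Fin N → (Fin n → ℝ) → ℂ, IsDual T φ φ') ∧
    ∀ φ' : Fin N → (Fin n → ℝ) → ℂ, IsDual T φ φ' →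
      -- (i)
      NormEquiv p (besovNorm M p q α lam φ) (normProj M p q α lam φ φ') ∧
      -- (ii)
      NormEquiv p (besovNorm M p q α lam φ) (normDetail M p q α lam φ φ') ∧
      -- (iii)
      (∀ f : (Fin n → ℝ) → ℂ, MemLp f p volume → ∃! a, IsCoeff M p φ φ' f a) ∧
      (∃ C : ℝ≥0, 0 < C ∧ ∀ f : (Fin n → ℝ) → ℂ, MemLp f p volume →
        ∀ a, IsCoeff M p φ φ' f a →
          besovNorm M p q α lam φ f ≤ C * coeffNorm M p q α lam a ∧
          coeffNorm M p q α lam a ≤ C * besovNorm M p q α lam φ f) ∧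
      -- (iv)
      NormEquiv p (besovNorm M p q α lam φ) (normInf M p q α lam φ) ∧
      -- (v)
      (((n : ℝ) + 1) / 2 < (idx M : ℝ) →
        (∃ ψ : Fin (idx M - 1) → Fin N → (Fin n → ℝ) → ℂ, IsWavelet M T φ ψ) ∧
        ∀ ψ : Fin (idx M - 1) → Fin N → (Fin n → ℝ) → ℂ, IsWavelet M T φ ψ →
          NormEquiv p (besovNorm M p q α lam φ) (normWavelet M p q α lam φ' ψ)) := by
  have hφ' : ∀ j, PerBdd (φ j) := fun j => (memPer_top_iff hT).1 (hφ j)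
  have hL : LowerStable φ := by
    obtain ⟨C₁, C₂, hC₁, -, h⟩ := hstab
    exact ⟨C₁, hC₁, fun c hc => (h c hc).1⟩
  refine ⟨?_, fun φ' hd => ?_⟩
  · obtain ⟨φ', hb⟩ := exists_biorth hφ' hL
    exact ⟨φ', hb.isDual hT⟩
  have hb := hd.biorth hT hφ
  have h_proj : BddBy p (besovNorm M p q α lam φ) (normProj M p q α lam φ φ') :=
    besov_bddBy_proj hM hp hb
  have h_proj' : BddBy p (normProj M p q α lam φ φ') (besovNorm M p q α lam φ) :=
    proj_bddBy_besov hM hp hb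
  have h_detail : BddBy p (besovNorm M p q α lam φ) (normDetail M p q α lam φ φ') :=
    h_proj.trans (proj_bddBy_detail hM hp hq hlam hα hN hb href)
  have h_detail' : BddBy p (normDetail M p q α lam φ φ') (besovNorm M p q α lam φ) :=
    (detail_bddBy_proj hM hp hb href).trans h_proj'
  refine ⟨normEquiv_iff.2 ⟨h_proj, h_proj'⟩, normEquiv_iff.2 ⟨h_detail, h_detail'⟩,
    fun f hf => existsUnique_isCoeff hM hp hb href hf, ?_, normEquiv_iff.2
      ⟨besov_bddBy_inf hM hp hq hlam hα hb href, inf_bddBy_besov hM hp hq hlam hα hb href⟩,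
    fun hm => ?_⟩
  · obtain ⟨C, hC⟩ := exists_coeffNorm_equiv (q := q) hM hp hq hlam hα hb
    obtain ⟨D, -, hD⟩ := normEquiv_iff.2 ⟨h_detail, h_detail'⟩
    refine ⟨1 + C * D, by positivity, fun f hf a ha => ?_⟩
    obtain ⟨h1, h2⟩ := hC f a ha
    obtain ⟨h3, h4⟩ := hD f hf
    have hle : ∀ x : ℝ≥0∞, C * (D * x) ≤ (1 + C * D : ℝ≥0) * x := fun x => by
      rw [← mul_assoc]
      gcongr
      push_cast
      exact le_add_self
    refine ⟨h3.trans (le_trans ?_ (hle _)), h1.trans (le_trans ?_ (hle _))⟩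
    · rw [mul_left_comm]
      gcongr
    · gcongr
  · obtain ⟨E, hE, hrefE, hV⟩ := exists_orthonormal_refinable hM hφ' hL href
    have h2 : (1 : ℝ≥0∞) ≤ 2 := by norm_num
    have hiff : ∀ ψ, IsWavelet M T φ ψ ↔
        IsOrthoCompl M E fun k : Fin (idx M - 1) × Fin N => ψ k.1 k.2 := fun ψ => by
      rw [← isWavelet_iff hM hT hE hrefE, IsWavelet, IsWavelet, W₀_congr (hV 2 h2)]
    have hm' : n + 1 < 2 * idx M := by
      rw [div_lt_iff₀ (by norm_num)] at hm
      have : ((n + 1 : ℕ) : ℝ) < ((2 * idx M : ℕ) : ℝ) := by push_cast; linarith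
      exact_mod_cast this
    simp only [hiff]
    exact ⟨exists_isOrthoCompl hM hT hE hrefE hN hm', fun ψ hψ => normEquiv_iff.2
      ⟨besov_bddBy_wavelet hM hT hp hq hlam hα hN hb hE hrefE (hV p hp) hψ,
        wavelet_bddBy_besov hM hT hp hb hE hrefE (hV p hp) hψ⟩⟩
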